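/- Let $N\ge 2$, let $F_N$ be the free group with basis $A=\{a_1,\dots,a_N\}$, let $X$ be its Cayley tree with respect to $A$, and let $\partial F_N=\partial X$ be its boundary. Let $\mathcal C_N$ be the space of closed subsets of $\partial X$ with at least two points, with the Vietoris topology. A subset current on $F_N$ is an $F_N$-invariant Borel measure on $\mathcal C_N$ that is finite on compact sets. The set $\mathcal S\mathrm{Curr}(F_N)$ of subset currents is an $\mathbb R_{\ge0}$-module; it carries the weak-* topology (convergence of integrals of compactly supported continuous functions on $\mathcal C_N$). $\mathrm{Out}(F_N)$ acts on it by pushing forward along the homeomorphisms of $\partial F_N$ induced by automorphisms. For a nontrivial finitely generated subgroup $H\le F_N$ with limit set $\Lambda(H)\subset\partial X$ and commensurator $\widehat H=\mathrm{Comm}_{F_N}(H)$, put $\eta_H=[\widehat H:H]\sum_{H'\in[\widehat H]}\delta_{\Lambda(H')}$, where $[\widehat H]$ is the conjugacy class of $\widehat H$, and put $\eta_{\{1\}}=0$. For a free group $L$ of finite rank let $\overline{\mathrm{rk}}(L)=\max\{\mathrm{rank}(L)-1,0\}$, and for finitely generated $H,K\le F_N$ let $$\mathcal N(H,K)=\sum_{HgK\in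 H\backslash F_N/K}\overline{\mathrm{rk}}(H\cap gKg^{-1}).$$ Theorem. For every finitely generated $H\le F_N$, $\eta_H$ is a subset current. There is a unique continuous, symmetric, $\mathbb R_{\ge0}$-bilinear functional $$\mathcal N:\mathcal S\mathrm{Curr}(F_N)\times\mathcal S\mathrm{Curr}(F_N)\to\mathbb R_{\ge0}$$ such that $\mathcal N(\eta_H,\eta_K)=\mathcal N(H,K)$ (in particular this sum is finite) for all finitely generated subgroups $H,K\le F_N$. It is $\mathrm{Out}(F_N)$-invariant: $\mathcal N(\varphi\mu,\varphi\nu)=\mathcal N(\mu,\nu)$ for all $\varphi\in\mathrm{Out}(F_N)$ and $\mu,\nu\in\mathcal S\mathrm{Curr}(F_N)$. Moreover $\mathcal N=\widehat E-\widehat V+\widehat c$, where the three terms are finite and are defined as follows. For a finite subtree $T\subset X$ with at least one edge, $\mathrm{SCyl}(T)\subset\mathcal C_N$ is the set of all $S$ that are contained in the union of the cylinders $\mathrm{Cyl}(e)$ of the terminal edges $e$ of $T$ (oriented towards the vertices of degree one) and meet each of these cylinders; here $\mathrm{Cyl}(e)\subset\partial X$ is the set of ends of the geodesic rays that start with $e$.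 Let $e_a$ be the edge $\{1,a\}$, let $\mathcal R_1$ be the set of finite subtrees containing the vertex $1$ with degree at least two and all of whose vertices of degree one are adjacent to $1$, and let $\mathrm{Conv}(S)\subset X$ be the convex hull of $S\in\mathcal C_N$. Then $$\widehat E(\mu,\nu)=\sum_{a\in A}\mu(\mathrm{SCyl}(e_a))\,\nu(\mathrm{SCyl}(e_a)),\qquad \widehat V(\mu,\nu)=\Big(\sum_{T\in\mathcal R_1}\mu(\mathrm{SCyl}(T))\Big)\Big(\sum_{T\in\mathcal R_1}\nu(\mathrm{SCyl}(T))\Big),$$ $$\widehat c(\mu,\nu)=\sum_{[T]}(\mu\times\nu)\big(\{(S_1,S_2):\mathrm{Conv}(S_1)\cap\mathrm{Conv}(S_2)=T\}\big),$$ where $[T]$ runs over the finite nonempty subtrees $T$ of $X$ containing $1$ (the single vertex included) modulo translation by $F_N$. Finally, for all finitely generated $H,K\le F_N$, $\widehat c(\eta_H,\eta_K)$ is the number of contractible connected components of the fiber product $\Delta_H\times_{R_N}\Delta_K$ over the $N$-petalled rose $R_N=F_N\backslash X$, where $\Delta_H=H\backslash\mathrm{Conv}(\Lambda(H))$ (the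 empty graph if $H$ is trivial). -/

import Mathlib

open Filter Topology MeasureTheory
open scoped NNReal ENNReal CompactlySupported

noncomputable section

namespace FreeCurr

/-- The free group `F_N` on the basis `a_0, …, a_{N-1}`; it is also the vertex set of the Cayley
tree `X` of `F_N`. -/
abbrev F (N : ℕ) : Type := FreeGroup (Fin N)
/-- A letter `a_i` (`(i, true)`) or `a_i⁻¹` (`(i, false)`), i.e. the label of an oriented edge of `X`. -/
abbrev Letter (N : ℕ) : Type := Fin N × Bool

/-- The boundary `∂X = ∂F_N`: every class of geodesic rays of the tree `X` contains exactly one ray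
starting at the identity, and these rays are the infinite reduced words. -/
def Boundary (N : ℕ) : Type :=
  {ξ : ℕ → Letter N // ∀ n, (ξ n).1 = (ξ (n + 1)).1 → (ξ n).2 = (ξ (n + 1)).2}

variable {N : ℕ}

/-- The topology of `∂X`: agreement of longer and longer prefixes (the topology whose basis consists
of the cylinders), that is, the topology of the product of discrete spaces. -/
instance : TopologicalSpace (Boundary N) :=
  inferInstanceAs (TopologicalSpace
    {ξ : ℕ → Letter N // ∀ n, (ξ n).1 = (ξ (n + 1)).1 → (ξ n).2 = (ξ (n + 1)).2})

/-- Convergence `u k → ξ` in `X ∪ ∂X` of a sequence of vertices: every letter of the reduced word of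
`u k` eventually exists and agrees with the corresponding letter of `ξ`. -/
def ConvergesTo (u : ℕ → F N) (ξ : Boundary N) : Prop :=
  ∀ i, ∀ᶠ k in atTop, (u k).toWord[i]? = some (ξ.1 i)

/-- The `n`-th vertex of the geodesic ray from the identity to `ξ`. -/
def Boundary.pre (ξ : Boundary N) (n : ℕ) : F N :=
  FreeGroup.mk (List.ofFn fun i : Fin n => ξ.1 i)

theorem toWord_mul_letter (g : F N) (x : Letter N) :
    (g * FreeGroup.mk [x]).toWord = g.toWord ++ [x] ∨
      (g * FreeGroup.mk [x]).toWord = g.toWord.dropLast := by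
  rw [FreeGroup.toWord_mul, FreeGroup.toWord_mk, FreeGroup.reduce_singleton]
  rcases List.eq_nil_or_concat g.toWord with h | ⟨l, y, h⟩
  · left; simp [h]
  · rw [List.concat_eq_append] at h
    have hr : FreeGroup.IsReduced g.toWord := FreeGroup.isReduced_toWord
    by_cases hxy : y.1 = x.1 → y.2 = x.2
    · left
      apply FreeGroup.IsReduced.reduce_eq
      rw [h] at hr ⊢
      refine FreeGroup.IsReduced.append_overlap (L₁ := l) (by simpa using hr) ?_ (by simp)
      simpa using hxy
    · right
      push Not at hxy
      have e : x = (y.1, !y.2) := by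
        obtain ⟨h1, h2⟩ := hxy
        ext
        · exact congrArg Fin.val h1.symm
        · cases hy : y.2 <;> cases hx : x.2 <;> simp_all
      have hl : FreeGroup.IsReduced l := hr.infix ⟨[], [y], by simp [h]⟩
      have hs : FreeGroup.Red.Step (l ++ [y] ++ [x]) l := by
        subst e
        simpa using FreeGroup.Red.Step.not (L₁ := l) (L₂ := []) (x := y.1) (b := y.2)
      rw [h, FreeGroup.reduce.Step.eq hs, hl.reduce_eq, List.dropLast_concat]

theorem norm_mul_letter_ge (g : F N) (x : Letter N) :
    g.norm ≤ (g * FreeGroup.mk [x]).norm + 1 := by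
  rcases toWord_mul_letter g x with h | h <;> simp only [FreeGroup.norm, h] <;> simp <;> omega

theorem getElem?_mul_letter (g : F N) (x : Letter N) {i : ℕ} (hi : i + 1 < g.norm) :
    (g * FreeGroup.mk [x]).toWord[i]? = g.toWord[i]? := by
  simp only [FreeGroup.norm] at hi
  rcases toWord_mul_letter g x with h | h <;> rw [h]
  · rw [List.getElem?_append_left (by omega)]
  · rw [List.getElem?_dropLast, if_pos (by omega)]

theorem getElem?_mul_mk (l : List (Letter N)) (g : F N) {i : ℕ} (hi : i + l.length < g.norm) :
    (g * FreeGroup.mk l).toWord[i]? = g.toWord[i]? := by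
  induction l generalizing g with
  | nil => simp [← FreeGroup.one_eq_mk]
  | cons x l ih =>
    have e : g * FreeGroup.mk (x :: l) = g * FreeGroup.mk [x] * FreeGroup.mk l := by
      rw [mul_assoc, FreeGroup.mul_mk]; simp
    simp only [List.length_cons] at hi
    have := norm_mul_letter_ge g x
    rw [e, ih _ (by omega), getElem?_mul_letter g x (by omega)]

theorem getElem?_of_norm_inv_mul_le {g h : F N} {L i : ℕ} (hL : (g⁻¹ * h).norm ≤ L)
    (hi : i + L < g.norm) : h.toWord[i]? = g.toWord[i]? := by
  have := getElem?_mul_mk (g⁻¹ * h).toWord g (i := i)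
    (by simp only [FreeGroup.norm] at *; omega)
  rwa [FreeGroup.mk_toWord, mul_inv_cancel_left] at this

theorem finite_norm_le (n : ℕ) : {g : F N | g.norm ≤ n}.Finite :=
  ((List.finite_length_le (Letter N) n).preimage FreeGroup.toWord_injective.injOn).subset
    (fun _ h => h)

/-- Injective self-maps of `F_N` that are Lipschitz for the word metric. Left translations and
automorphisms are of this kind. -/
structure IsCoarse (f : F N → F N) : Prop where
  inj : Function.Injective f
  step : ∃ L, ∀ g x, ((f g)⁻¹ * f (g * FreeGroup.mk [x])).norm ≤ L

theorem IsCoarse.proper {f : F N → F N} (hf : IsCoarse f) (m : ℕ) :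
    ∃ M, ∀ g : F N, M ≤ g.norm → m ≤ (f g).norm := by
  obtain ⟨M, hM⟩ := (((finite_norm_le (N := N) m).preimage hf.inj.injOn).image
    FreeGroup.norm).bddAbove
  refine ⟨M + 1, fun g hg => ?_⟩
  by_contra h
  have := hM ⟨g, show (f g).norm ≤ m by omega, rfl⟩
  omega

theorem IsCoarse.stable {f : F N → F N} (hf : IsCoarse f) (i : ℕ) :
    ∃ M, ∀ (g : F N) (l : List (Letter N)), M ≤ g.norm → FreeGroup.IsReduced (g.toWord ++ l) →
      (f (g * FreeGroup.mk l)).toWord[i]? = (f g).toWord[i]? ∧ i < (f g).norm := by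
  obtain ⟨L, hL⟩ := hf.step
  obtain ⟨M, hM⟩ := hf.proper (i + L + 1)
  refine ⟨M, fun g l hg hl => ⟨?_, by have := hM g hg; omega⟩⟩
  induction l generalizing g with
  | nil => simp [← FreeGroup.one_eq_mk]
  | cons x l ih =>
    have e : g * FreeGroup.mk (x :: l) = g * FreeGroup.mk [x] * FreeGroup.mk l := by
      rw [mul_assoc, FreeGroup.mul_mk]; simp
    have hw : (g * FreeGroup.mk [x]).toWord = g.toWord ++ [x] := by
      rw [FreeGroup.toWord_mul, FreeGroup.toWord_mk, FreeGroup.reduce_singleton]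
      exact (hl.infix ⟨[], l, by simp⟩).reduce_eq
    rw [e, ih _ (by simp only [FreeGroup.norm, hw, List.length_append] at *; omega)
      (by simpa [hw] using hl)]
    exact getElem?_of_norm_inv_mul_le (hL g x) (by have := hM g hg; omega)

theorem Boundary.isReduced_ofFn (ξ : Boundary N) (n : ℕ) :
    FreeGroup.IsReduced (List.ofFn fun i : Fin n => ξ.1 i) := by
  rw [FreeGroup.IsReduced, List.isChain_iff_getElem]
  intro i hi
  simpa using ξ.2 i

theorem Boundary.toWord_pre (ξ : Boundary N) (n : ℕ) :
    (ξ.pre n).toWord = List.ofFn fun i : Fin n => ξ.1 i := by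
  rw [Boundary.pre, FreeGroup.toWord_mk, (ξ.isReduced_ofFn n).reduce_eq]

theorem Boundary.norm_pre (ξ : Boundary N) (n : ℕ) : (ξ.pre n).norm = n := by
  simp [FreeGroup.norm, toWord_pre]

theorem Boundary.pre_convergesTo (ξ : Boundary N) : ConvergesTo ξ.pre ξ := by
  intro i
  filter_upwards [eventually_gt_atTop i] with k hk
  simp [toWord_pre, hk]

theorem ConvergesTo.unique {u : ℕ → F N} {ξ ζ : Boundary N} (h : ConvergesTo u ξ)
    (h' : ConvergesTo u ζ) : ξ = ζ := by
  apply Subtype.ext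
  funext i
  obtain ⟨k, h1, h2⟩ := ((h i).and (h' i)).exists
  exact Option.some.inj (h1.symm.trans h2)

/-- A sequence tending to a boundary point eventually extends each of its prefixes. -/
theorem ConvergesTo.eventually_eq {u : ℕ → F N} {ξ : Boundary N} (h : ConvergesTo u ξ) (M : ℕ) :
    ∀ᶠ k in atTop, ∃ l, u k = ξ.pre M * FreeGroup.mk l ∧
      FreeGroup.IsReduced ((ξ.pre M).toWord ++ l) := by
  have : ∀ᶠ k in atTop, ∀ i ∈ Finset.range M, (u k).toWord[i]? = some (ξ.1 i) :=
    (Filter.eventually_all_finset _).2 fun i _ => h i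
  filter_upwards [this] with k hk
  have e : (ξ.pre M).toWord ++ (u k).toWord.drop M = (u k).toWord := by
    rw [Boundary.toWord_pre]
    conv_rhs => rw [← List.take_append_drop M (u k).toWord]
    congr 1
    apply List.ext_getElem?
    intro i
    by_cases hi : i < M
    · simp [hi, hk i (Finset.mem_range.2 hi)]
    · simp [hi]
  refine ⟨(u k).toWord.drop M, ?_, by rw [e]; exact FreeGroup.isReduced_toWord⟩
  conv_lhs => rw [← FreeGroup.mk_toWord (x := u k), ← e, ← FreeGroup.mul_mk, FreeGroup.mk_toWord]

theorem IsCoarse.eventually_const {f : F N → F N} (hf : IsCoarse f) (i : ℕ) :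
    ∃ M, ∀ (u : ℕ → F N) (ξ : Boundary N), ConvergesTo u ξ →
      i < (f (ξ.pre M)).norm ∧
      ∀ᶠ k in atTop, (f (u k)).toWord[i]? = (f (ξ.pre M)).toWord[i]? := by
  obtain ⟨M, hM⟩ := hf.stable i
  refine ⟨M, fun u ξ h => ⟨?_, ?_⟩⟩
  · exact (hM (ξ.pre M) [] (ξ.norm_pre M).ge (by simpa using FreeGroup.isReduced_toWord)).2
  · filter_upwards [h.eventually_eq M] with k ⟨l, e, hl⟩
    rw [e]
    exact (hM (ξ.pre M) l (ξ.norm_pre M).ge hl).1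

theorem IsCoarse.exists_limit {f : F N → F N} (hf : IsCoarse f) (ξ : Boundary N) :
    ∃ ζ : Boundary N, ∀ u : ℕ → F N, ConvergesTo u ξ → ConvergesTo (f ∘ u) ζ := by
  choose M hM using hf.eventually_const
  have hlt := fun i => (hM i ξ.pre ξ ξ.pre_convergesTo).1
  refine ⟨⟨fun i => (f (ξ.pre (M i))).toWord[i]'(hlt i), fun n => ?_⟩, fun u hu i => ?_⟩
  · obtain ⟨k, h1, h2⟩ := ((hM n ξ.pre ξ ξ.pre_convergesTo).2.and
      (hM (n+1) ξ.pre ξ ξ.pre_convergesTo).2).exists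
    rw [List.getElem?_eq_getElem (hlt n)] at h1
    rw [List.getElem?_eq_getElem (hlt (n+1))] at h2
    have hr : FreeGroup.IsReduced (f (ξ.pre k)).toWord := FreeGroup.isReduced_toWord
    rw [FreeGroup.IsReduced, List.isChain_iff_getElem] at hr
    obtain ⟨a1, h1⟩ := List.getElem?_eq_some_iff.1 h1
    obtain ⟨a2, h2⟩ := List.getElem?_eq_some_iff.1 h2
    have := hr n a2
    rwa [h1, h2] at this
  · filter_upwards [(hM i u ξ hu).2] with k hk
    simp only [Function.comp, hk]
    exact List.getElem?_eq_getElem (hlt i)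

/-- The extension to `∂X` of an injective Lipschitz self-map `f` of `F_N`: if `u k → ξ`, then
`f (u k) → extend f ξ` (see `extend_spec`). -/
def extend (f : F N → F N) (hf : IsCoarse f) (ξ : Boundary N) : Boundary N :=
  (hf.exists_limit ξ).choose

theorem extend_spec {f : F N → F N} (hf : IsCoarse f) {ξ : Boundary N} {u : ℕ → F N}
    (hu : ConvergesTo u ξ) : ConvergesTo (f ∘ u) (extend f hf ξ) :=
  (hf.exists_limit ξ).choose_spec u hu

theorem extend_eq {f : F N → F N} (hf : IsCoarse f) {ξ ζ : Boundary N}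
    (h : ConvergesTo (f ∘ ξ.pre) ζ) : extend f hf ξ = ζ :=
  (extend_spec hf ξ.pre_convergesTo).unique h

theorem continuous_extend {f : F N → F N} (hf : IsCoarse f) : Continuous (extend f hf) := by
  refine Continuous.subtype_mk (continuous_pi fun i => ?_) _
  refine IsLocallyConstant.continuous ((IsLocallyConstant.iff_eventually_eq _).2 fun ξ => ?_)
  obtain ⟨M, hM⟩ := hf.eventually_const i
  have key : ∀ ξ : Boundary N,
      (f (ξ.pre M)).toWord[i]? = some ((extend f hf ξ).1 i) := fun ξ => by
    obtain ⟨k, h1, h2⟩ := ((extend_spec hf ξ.pre_convergesTo i).and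
      (hM ξ.pre ξ ξ.pre_convergesTo).2).exists
    exact h2 ▸ h1
  have hev : ∀ᶠ ζ : Boundary N in 𝓝 ξ, ∀ j : Fin M, ζ.1 j = ξ.1 j := by
    refine eventually_all.2 fun j => ?_
    have hc : Continuous fun ζ : Boundary N => ζ.1 j :=
      (continuous_apply (j : ℕ)).comp continuous_subtype_val
    exact hc.continuousAt.eventually (show ∀ᶠ y in 𝓝 (ξ.1 j), y = ξ.1 j by simp)
  filter_upwards [hev] with ζ hζ
  have e : ζ.pre M = ξ.pre M := by simp only [Boundary.pre, hζ]
  have := key ζ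
  rw [e, key ξ] at this
  exact (Option.some.inj this).symm

theorem isCoarse_mul_left (g : F N) : IsCoarse (g * ·) where
  inj := mul_right_injective g
  step := ⟨1, fun h x => by
    simpa [mul_assoc] using FreeGroup.norm_mk_le (L₁ := [x])⟩

theorem isCoarse_mulAut (φ : MulAut (F N)) : IsCoarse φ where
  inj := φ.injective
  step := ⟨Finset.univ.sup fun x => (φ (FreeGroup.mk [x])).norm, fun h x => by
    simpa using Finset.le_sup (f := fun x => (φ (FreeGroup.mk [x])).norm) (Finset.mem_univ x)⟩

theorem extend_extend {f g h : F N → F N} (hf : IsCoarse f) (hg : IsCoarse g) (hh : IsCoarse h)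
    (e : f ∘ g = h) (ξ : Boundary N) : extend f hf (extend g hg ξ) = extend h hh ξ := by
  subst e
  exact (extend_eq hh (extend_spec hf (extend_spec hg ξ.pre_convergesTo))).symm

/-- The action of `F_N` on `∂X` extending left translation. -/
instance : MulAction (F N) (Boundary N) where
  smul g ξ := extend (g * ·) (isCoarse_mul_left g) ξ
  one_smul ξ := extend_eq _ (by simpa [Function.comp_def] using ξ.pre_convergesTo)
  mul_smul g h ξ := (extend_extend _ _ _ (by funext x; simp [mul_assoc]) ξ).symm

/-- The action of `Aut(F_N)` on `∂X` extending its action on `F_N`. -/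
instance : MulAction (MulAut (F N)) (Boundary N) where
  smul φ ξ := extend φ (isCoarse_mulAut φ) ξ
  one_smul ξ := extend_eq _ (by simpa [Function.comp_def] using ξ.pre_convergesTo)
  mul_smul φ ψ ξ := (extend_extend (isCoarse_mulAut φ) (isCoarse_mulAut ψ)
    (isCoarse_mulAut (φ * ψ)) rfl ξ).symm

instance : ContinuousConstSMul (F N) (Boundary N) :=
  ⟨fun g => continuous_extend (isCoarse_mul_left g)⟩

instance : ContinuousConstSMul (MulAut (F N)) (Boundary N) :=
  ⟨fun φ => continuous_extend (isCoarse_mulAut φ)⟩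

theorem smul_smul_eq (φ : MulAut (F N)) (g : F N) (ξ : Boundary N) :
    φ • g • ξ = φ g • φ • ξ := by
  have h : IsCoarse fun x => φ (g * x) :=
    ⟨fun a b hab => by simpa using hab,
      by simpa [mul_assoc] using (isCoarse_mulAut φ).step⟩
  exact (extend_extend _ _ h rfl ξ).trans
    (extend_extend (isCoarse_mul_left _) (isCoarse_mulAut φ) h (by funext x; simp) ξ).symm

theorem conj_smul_eq (g : F N) (ξ : Boundary N) : MulAut.conj g • ξ = g • ξ := by
  refine extend_eq _ fun i => ?_
  have h1 : ConvergesTo ((g * ·) ∘ ξ.pre) (g • ξ) := extend_spec _ ξ.pre_convergesTo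
  obtain ⟨M, hM⟩ := (isCoarse_mul_left g).proper (i + g.norm + 1)
  filter_upwards [h1 i, eventually_ge_atTop M] with k hk hkM
  rw [← hk]
  have := hM (ξ.pre k) (by rw [ξ.norm_pre]; exact hkM)
  refine getElem?_of_norm_inv_mul_le (L := g.norm) (by simp [← mul_assoc]) ?_
  simp only [Function.comp]
  omega

/-- The space `𝒞_N` of closed subsets of `∂X` with at least two points. -/
def ClosedSubsets (N : ℕ) : Type := {S : Set (Boundary N) // IsClosed S ∧ S.Nontrivial}

/-- The subspace topology of the Vietoris topology. -/
instance : TopologicalSpace (ClosedSubsets N) :=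
  TopologicalSpace.induced Subtype.val (TopologicalSpace.vietoris (Boundary N))

instance : MeasurableSpace (ClosedSubsets N) := borel _

instance : BorelSpace (ClosedSubsets N) := ⟨rfl⟩

section action
open scoped Pointwise

/-- A group acting on `∂X` by homeomorphisms acts on `𝒞_N` by taking images. -/
instance {G : Type} [Group G] [MulAction G (Boundary N)] [ContinuousConstSMul G (Boundary N)] :
    MulAction G (ClosedSubsets N) where
  smul g S := ⟨g • S.1, S.2.1.smul g, S.2.2.image (MulAction.injective g)⟩
  one_smul S := Subtype.ext (one_smul G S.1)
  mul_smul g h S := Subtype.ext (mul_smul g h S.1)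

instance {G : Type} [Group G] [MulAction G (Boundary N)] [ContinuousConstSMul G (Boundary N)] :
    ContinuousConstSMul G (ClosedSubsets N) where
  continuous_const_smul g := by
    let := TopologicalSpace.vietoris (Boundary N)
    exact continuous_induced_rng.2
      ((continuous_const_smul (T := Boundary N) g).image_vietoris.comp continuous_induced_dom)

end action

/-- The subset currents on `F_N`: Borel measures on `𝒞_N` that are `F_N`-invariant and finite on
compact sets. They form an `ℝ≥0`-submodule of the measures on `𝒞_N`. -/
def subsetCurrents (N : ℕ) : Submodule ℝ≥0 (Measure (ClosedSubsets N)) where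
  carrier := {μ | (∀ g : F N, μ.map (g • ·) = μ) ∧ ∀ K, IsCompact K → μ K < ∞}
  add_mem' {μ ν} hμ hν := ⟨fun g => by
      rw [Measure.map_add _ _ (continuous_const_smul g).measurable, hμ.1, hν.1],
    fun K hK => by simpa using ⟨hμ.2 K hK, hν.2 K hK⟩⟩
  zero_mem' := ⟨fun g => by simp, fun K _ => by simp⟩
  smul_mem' c μ hμ := ⟨fun g => by rw [Measure.map_smul, hμ.1],
    fun K hK => by
      rw [Measure.smul_apply]
      exact ENNReal.mul_lt_top ENNReal.coe_lt_top (hμ.2 K hK)⟩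

/-- The space `𝒮Curr(F_N)`. -/
abbrev SCurr (N : ℕ) : Type := subsetCurrents N

/-- The weak-* topology: the coarsest topology for which `μ ↦ ∫ f dμ` is continuous for every
continuous function `f` with compact support on `𝒞_N`. -/
instance : TopologicalSpace (SCurr N) :=
  TopologicalSpace.induced
    (fun (μ : SCurr N) (f : C_c(ClosedSubsets N, ℝ)) => ∫ S, f S ∂(μ : Measure (ClosedSubsets N)))
    inferInstance

theorem measurable_smul_closedSubsets (φ : MulAut (F N)) :
    Measurable (fun S : ClosedSubsets N => φ • S) := (continuous_const_smul φ).measurable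

theorem closedSubsets_smul_smul_eq (φ : MulAut (F N)) (g : F N) (S : ClosedSubsets N) :
    φ • g • S = φ g • φ • S := by
  apply Subtype.ext
  change (φ • ·) '' ((g • ·) '' S.1) = (φ g • ·) '' ((φ • ·) '' S.1)
  simp only [Set.image_image, smul_smul_eq]

theorem closedSubsets_conj_smul_eq (g : F N) (S : ClosedSubsets N) : MulAut.conj g • S = g • S := by
  apply Subtype.ext
  change (MulAut.conj g • ·) '' S.1 = (g • ·) '' S.1
  simp only [conj_smul_eq]

/-- The action of `Aut(F_N)` on `𝒮Curr(F_N)` by pushing forward. -/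
instance : MulAction (MulAut (F N)) (SCurr N) where
  smul φ μ := ⟨(μ : Measure (ClosedSubsets N)).map (φ • ·), fun g => by
      have hg := fun g : F N =>
        (continuous_const_smul (T := ClosedSubsets N) g).measurable
      have hφ := measurable_smul_closedSubsets φ
      conv_rhs => rw [← μ.2.1 (φ⁻¹ g)]
      rw [Measure.map_map (hg _) hφ, Measure.map_map hφ (hg _)]
      congr 1
      funext S
      simp only [Function.comp, closedSubsets_smul_smul_eq]
      congr 2
      exact (MulEquiv.apply_symm_apply φ g).symm,
    fun K hK => by
      rw [show (φ • · : ClosedSubsets N → _) = (Homeomorph.smul φ).toMeasurableEquiv from rfl,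
        MeasurableEquiv.map_apply]
      exact μ.2.2 _ ((Homeomorph.smul φ).isCompact_preimage.2 hK)⟩
  one_smul μ := Subtype.ext (by
    change Measure.map (fun S => (1 : MulAut (F N)) • S) _ = _
    simp only [one_smul]
    exact Measure.map_id)
  mul_smul φ ψ μ := Subtype.ext (by
    change Measure.map (fun S => (φ * ψ) • S) _ =
      Measure.map (fun S => φ • S) (Measure.map (fun S => ψ • S) _)
    rw [Measure.map_map (measurable_smul_closedSubsets φ) (measurable_smul_closedSubsets ψ)]
    simp only [mul_smul]
    rfl)

theorem conj_smul_scurr (g : F N) (μ : SCurr N) : MulAut.conj g • μ = μ := by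
  apply Subtype.ext
  change Measure.map (fun S => MulAut.conj g • S) _ = _
  simp only [closedSubsets_conj_smul_eq]
  exact μ.2.1 g

/-- The outer automorphism group `Out(F_N) = Aut(F_N) / Inn(F_N)`. -/
abbrev OutF (N : ℕ) : Type := MulAut (F N) ⧸ (MulAut.conj : F N →* MulAut (F N)).range

/-- The action of `Out(F_N)` on `𝒮Curr(F_N)` induced by that of `Aut(F_N)`. -/
instance : SMul (OutF N) (SCurr N) where
  smul Φ μ := Quotient.liftOn' Φ (fun φ => φ • μ) fun φ ψ h => by
    obtain ⟨g, hg⟩ := QuotientGroup.leftRel_apply.1 h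
    have : ψ = φ * MulAut.conj g := by rw [hg]; group
    simp only [this, mul_smul, conj_smul_scurr]

theorem outF_mk_smul (φ : MulAut (F N)) (μ : SCurr N) : (QuotientGroup.mk φ : OutF N) • μ = φ • μ := rfl

/-- The limit set `Λ(H)` of `H` in `∂X`. -/
def limitSet (H : Subgroup (F N)) : Set (Boundary N) :=
  {ξ | ∃ u : ℕ → F N, (∀ k, u k ∈ H) ∧ ConvergesTo u ξ}

open Classical in
/-- The Dirac measure at `S` on `𝒞_N`. It is only used for `S = Λ(H)` with `H` non-trivial, and then
`S` belongs to `𝒞_N`, so that the second branch does not occur. -/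
def diracAt (S : Set (Boundary N)) : Measure (ClosedSubsets N) :=
  if h : IsClosed S ∧ S.Nontrivial then Measure.dirac ⟨S, h⟩ else 0

/-- The conjugate `g H g⁻¹`. -/
def conj (g : F N) (H : Subgroup (F N)) : Subgroup (F N) := H.map (MulAut.conj g).toMonoidHom

/-- `∑_{H' ∈ [H]} δ_{Λ(H')}`, the sum over the conjugacy class `[H]` of `H`. -/
def conjClassMeasure (H : Subgroup (F N)) : Measure (ClosedSubsets N) :=
  Measure.sum fun H' : {H' : Subgroup (F N) // ∃ g, H' = conj g H} => diracAt (limitSet H'.1)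

open Classical in
/-- The counting subset current `η_H` as a Borel measure: with `Ĥ` the commensurator of `H`, it is
`[Ĥ : H] ∑_{H' ∈ [Ĥ]} δ_{Λ(H')}` for `H` non-trivial, and `0` for `H` trivial. -/
def countingMeasure (H : Subgroup (F N)) : Measure (ClosedSubsets N) :=
  if H = ⊥ then 0
  else (H.relIndex (Subgroup.Commensurable.commensurator H) : ℝ≥0∞) •
    conjClassMeasure (Subgroup.Commensurable.commensurator H)

/-- The reduced rank `max (rank H - 1) 0`, where `rank H` is the cardinality of a free basis of `H`.
The subtraction in `ℕ∞` is truncated at `0`, and `⊤ - 1 = ⊤`. -/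
def reducedRank (H : Subgroup (F N)) : ℕ∞ := ENat.card (IsFreeGroup.Generators H) - 1

/-- The product `𝒩(H, K)`: the sum over the double cosets `HgK` of the reduced ranks of
`H ∩ gKg⁻¹`. The terms do not depend on the representatives `g`. -/
def productN (H K : Subgroup (F N)) : ℝ≥0∞ :=
  ∑' D : DoubleCoset.Quotient (H : Set (F N)) (K : Set (F N)),
    (reducedRank (H ⊓ conj (Quotient.out D) K) : ℝ≥0∞)

/-- The Cayley tree `X` of `F_N`. -/
def cayley (N : ℕ) : SimpleGraph (F N) := SimpleGraph.mulCayley (Set.range FreeGroup.of)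

/-- A finite non-empty subtree of `X`. A subtree of a tree is determined by its vertices. -/
structure IsFiniteSubtree (T : Set (F N)) : Prop where
  finite : T.Finite
  connected : ((cayley N).induce T).Connected

/-- The degree of `v` in the subtree with vertex set `T`. -/
def degreeIn (T : Set (F N)) (v : F N) : ℕ := {w ∈ T | (cayley N).Adj v w}.ncard

/-- The cylinder of the oriented edge `e` from `u` to `v`: the classes of rays emanating from `e`.
The ray from `u` to `ξ` is the translate by `u` of the ray from the identity to `u⁻¹ξ`; its second
vertex has to be `v`. -/
def cyl (u v : F N) : Set (Boundary N) := {ξ | u * (u⁻¹ • ξ).pre 1 = v}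

/-- The terminal edges of `T`, oriented towards the vertices of degree one. -/
def terminalEdges (T : Set (F N)) : Set (F N × F N) :=
  {e | e.1 ∈ T ∧ e.2 ∈ T ∧ (cayley N).Adj e.1 e.2 ∧ degreeIn T e.2 = 1}

/-- The subset cylinder of a finite subtree `T` of `X`. -/
def sCyl (T : Set (F N)) : Set (ClosedSubsets N) :=
  {S | S.1 ⊆ ⋃ e ∈ terminalEdges T, cyl e.1 e.2 ∧
    ∀ e ∈ terminalEdges T, (S.1 ∩ cyl e.1 e.2).Nonempty}

/-- The edge of `X` with endpoints `1` and `a`, as a subtree. -/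
def edgeTree (a : Fin N) : Set (F N) := {1, FreeGroup.of a}

/-- The round graphs of grade `r` in `X` based at the identity: finite subtrees containing the
identity with degree more than one, all of whose vertices of degree one are at distance `r` from
the identity. -/
def roundGraphs (N r : ℕ) : Set (Set (F N)) :=
  {T | IsFiniteSubtree T ∧ 1 ∈ T ∧ 1 < degreeIn T 1 ∧
    ∀ u ∈ T, degreeIn T u = 1 → (cayley N).dist 1 u = r}

/-- The vertices of the convex hull of `S` in `X`, the union of the bi-infinite geodesics between
points of `S`: `g` lies on the geodesic from `ξ` to `ζ` if and only if the rays from `g` to `ξ` and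
from `g` to `ζ` start with different edges. -/
def conv (S : Set (Boundary N)) : Set (F N) :=
  {g | ∃ ξ ∈ S, ∃ ζ ∈ S, (g⁻¹ • ξ).1 0 ≠ (g⁻¹ • ζ).1 0}

/-- `Ê(μ, ν) = ∑_a μ(SCyl(e_a)) ν(SCyl(e_a))`. -/
def eHat (μ ν : SCurr N) : ℝ≥0∞ :=
  ∑ a : Fin N, μ.1 (sCyl (edgeTree a)) * ν.1 (sCyl (edgeTree a))

/-- `V̂(μ, ν) = V(μ) V(ν)`, where `V(μ)` is the sum of `μ(SCyl(T))` over the round graphs `T` of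
grade one. -/
def vHat (μ ν : SCurr N) : ℝ≥0∞ :=
  (∑' T : roundGraphs N 1, μ.1 (sCyl T.1)) * ∑' T : roundGraphs N 1, ν.1 (sCyl T.1)

/-- The finite subtrees of `X` containing the identity, `{1}` included. -/
abbrev BasedSubtree (N : ℕ) : Type := {T : Set (F N) // IsFiniteSubtree T ∧ 1 ∈ T}

/-- The equivalence of finite subtrees under translation by `F_N`. -/
def subtreeSetoid (N : ℕ) : Setoid (BasedSubtree N) where
  r T T' := ∃ g : F N, (g * ·) '' T.1 = T'.1
  iseqv :=
    ⟨fun T => ⟨1, by simp⟩,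
     fun {T T'} ⟨g, h⟩ => ⟨g⁻¹, by rw [← h, Set.image_image]; simp⟩,
     fun {T T' T''} ⟨g, h⟩ ⟨g', h'⟩ =>
      ⟨g' * g, by rw [← h', ← h, Set.image_image]; simp [mul_assoc]⟩⟩

/-- The pairs `(S₁, S₂)` with `Conv(S₁) ∩ Conv(S₂) = T`. -/
def pairsWithIntersection (T : Set (F N)) : Set (ClosedSubsets N × ClosedSubsets N) :=
  {p | conv p.1.1 ∩ conv p.2.1 = T}

/-- `ĉ(μ, ν)`: the sum over the translation classes `[T]` of the measure under `μ × ν` of the set of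
pairs `(S₁, S₂)` with `Conv(S₁) ∩ Conv(S₂) = T`. As `μ × ν` is invariant under the diagonal action,
the representative `T` does not matter. -/
def cHat (μ ν : SCurr N) : ℝ≥0∞ :=
  ∑' C : Quotient (subtreeSetoid N), (μ.1.prod ν.1) (pairsWithIntersection C.out.1)

/-- An `R_N`-graph, i.e. a graph with a graph morphism to the rose with `N` petals: each topological
edge has a label and gets the orientation of the petal it is mapped to. -/
structure RoseGraph (N : ℕ) where
  V : Type
  E : Type
  o : E → V
  t : E → V
  label : E → Fin N

namespace RoseGraph

/-- The fiber product of two `R_N`-graphs over the rose. -/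
def fiberProduct (Γ Δ : RoseGraph N) : RoseGraph N where
  V := Γ.V × Δ.V
  E := {e : Γ.E × Δ.E // Γ.label e.1 = Δ.label e.2}
  o e := (Γ.o e.1.1, Δ.o e.1.2)
  t e := (Γ.t e.1.1, Δ.t e.1.2)
  label e := Γ.label e.1.1

variable (Γ : RoseGraph N)

/-- The origin of an oriented edge: `(e, true)` is `e` with its given orientation and `(e, false)` is
its inverse. -/
def src (e : Γ.E × Bool) : Γ.V := if e.2 then Γ.o e.1 else Γ.t e.1

/-- The terminal vertex of an oriented edge. -/
def tgt (e : Γ.E × Bool) : Γ.V := if e.2 then Γ.t e.1 else Γ.o e.1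

/-- `p` is an edge path from `v` to `w`. -/
def IsPath : Γ.V → List (Γ.E × Bool) → Γ.V → Prop
  | v, [], w => v = w
  | v, e :: p, w => Γ.src e = v ∧ IsPath (Γ.tgt e) p w

/-- The connected components. -/
def Component : Type := Quot fun v w : Γ.V => ∃ e : Γ.E × Bool, Γ.src e = v ∧ Γ.tgt e = w

/-- A component of a graph is contractible if and only if it is a tree: there is no non-trivial
reduced closed path (a path is reduced if no oriented edge is followed by its inverse). -/
def Component.Contractible {Γ : RoseGraph N} (C : Γ.Component) : Prop :=
  ∀ v : Γ.V, Quot.mk _ v = C → ∀ p : List (Γ.E × Bool), Γ.IsPath v p v →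
    p.IsChain (fun e e' => e' ≠ (e.1, !e.2)) → p = []

/-- The number `c(Γ)` of contractible components. -/
def numContractible : ℕ∞ := ENat.card {C : Γ.Component // C.Contractible}

end RoseGraph

/-- The quotient `H \ Y` by `H` of the full subgraph of `X` on an `H`-invariant set of vertices `Y`,
with the labels of `X` and the orientation of each edge from `g` to `g a`. -/
def quotientGraph (H : Subgroup (F N)) (Y : Set (F N)) : RoseGraph N where
  V := Quot fun x y : Y => ∃ h ∈ H, h * x.1 = y.1
  E := Quot fun e e' : {e : F N × Fin N // e.1 ∈ Y ∧ e.1 * FreeGroup.of e.2 ∈ Y} =>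
    ∃ h ∈ H, h * e.1.1 = e'.1.1 ∧ e.1.2 = e'.1.2
  o := Quot.map (fun e => ⟨e.1.1, e.2.1⟩) fun _ _ ⟨h, hh, h1, _⟩ => ⟨h, hh, h1⟩
  t := Quot.map (fun e => ⟨e.1.1 * FreeGroup.of e.1.2, e.2.2⟩)
    fun _ _ ⟨h, hh, h1, h2⟩ => ⟨h, hh, by rw [← mul_assoc, h1, h2]⟩
  label := Quot.lift (fun e => e.1.2) fun _ _ ⟨_, _, _, h2⟩ => h2

/-- The core graph `Δ_H = H \ Conv(Λ(H))`. -/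
def coreGraph (H : Subgroup (F N)) : RoseGraph N := quotientGraph H (conv (limitSet H))

/-- The defining properties of the intersection functional: continuity, symmetry and the value
`𝒩(H, K)` at the counting subset currents of finitely generated subgroups `H` and `K`. The bilinearity
over `ℝ≥0` is part of the type of `B`. -/
structure IsIntersectionFunctional
    (hη : ∀ H : Subgroup (F N), H.FG → countingMeasure H ∈ subsetCurrents N)
    (B : SCurr N →ₗ[ℝ≥0] SCurr N →ₗ[ℝ≥0] ℝ≥0) : Prop where
  continuous : Continuous fun p : SCurr N × SCurr N => B p.1 p.2
  symm : ∀ μ ν : SCurr N, B μ ν = B ν μ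
  counting : ∀ (H K : Subgroup (F N)) (hH : H.FG) (hK : K.FG),
    (B ⟨countingMeasure H, hη H hH⟩ ⟨countingMeasure K, hη K hK⟩ : ℝ≥0∞) = productN H K

end FreeCurr

end

open FreeCurr

open Filter Topology MeasureTheory
open scoped NNReal ENNReal CompactlySupported

noncomputable section

namespace FreeCurr

variable {N : ℕ}

/-! Let `H`, `K` be finitely generated and non-trivial. For a double coset `HgK` let `Y` be the
intersection of the hulls of Λ(H) and gΛ(K). It is a subtree, possibly empty, on which `L = H ∩
gKg⁻¹` acts freely with finite quotient. If `Y` is non-empty, the Euler characteristic of `L \ Y`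
gives rank(L) - 1 = #edges - #vertices. Hence the reduced rank of `L` is #edges - #vertices + c,
where c is 1 if `Y` is finite and non-empty (then `L` is trivial) and 0 otherwise; if `Y` is empty,
`L` is trivial and everything vanishes (`reducedRank_add`). The current η_H puts one Dirac mass at
gΛ(H) for each coset gH (`countingMeasure_eq_sum`), so the sums over all double cosets of #vertices,
#edges and c are V̂, Ê and ĉ at (η_H, η_K). This is `productN_add_vHat`. The right-hand side Ê - V̂
+ ĉ makes sense for all subset currents and is bilinear and symmetric; it remains to prove
continuity and density.

Continuity. Ê and V̂ are polynomials in measures of compact open sets. For ĉ, every translation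
class of finite trees is replaced by its members through the identity, each with weight 1/|T|
(`SCurr.cHat_eq_tsum`). A tree through the identity that leaves the ball of radius n has weight at
most 1/(n+1), and all pair events together have measure at most V̂. So the tails are at most
V̂/(n+1), and ĉ is a locally uniform limit of continuous functions (`SCurr.continuous_cHat`).

Density of the span of counting currents (`SCurr.dense_countingSpan`). Up to weak-* approximation a
current is given by the masses of the classes of hulls with a prescribed pattern in the ball of
radius R. Invariance imposes on these masses one linear equation for each generator and each overlap
of two neighbouring balls. The masses are perturbed to rationals satisfying the same equations and
the denominators are cleared. Then as many vertices as the numbers prescribe are glued to a finite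
labelled graph (`SCurr.exists_isGluing`). The fundamental groups of its components are finitely
generated subgroups whose counting currents have exactly the prescribed pattern counts
(`IsGluing.exists_current`).

Density gives non-negativity and uniqueness. Uniqueness gives invariance, because automorphisms
permute the counting currents and preserve 𝒩(H, K). Finally, the components of the fiber product
with their fundamental groups are the orbits of pairs of cosets having a non-empty tree `Y`, with
their stabilizers; such a component is contractible exactly when the stabilizer is trivial, that is,
when `Y` is finite (`cHat_eq_numContractible`). -/

/-! ### Letters, rays and directions in the tree -/

/-- The inverse letter. -/
def linv (x : Letter N) : Letter N := (x.1, !x.2)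

/-- A letter as an element of `F_N`. -/
def lt (x : Letter N) : F N := FreeGroup.mk [x]

@[simp] theorem linv_linv (x : Letter N) : linv (linv x) = x := by simp [linv]

theorem lt_linv (x : Letter N) : lt (linv x) = (lt x)⁻¹ := by
  simp [lt, linv, FreeGroup.inv_mk, FreeGroup.invRev]

theorem lt_injective : Function.Injective (lt (N := N)) := fun x y h => by
  have := congrArg FreeGroup.toWord h
  simpa [lt, FreeGroup.toWord_mk, FreeGroup.reduce_singleton] using this

theorem mk_cons (x : Letter N) (w : List (Letter N)) :
    FreeGroup.mk (x :: w) = lt x * FreeGroup.mk w := by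
  simp [lt, FreeGroup.mul_mk]

theorem mk_append (w w' : List (Letter N)) :
    FreeGroup.mk (w ++ w') = FreeGroup.mk w * FreeGroup.mk w' := by
  simp [FreeGroup.mul_mk]

theorem ne_linv_iff {x y : Letter N} : y ≠ linv x ↔ (x.1 = y.1 → x.2 = y.2) := by
  obtain ⟨a, b⟩ := x
  obtain ⟨c, d⟩ := y
  simp only [linv, ne_eq, Prod.mk.injEq, not_and]
  constructor
  · intro h e
    have := h e.symm
    cases b <;> cases d <;> simp_all
  · intro h e
    have := h e.symm
    cases b <;> cases d <;> simp_all

theorem isReduced_cons_cons {x y : Letter N} {w : List (Letter N)} :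
    FreeGroup.IsReduced (x :: y :: w) ↔ y ≠ linv x ∧ FreeGroup.IsReduced (y :: w) := by
  rw [FreeGroup.IsReduced, List.isChain_cons_cons, ne_linv_iff]; rfl

theorem toWord_mk_of_isReduced {w : List (Letter N)} (h : FreeGroup.IsReduced w) :
    (FreeGroup.mk w).toWord = w := by
  rw [FreeGroup.toWord_mk, h.reduce_eq]

namespace Boundary

theorem ne_linv (ξ : Boundary N) (n : ℕ) : ξ.1 (n + 1) ≠ linv (ξ.1 n) := ne_linv_iff.2 (ξ.2 n)

/-- Removal of the first `k` letters. -/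
def shift (ξ : Boundary N) (k : ℕ) : Boundary N :=
  ⟨fun n => ξ.1 (n + k), fun n => by
    have := ξ.2 (n + k)
    rwa [Nat.add_right_comm] at this⟩

/-- Addition of a letter in front. -/
def cons (x : Letter N) (ξ : Boundary N) (h : ξ.1 0 ≠ linv x) : Boundary N :=
  ⟨fun n => n.casesOn x ξ.1, fun n => by
    cases n with
    | zero => exact ne_linv_iff.1 h
    | succ n => exact ξ.2 n⟩

theorem pre_zero (ξ : Boundary N) : ξ.pre 0 = 1 := by simp [pre, FreeGroup.one_eq_mk]

theorem pre_succ (ξ : Boundary N) (n : ℕ) : ξ.pre (n + 1) = ξ.pre n * lt (ξ.1 n) := by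
  rw [pre, pre, lt, FreeGroup.mul_mk, List.ofFn_succ_last]
  rfl

theorem pre_succ' (ξ : Boundary N) (n : ℕ) : ξ.pre (n + 1) = lt (ξ.1 0) * (ξ.shift 1).pre n := by
  rw [pre, pre, lt, FreeGroup.mul_mk, List.ofFn_succ]
  rfl

theorem pre_one (ξ : Boundary N) : ξ.pre 1 = lt (ξ.1 0) := by
  rw [pre_succ, pre_zero, one_mul]

end Boundary

theorem smul_boundary_eq {g : F N} {ξ ζ : Boundary N}
    (h : ∀ i, ∀ᶠ k in atTop, (g * ξ.pre k).toWord[i]? = some (ζ.1 i)) : g • ξ = ζ :=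
  extend_eq _ h

theorem smul_boundary_spec {g : F N} {ξ : Boundary N} {u : ℕ → F N} (h : ConvergesTo u ξ) :
    ConvergesTo (fun k => g * u k) (g • ξ) :=
  extend_spec (isCoarse_mul_left g) h

theorem mulAut_boundary_spec {φ : MulAut (F N)} {ξ : Boundary N} {u : ℕ → F N}
    (h : ConvergesTo u ξ) : ConvergesTo (fun k => φ (u k)) (φ • ξ) :=
  extend_spec (isCoarse_mulAut φ) h

theorem lt_inv_smul (ξ : Boundary N) : (lt (ξ.1 0))⁻¹ • ξ = ξ.shift 1 := by
  apply smul_boundary_eq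
  intro i
  have := (tendsto_sub_atTop_nat 1).eventually ((ξ.shift 1).pre_convergesTo i)
  filter_upwards [this, eventually_ge_atTop 1] with k hk h1
  obtain ⟨k, rfl⟩ := Nat.exists_eq_add_of_le' h1
  rw [ξ.pre_succ', inv_mul_cancel_left]
  exact hk

theorem lt_smul (x : Letter N) (ξ : Boundary N) (h : ξ.1 0 ≠ linv x) :
    lt x • ξ = ξ.cons x h := by
  have := lt_inv_smul (ξ.cons x h)
  rw [inv_smul_eq_iff] at this
  exact this.symm

/-- The first letter of the ray from `g` to `ξ`. -/
def dir (g : F N) (ξ : Boundary N) : Letter N := (g⁻¹ • ξ).1 0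

theorem dir_mul (g h : F N) (ξ : Boundary N) : dir (g * h) (g • ξ) = dir h ξ := by
  simp only [dir, mul_inv_rev, mul_smul, inv_smul_smul]

theorem dir_smul (g h : F N) (ξ : Boundary N) : dir h (g • ξ) = dir (g⁻¹ * h) ξ := by
  rw [← dir_mul g (g⁻¹ * h), mul_inv_cancel_left]

theorem dir_one (ξ : Boundary N) : dir 1 ξ = ξ.1 0 := by simp [dir]

/-- Removing the edge between `g` and `g x` cuts the tree in two, and `ξ` lies on one side: exactly
one of the two endpoints has to cross the edge in order to reach `ξ`. -/
theorem dir_mul_lt (g : F N) (x : Letter N) (ξ : Boundary N) :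
    dir (g * lt x) ξ ≠ linv x ↔ dir g ξ = x := by
  have e : (g * lt x)⁻¹ • ξ = (lt x)⁻¹ • g⁻¹ • ξ := by rw [mul_inv_rev, mul_smul]
  rw [dir, dir, e]
  generalize g⁻¹ • ξ = η
  constructor
  · intro h
    by_contra h'
    apply h
    rw [← lt_linv, lt_smul (linv x) η (by rwa [linv_linv])]
    rfl
  · rintro rfl
    rw [lt_inv_smul]
    exact η.ne_linv 0

theorem pre_inv_smul (ξ : Boundary N) (n : ℕ) : (ξ.pre n)⁻¹ • ξ = ξ.shift n := by
  induction n with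
  | zero => rw [ξ.pre_zero, inv_one, one_smul]; rfl
  | succ n ih =>
    rw [ξ.pre_succ, mul_inv_rev, mul_smul, ih]
    have := lt_inv_smul (ξ.shift n)
    have e : (ξ.shift n).1 0 = ξ.1 n := by simp [Boundary.shift]
    rw [e] at this
    rw [this]
    apply Subtype.ext
    funext k
    change ξ.1 (k + 1 + n) = ξ.1 (k + (n + 1))
    rw [add_right_comm, add_assoc]

theorem dir_pre (ξ : Boundary N) (n : ℕ) : dir (ξ.pre n) ξ = ξ.1 n := by
  rw [dir, pre_inv_smul]; simp [Boundary.shift]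

/-- If the ray from the far end of a geodesic to `ξ` does not turn back, then the geodesic is an
initial segment of the ray from `g`; the separation by `dir_mul_lt` is carried back edge by edge. -/
theorem dir_of_dir_mul_mk {g : F N} {x : Letter N} {w : List (Letter N)} {ξ : Boundary N}
    (hw : FreeGroup.IsReduced (x :: w))
    (h : dir (g * FreeGroup.mk (x :: w)) ξ ≠ linv ((x :: w).getLast (by simp))) :
    dir g ξ = x := by
  induction w generalizing g x with
  | nil => exact (dir_mul_lt g x ξ).1 h
  | cons y w ih =>
    rw [isReduced_cons_cons] at hw
    rw [mk_cons, ← mul_assoc] at h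
    have := ih (g := g * lt x) hw.2 h
    exact (dir_mul_lt g x ξ).1 (this ▸ hw.1)

/-! ### Convex sets of vertices and convex hulls -/

/-- Subtrees of `X` (possibly empty). -/
def IsConvex (T : Set (F N)) : Prop :=
  ∀ g ∈ T, ∀ x w, FreeGroup.IsReduced (x :: w) → g * FreeGroup.mk (x :: w) ∈ T → g * lt x ∈ T

theorem IsConvex.inter {T T' : Set (F N)} (h : IsConvex T) (h' : IsConvex T') :
    IsConvex (T ∩ T') :=
  fun g hg x w hw hx => ⟨h g hg.1 x w hw hx.1, h' g hg.2 x w hw hx.2⟩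

theorem IsConvex.mem_of_prefix {T : Set (F N)} (h : IsConvex T) {g : F N} (hg : g ∈ T)
    (w w' : List (Letter N)) (hw : FreeGroup.IsReduced (w ++ w'))
    (hm : g * FreeGroup.mk (w ++ w') ∈ T) : g * FreeGroup.mk w ∈ T := by
  induction w generalizing g with
  | nil => simpa [← FreeGroup.one_eq_mk] using hg
  | cons x w ih =>
    have h1 := h g hg x (w ++ w') hw hm
    rw [List.cons_append, mk_cons, ← mul_assoc] at hm
    rw [mk_cons, ← mul_assoc]
    exact ih h1 (hw.infix ⟨[x], [], by simp⟩) hm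

theorem IsConvex.take_mem {T : Set (F N)} (h : IsConvex T) (h1 : 1 ∈ T) {g : F N} (hg : g ∈ T)
    (n : ℕ) : FreeGroup.mk (g.toWord.take n) ∈ T := by
  have := h.mem_of_prefix h1 (g.toWord.take n) (g.toWord.drop n)
    (by rw [List.take_append_drop]; exact FreeGroup.isReduced_toWord)
    (by rw [List.take_append_drop, FreeGroup.mk_toWord, one_mul]; exact hg)
  rwa [one_mul] at this

theorem norm_mk_take (g : F N) (n : ℕ) : (FreeGroup.mk (g.toWord.take n)).norm = min n g.norm := by
  have hr : FreeGroup.IsReduced (g.toWord.take n) :=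
    (FreeGroup.isReduced_toWord (x := g)).infix ⟨[], g.toWord.drop n, by simp⟩
  rw [FreeGroup.norm, toWord_mk_of_isReduced hr, List.length_take]; rfl

theorem mem_conv {S : Set (Boundary N)} {g : F N} :
    g ∈ conv S ↔ ∃ ξ ∈ S, ∃ ζ ∈ S, dir g ξ ≠ dir g ζ := Iff.rfl

theorem exists_dir_ne {S : Set (Boundary N)} {g : F N} (h : g ∈ conv S) (x : Letter N) :
    ∃ ξ ∈ S, dir g ξ ≠ x := by
  obtain ⟨ξ, hξ, ζ, hζ, hne⟩ := h
  by_cases h1 : dir g ξ = x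
  · exact ⟨ζ, hζ, fun h2 => hne (h1.trans h2.symm)⟩
  · exact ⟨ξ, hξ, h1⟩

/-- Some other point of `S` leaves `g` in a different direction. Seen from the next vertex it lies
behind, while `ξ` lies ahead. In particular a hull has no leaves. -/
theorem mul_lt_mem_conv {S : Set (Boundary N)} {g : F N} (h : g ∈ conv S) {ξ : Boundary N}
    (hξ : ξ ∈ S) : g * lt (dir g ξ) ∈ conv S := by
  obtain ⟨ζ, hζ, hne⟩ := exists_dir_ne h (dir g ξ)
  have h1 := (dir_mul_lt g (dir g ξ) ξ).2 rfl
  have h2 : dir (g * lt (dir g ξ)) ζ = linv (dir g ξ) := by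
    by_contra h2
    exact hne ((dir_mul_lt _ _ _).1 h2)
  exact ⟨ξ, hξ, ζ, hζ, fun e => h1 (Eq.trans e h2)⟩

theorem exists_dir_eq {S : Set (Boundary N)} {g : F N} {x : Letter N} {w : List (Letter N)}
    (hw : FreeGroup.IsReduced (x :: w)) (h : g * FreeGroup.mk (x :: w) ∈ conv S) :
    ∃ ξ ∈ S, dir g ξ = x := by
  obtain ⟨ξ, hξ, hne⟩ := exists_dir_ne h (linv ((x :: w).getLast (by simp)))
  exact ⟨ξ, hξ, dir_of_dir_mul_mk hw hne⟩

theorem isConvex_conv (S : Set (Boundary N)) : IsConvex (conv S) := by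
  intro g hg x w hw hm
  obtain ⟨ξ, hξ, rfl⟩ := exists_dir_eq hw hm
  exact mul_lt_mem_conv hg hξ

theorem mul_lt_mem_conv_iff {S : Set (Boundary N)} {g : F N} (h : g ∈ conv S) {x : Letter N} :
    g * lt x ∈ conv S ↔ ∃ ξ ∈ S, dir g ξ = x := by
  constructor
  · exact fun h' => exists_dir_eq (w := []) (by simp) h'
  · rintro ⟨ξ, hξ, rfl⟩
    exact mul_lt_mem_conv h hξ

theorem conv_mono {S S' : Set (Boundary N)} (h : S ⊆ S') : conv S ⊆ conv S' :=
  fun _ ⟨ξ, hξ, ζ, hζ, hne⟩ => ⟨ξ, h hξ, ζ, h hζ, hne⟩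

theorem smul_val {G : Type} [Group G] [MulAction G (Boundary N)]
    [ContinuousConstSMul G (Boundary N)] (g : G) (S : ClosedSubsets N) :
    (g • S).1 = (g • ·) '' S.1 := rfl

theorem mem_conv_image {S : Set (Boundary N)} {g h : F N} :
    h ∈ conv ((g • ·) '' S) ↔ g⁻¹ * h ∈ conv S := by
  simp only [mem_conv, Set.exists_mem_image, dir_smul]

theorem pre_mem_conv {S : Set (Boundary N)} (h : 1 ∈ conv S) {ξ : Boundary N} (hξ : ξ ∈ S) (n : ℕ) :
    ξ.pre n ∈ conv S := by
  induction n with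
  | zero => rwa [ξ.pre_zero]
  | succ n ih =>
    rw [ξ.pre_succ, ← dir_pre]
    exact mul_lt_mem_conv ih hξ

theorem eq_of_getElem_eq_pre {ξ ζ : Boundary N} {n : ℕ} : ζ.pre n = ξ.pre n ↔ ∀ i < n, ζ.1 i = ξ.1 i := by
  rw [← FreeGroup.toWord_inj, ζ.toWord_pre, ξ.toWord_pre, List.ofFn_inj]
  constructor
  · intro h i hi
    exact congrFun h ⟨i, hi⟩
  · intro h
    funext i
    exact h i i.2

/-- A point on the other side of the last edge of a path starting at the identity has the path as
a prefix. -/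
theorem pre_eq_of_dir_ne {x : Letter N} {w : List (Letter N)} {ξ : Boundary N}
    (hw : FreeGroup.IsReduced (x :: w))
    (h : dir (FreeGroup.mk (x :: w)) ξ ≠ linv ((x :: w).getLast (by simp))) :
    ξ.pre (x :: w).length = FreeGroup.mk (x :: w) := by
  induction w generalizing x ξ with
  | nil =>
    have := dir_of_dir_mul_mk (g := 1) hw (by rwa [one_mul])
    rw [dir_one] at this
    simp [ξ.pre_one, this, lt]
  | cons y w ih =>
    have hx := dir_of_dir_mul_mk (g := 1) hw (by rwa [one_mul])
    rw [dir_one] at hx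
    have hw' := hw
    rw [isReduced_cons_cons] at hw'
    rw [List.length_cons, ξ.pre_succ', mk_cons x, hx]
    congr 1
    apply ih hw'.2
    rw [← lt_inv_smul, hx, dir_smul, inv_inv, ← mk_cons]
    exact h

/-- At a hull vertex at depth `n + 1` of the ray, some point of `S` does not lie behind the last
edge, so it shares its first `n + 1` letters with `ξ`. These points converge to `ξ`, and `S` is
closed. -/
theorem mem_of_pre_mem_conv {S : Set (Boundary N)} (hS : IsClosed S) {ξ : Boundary N}
    (h : ∀ n, ξ.pre n ∈ conv S) : ξ ∈ S := by
  have key : ∀ n, ∃ ζ ∈ S, ζ.pre (n + 1) = ξ.pre (n + 1) := by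
    intro n
    have hm := h (n + 1)
    have hr := ξ.isReduced_ofFn (n + 1)
    rw [Boundary.pre] at hm
    have e := hm
    rw [List.ofFn_succ] at hm hr
    obtain ⟨ζ, hζ, hne⟩ := exists_dir_ne hm (linv (List.getLast _ (List.cons_ne_nil _ _)))
    refine ⟨ζ, hζ, ?_⟩
    have := pre_eq_of_dir_ne hr hne
    rw [show ξ.pre (n + 1) = FreeGroup.mk (List.ofFn fun i : Fin (n + 1) => ξ.1 i) from rfl,
      List.ofFn_succ]
    simpa using this
  choose ζ hζ he using key
  refine hS.mem_of_tendsto (b := atTop) (f := ζ) ?_ (Eventually.of_forall hζ)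
  refine (Topology.IsInducing.subtypeVal.tendsto_nhds_iff).2 (tendsto_pi_nhds.2 ?_)
  intro i
  apply tendsto_nhds_of_eventually_eq
  filter_upwards [eventually_ge_atTop i] with n hn
  exact eq_of_getElem_eq_pre.1 (he n) i (by omega)

theorem mem_iff_pre_mem_conv {S : Set (Boundary N)} (hS : IsClosed S) (h : 1 ∈ conv S)
    {ξ : Boundary N} : ξ ∈ S ↔ ∀ n, ξ.pre n ∈ conv S :=
  ⟨fun hξ => pre_mem_conv h hξ, mem_of_pre_mem_conv hS⟩

/-- The vertex at which two rays from the identity separate lies on the geodesic between their ends.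
-/
theorem exists_mem_conv {S : Set (Boundary N)} (hS : S.Nontrivial) : (conv S).Nonempty := by
  obtain ⟨ξ, hξ, ζ, hζ, hne⟩ := hS
  have : ∃ n, ξ.1 n ≠ ζ.1 n := by
    by_contra! h
    exact hne (Subtype.ext (funext h))
  classical
  let n := Nat.find this
  have h1 : ξ.1 n ≠ ζ.1 n := Nat.find_spec this
  have h2 : ζ.pre n = ξ.pre n := eq_of_getElem_eq_pre.2 fun i hi => by
    have := Nat.find_min this hi
    simpa [eq_comm] using this
  refine ⟨ξ.pre n, ξ, hξ, ζ, hζ, ?_⟩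
  change dir _ _ ≠ dir _ _
  rwa [dir_pre, ← h2, dir_pre]

/-! ### The Vietoris topology, compact open classes of hulls -/

instance : T2Space (Boundary N) :=
  inferInstanceAs (T2Space
    {ξ : ℕ → Letter N // ∀ n, (ξ n).1 = (ξ (n + 1)).1 → (ξ n).2 = (ξ (n + 1)).2})

theorem continuous_letter (n : ℕ) : Continuous fun ξ : Boundary N => ξ.1 n :=
  (continuous_apply n).comp continuous_subtype_val

instance : CompactSpace (Boundary N) := by
  refine isCompact_iff_compactSpace.1 (IsClosed.isCompact ?_)
  have e : {ξ : ℕ → Letter N | ∀ n, (ξ n).1 = (ξ (n + 1)).1 → (ξ n).2 = (ξ (n + 1)).2} =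
      ⋂ n, {ξ | (ξ n).1 = (ξ (n + 1)).1 → (ξ n).2 = (ξ (n + 1)).2} := by
    ext ξ
    simp
  change IsClosed {ξ : ℕ → Letter N | ∀ n, (ξ n).1 = (ξ (n + 1)).1 → (ξ n).2 = (ξ (n + 1)).2}
  rw [e]
  refine isClosed_iInter fun n => ?_
  have hc : Continuous fun ξ : ℕ → Letter N => (ξ n, ξ (n + 1)) :=
    (continuous_apply n).prodMk (continuous_apply (n + 1))
  exact (isClosed_discrete {p : Letter N × Letter N | p.1.1 = p.2.1 → p.1.2 = p.2.2}).preimage hc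

theorem isClopen_dir (g : F N) (x : Letter N) : IsClopen {ξ : Boundary N | dir g ξ = x} :=
  (isClopen_discrete {x}).preimage ((continuous_letter 0).comp (continuous_const_smul g⁻¹))

theorem isClopen_meets {U : Set (Boundary N)} (hU : IsClopen U) :
    IsClopen {S : ClosedSubsets N | (S.1 ∩ U).Nonempty} := by
  let := TopologicalSpace.vietoris (Boundary N)
  have hc : Continuous (Subtype.val : ClosedSubsets N → Set (Boundary N)) :=
    continuous_induced_dom
  exact ⟨(TopologicalSpace.vietoris.isClosed_inter_nonempty_of_isClosed hU.1).preimage hc,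
    (TopologicalSpace.vietoris.isOpen_inter_nonempty_of_isOpen hU.2).preimage hc⟩

/-- Whether `g` is in the hull depends only on which of the finitely many clopen sets of points with
a given direction at `g` are met by `S`. -/
theorem isClopen_mem_conv (g : F N) : IsClopen {S : ClosedSubsets N | g ∈ conv S.1} := by
  have : {S : ClosedSubsets N | g ∈ conv S.1} =
      ⋃ p ∈ {p : Letter N × Letter N | p.1 ≠ p.2},
        {S : ClosedSubsets N | (S.1 ∩ {ξ | dir g ξ = p.1}).Nonempty} ∩
        {S | (S.1 ∩ {ξ | dir g ξ = p.2}).Nonempty} := by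
    ext S
    simp only [Set.mem_ofPred_eq, mem_conv, Set.mem_iUnion, Set.mem_inter_iff, exists_prop]
    constructor
    · rintro ⟨ξ, hξ, ζ, hζ, h⟩
      exact ⟨(dir g ξ, dir g ζ), h, ⟨ξ, hξ, rfl⟩, ⟨ζ, hζ, rfl⟩⟩
    · rintro ⟨p, hp, ⟨ξ, hξ, h1⟩, ⟨ζ, hζ, h2⟩⟩
      refine ⟨ξ, hξ, ζ, hζ, ?_⟩
      rw [Set.mem_ofPred_eq] at h1 h2
      rwa [h1, h2]
  rw [this]
  exact (Set.toFinite _).isClopen_biUnion fun p _ =>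
    (isClopen_meets (isClopen_dir g p.1)).inter (isClopen_meets (isClopen_dir g p.2))

/-- The sets whose convex hull contains the identity. -/
def hullAtOne (N : ℕ) : Set (ClosedSubsets N) := {S | 1 ∈ conv S.1}

theorem isClopen_hullAtOne : IsClopen (hullAtOne N) := isClopen_mem_conv 1

/-- The inclusion of `𝒞_N` into the space of compact subsets. -/
def toCompacts (S : ClosedSubsets N) : TopologicalSpace.Compacts (Boundary N) :=
  ⟨S.1, S.2.1.isCompact⟩

theorem isEmbedding_toCompacts : Topology.IsEmbedding (toCompacts (N := N)) := by
  let := TopologicalSpace.vietoris (Boundary N)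
  refine ⟨⟨?_⟩, fun S S' h => Subtype.ext (congrArg TopologicalSpace.Compacts.carrier h)⟩
  change TopologicalSpace.induced _ _ = TopologicalSpace.induced _ (TopologicalSpace.induced _ _)
  rw [induced_compose]
  rfl

instance : T2Space (ClosedSubsets N) := isEmbedding_toCompacts.t2Space

/-- The space of all compact subsets of ∂X is compact, and there the condition is closed, being a
finite union of conditions to meet two given clopen sets. Different directions at the identity
already provide two points, so nothing is lost by requiring them in 𝒞_N. -/
theorem isCompact_hullAtOne : IsCompact (hullAtOne N) := by
  refine isEmbedding_toCompacts.isCompact_iff.2 (IsClosed.isCompact ?_)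
  have e : toCompacts '' hullAtOne N = ⋃ p ∈ {p : Letter N × Letter N | p.1 ≠ p.2},
        {S : TopologicalSpace.Compacts (Boundary N) |
          ((S : Set (Boundary N)) ∩ {ξ | dir 1 ξ = p.1}).Nonempty} ∩
        {S | ((S : Set (Boundary N)) ∩ {ξ | dir 1 ξ = p.2}).Nonempty} := by
    ext S
    simp only [Set.mem_image, Set.mem_iUnion, Set.mem_inter_iff, exists_prop, Set.mem_ofPred_eq]
    constructor
    · rintro ⟨S, ⟨ξ, hξ, ζ, hζ, h⟩, rfl⟩
      exact ⟨(dir 1 ξ, dir 1 ζ), h, ⟨ξ, hξ, rfl⟩, ⟨ζ, hζ, rfl⟩⟩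
    · rintro ⟨p, hp, ⟨ξ, hξ, h1⟩, ⟨ζ, hζ, h2⟩⟩
      rw [Set.mem_ofPred_eq] at h1 h2
      have hne : dir 1 ξ ≠ dir 1 ζ := by rwa [h1, h2]
      exact ⟨⟨S, S.isCompact.isClosed, ξ, hξ, ζ, hζ, fun e => hne (by rw [e])⟩,
        ⟨ξ, hξ, ζ, hζ, hne⟩, rfl⟩
  rw [e]
  exact (Set.toFinite _).isClosed_biUnion fun p _ =>
    (TopologicalSpace.Compacts.isClosed_inter_nonempty_of_isClosed (isClopen_dir 1 p.1).1).inter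
    (TopologicalSpace.Compacts.isClosed_inter_nonempty_of_isClosed (isClopen_dir 1 p.2).1)

/-- The ball of radius `r` around the identity. -/
def ball (N r : ℕ) : Set (F N) := {g | g.norm ≤ r}

theorem finite_ball (r : ℕ) : (ball N r).Finite := finite_norm_le r

/-- The sets `S` with `1 ∈ Conv(S)` such that `Conv(S)` meets the ball of radius `r` in `P`. -/
def typeClass (r : ℕ) (P : Set (F N)) : Set (ClosedSubsets N) :=
  {S | 1 ∈ conv S.1 ∧ conv S.1 ∩ ball N r = P}

theorem isClopen_conv_inter {B : Set (F N)} (hB : B.Finite) (P : Set (F N)) :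
    IsClopen {S : ClosedSubsets N | conv S.1 ∩ B = P} := by
  by_cases hP : P ⊆ B
  · have : {S : ClosedSubsets N | conv S.1 ∩ B = P} =
        ⋂ g ∈ B, {S | g ∈ conv S.1 ↔ g ∈ P} := by
      ext S
      simp only [Set.mem_ofPred_eq, Set.mem_iInter]
      constructor
      · rintro rfl g hg
        simp [hg]
      · intro h
        ext g
        constructor
        · exact fun hg => (h g hg.2).1 hg.1
        · exact fun hg => ⟨(h g (hP hg)).2 hg, hP hg⟩
    rw [this]
    refine hB.isClopen_biInter fun g _ => ?_
    by_cases hg : g ∈ P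
    · simpa [hg] using isClopen_mem_conv g
    · simp only [hg, iff_false]
      exact (isClopen_mem_conv g).compl
  · have : {S : ClosedSubsets N | conv S.1 ∩ B = P} = ∅ := by
      ext S
      simp only [Set.mem_ofPred_eq, Set.mem_empty_iff_false, iff_false]
      rintro rfl
      exact hP Set.inter_subset_right
    rw [this]
    exact isClopen_empty

theorem isClopen_typeClass (r : ℕ) (P : Set (F N)) : IsClopen (typeClass r P) :=
  isClopen_hullAtOne.inter (isClopen_conv_inter (finite_ball r) P)

theorem typeClass_subset (r : ℕ) (P : Set (F N)) : typeClass r P ⊆ hullAtOne N := fun _ h => h.1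

theorem isCompact_typeClass (r : ℕ) (P : Set (F N)) : IsCompact (typeClass r P) :=
  isCompact_hullAtOne.of_isClosed_subset (isClopen_typeClass r P).1 (typeClass_subset r P)

/-- A closed set whose hull contains the identity is the set of ends of the rays from the identity
that stay in the hull. -/
theorem conv_injOn : Set.InjOn (fun S : ClosedSubsets N => conv S.1) (hullAtOne N) := by
  intro S hS S' hS' h
  apply Subtype.ext
  ext ξ
  rw [mem_iff_pre_mem_conv S.2.1 hS, mem_iff_pre_mem_conv S'.2.1 hS']
  simp only at h
  rw [h]

theorem ball_mono {r r' : ℕ} (h : r ≤ r') : ball N r ⊆ ball N r' := fun _ hg => hg.trans h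

theorem typeClass_anti {r r' : ℕ} (h : r ≤ r') (S : ClosedSubsets N) :
    typeClass r' (conv S.1 ∩ ball N r') ⊆ typeClass r (conv S.1 ∩ ball N r) := by
  rintro S' ⟨h1, h2⟩
  refine ⟨h1, ?_⟩
  have e := congrArg (· ∩ ball N r) h2
  simpa only [Set.inter_assoc, Set.inter_eq_self_of_subset_right (ball_mono h)] using e

/-- The classes around `S` are compact, decrease with the radius and contain in common at most `S`,
since the hull determines the set. By compactness one of them lies in `U`: the classes form a
neighbourhood basis in `hullAtOne`. -/
theorem exists_typeClass_subset {S : ClosedSubsets N} {U : Set (ClosedSubsets N)}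
    (hU : IsOpen U) (hSU : S ∈ U) : ∃ r, typeClass r (conv S.1 ∩ ball N r) ⊆ U := by
  refine exists_subset_nhds_of_isCompact' (V := fun r => typeClass r (conv S.1 ∩ ball N r)) ?_
    (fun r => isCompact_typeClass _ _) (fun r => (isClopen_typeClass _ _).1) ?_
  · exact directed_of_isDirected_le fun r r' h => typeClass_anti h S
  · intro S' hS'
    rw [Set.mem_iInter] at hS'
    have hc : conv S'.1 = conv S.1 := by
      ext g
      have := Set.ext_iff.1 (hS' g.norm).2 g
      simpa [ball] using this
    have h1 := (hS' 0).1
    have : S' = S := conv_injOn h1 (show 1 ∈ conv S.1 from hc ▸ h1) hc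
    rw [this]
    exact hU.mem_nhds hSU

theorem exists_finset_cover {K : Set (ClosedSubsets N)} (hK : IsCompact K) :
    ∃ t : Finset (F N), K ⊆ ⋃ g ∈ t, {S | g ∈ conv S.1} :=
  hK.elim_finite_subcover _ (fun g => (isClopen_mem_conv g).2) fun S _ => by
    obtain ⟨g, hg⟩ := exists_mem_conv S.2.2
    exact Set.mem_iUnion.2 ⟨g, hg⟩

theorem mem_conv_smul {g h : F N} {S : ClosedSubsets N} :
    h ∈ conv (g • S).1 ↔ g⁻¹ * h ∈ conv S.1 := by
  rw [smul_val, mem_conv_image]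

theorem measurable_smul_F (g : F N) : Measurable (fun S : ClosedSubsets N => g • S) :=
  (continuous_const_smul g).measurable

theorem measure_mem_conv_of_invariant {μ : Measure (ClosedSubsets N)}
    (h : ∀ g : F N, μ.map (g • ·) = μ) (g : F N) : μ {S | g ∈ conv S.1} = μ (hullAtOne N) := by
  conv_lhs => rw [← h g]
  rw [Measure.map_apply (measurable_smul_F g) (isClopen_mem_conv g).1.measurableSet]
  congr 1
  ext S
  simp [mem_conv_smul, hullAtOne]

/-- Every hull has a vertex, so a compact set is covered by finitely many translates of `hullAtOne`,
which all have the same measure. -/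
theorem mem_subsetCurrents_of_hullAtOne {μ : Measure (ClosedSubsets N)}
    (h : ∀ g : F N, μ.map (g • ·) = μ) (h1 : μ (hullAtOne N) < ∞) : μ ∈ subsetCurrents N := by
  refine ⟨h, fun K hK => ?_⟩
  obtain ⟨t, ht⟩ := exists_finset_cover hK
  refine (measure_mono ht).trans_lt ((measure_biUnion_finset_le _ _).trans_lt ?_)
  refine ENNReal.sum_lt_top.2 fun g _ => ?_
  rwa [measure_mem_conv_of_invariant h]

/-! ### Weak-* topology in terms of the measures of type classes -/

namespace SCurr

theorem measure_preimage_smul (μ : SCurr N) (g : F N) {A : Set (ClosedSubsets N)}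
    (hA : MeasurableSet A) : μ.1 {S | g • S ∈ A} = μ.1 A := by
  conv_rhs => rw [← μ.2.1 g]
  rw [Measure.map_apply (measurable_smul_F g) hA]
  rfl

theorem lt_top (μ : SCurr N) : μ.1 (hullAtOne N) < ∞ := μ.2.2 _ isCompact_hullAtOne

theorem typeClass_ne_top (μ : SCurr N) (r : ℕ) (P : Set (F N)) : μ.1 (typeClass r P) ≠ ∞ :=
  (μ.2.2 _ (isCompact_typeClass r P)).ne

instance (μ : SCurr N) : IsFiniteMeasureOnCompacts μ.1 := ⟨fun {_} hK => μ.2.2 _ hK⟩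

instance (μ : SCurr N) : SigmaFinite μ.1 := by
  refine ⟨⟨⟨fun n => ⋃ g ∈ ball N n, {S | g ∈ conv S.1}, fun _ => trivial, fun n => ?_, ?_⟩⟩⟩
  · have := (finite_ball (N := N) n).to_subtype
    refine (measure_biUnion_lt_top (finite_ball n) fun g _ => ?_)
    rw [measure_mem_conv_of_invariant μ.2.1]
    exact μ.lt_top
  · ext S
    simp only [Set.mem_iUnion, Set.mem_univ, iff_true]
    obtain ⟨g, hg⟩ := exists_mem_conv S.2.2
    exact ⟨g.norm, g, le_refl g.norm, hg⟩

/-- The indicator of a compact open set is itself a test function. -/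
theorem continuous_measure {C : Set (ClosedSubsets N)} (hC : IsClopen C) (hK : IsCompact C) :
    Continuous fun μ : SCurr N => (μ.1 C).toReal := by
  let f : C_c(ClosedSubsets N, ℝ) :=
    ⟨⟨C.indicator 1, (continuous_const (y := (1 : ℝ))).indicator
      fun S hS => by rw [hC.frontier_eq] at hS; exact absurd hS (Set.notMem_empty _)⟩,
     HasCompactSupport.intro hK fun S hS => Set.indicator_of_notMem hS _⟩
  have e : (fun μ : SCurr N => (μ.1 C).toReal) =
      (fun φ : C_c(ClosedSubsets N, ℝ) → ℝ => φ f) ∘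
      (fun (μ : SCurr N) (f : C_c(ClosedSubsets N, ℝ)) =>
        ∫ S, f S ∂(μ : Measure (ClosedSubsets N))) := by
    funext μ
    simp only [Function.comp]
    change _ = ∫ S, C.indicator 1 S ∂μ.1
    rw [integral_indicator_one hC.1.measurableSet]
    rfl
  rw [e]
  exact (continuous_apply f).comp continuous_induced_dom

theorem integrable (μ : SCurr N) {f : ClosedSubsets N → ℝ} (hf : Continuous f) {t : Finset (F N)}
    (ht : Function.support f ⊆ ⋃ g ∈ t, {S | g ∈ conv S.1}) : Integrable f μ.1 := by
  refine hf.integrable_of_hasCompactSupport (HasCompactSupport.intro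
    (K := ⋃ g ∈ t, {S | g ∈ conv S.1}) (t.isCompact_biUnion fun g _ => ?_) fun S hS => ?_)
  · have : {S : ClosedSubsets N | g ∈ conv S.1} = (g⁻¹ • ·) ⁻¹' hullAtOne N := by
      ext S
      simp [hullAtOne, mem_conv_smul]
    rw [this]
    exact (Homeomorph.smul g⁻¹).isCompact_preimage.2 isCompact_hullAtOne
  · by_contra h
    exact hS (ht h)

theorem integral_smul (μ : SCurr N) (g : F N) (f : ClosedSubsets N → ℝ) :
    ∫ S, f (g • S) ∂μ.1 = ∫ S, f S ∂μ.1 := by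
  have := integral_map_equiv (Homeomorph.smul g : ClosedSubsets N ≃ₜ _).toMeasurableEquiv f (μ := μ.1)
  rw [show Measure.map (Homeomorph.smul g : ClosedSubsets N ≃ₜ _).toMeasurableEquiv μ.1 = μ.1 from
    μ.2.1 g] at this
  exact this.symm

/-- By invariance, only the functions supported on the sets whose hull contains the identity matter. -/
theorem exists_integral_eq (t : Finset (F N)) (f : ClosedSubsets N → ℝ) (hf : Continuous f)
    (ht : Function.support f ⊆ ⋃ g ∈ t, {S | g ∈ conv S.1}) :
    ∃ f₁ : ClosedSubsets N → ℝ, Continuous f₁ ∧ Function.support f₁ ⊆ hullAtOne N ∧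
      ∀ μ : SCurr N, ∫ S, f S ∂μ.1 = ∫ S, f₁ S ∂μ.1 := by
  classical
  induction t using Finset.induction_on generalizing f with
  | empty =>
    have : f = 0 := by simpa using ht
    exact ⟨f, hf, by simp [this], fun _ => rfl⟩
  | insert g t _ ih =>
    set A : Set (ClosedSubsets N) := {S | g ∈ conv S.1}
    have hA : IsClopen A := isClopen_mem_conv g
    have hc : ∀ B : Set (ClosedSubsets N), IsClopen B → Continuous (B.indicator f) := fun B hB =>
      hf.indicator fun S hS => by rw [hB.frontier_eq] at hS; exact absurd hS (Set.notMem_empty _)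
    have hs : Function.support (Aᶜ.indicator f) ⊆ ⋃ g ∈ t, {S | g ∈ conv S.1} := by
      intro S hS
      rw [Set.support_indicator] at hS
      have := ht hS.2
      rw [Finset.set_biUnion_insert] at this
      exact this.resolve_left hS.1
    obtain ⟨f₁, h1, h2, h3⟩ := ih (Aᶜ.indicator f) (hc _ hA.compl) hs
    have hs' : Function.support (A.indicator f) ⊆ ⋃ h ∈ ({g} : Finset (F N)), {S | h ∈ conv S.1} := by
      rw [Set.support_indicator]
      simp [A]
    have hs1 : Function.support (fun S => A.indicator f (g • S)) ⊆ hullAtOne N := by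
      intro S hS
      by_contra h
      refine hS (Set.indicator_of_notMem (fun h' => h ?_) _)
      simpa [A, mem_conv_smul, hullAtOne] using h'
    have hint : ∀ (μ : SCurr N) (k : ClosedSubsets N → ℝ), Continuous k →
        Function.support k ⊆ hullAtOne N → Integrable k μ.1 := fun μ k hk h =>
      integrable μ hk (t := {1}) (by simpa [hullAtOne] using h)
    -- The part of `f` on the hulls through `g` is pulled back by `g` and becomes supported in
    -- `hullAtOne`, with the same integrals. The rest is covered by the remaining vertices `t`.
    refine ⟨fun S => A.indicator f (g • S) + f₁ S, ((hc A hA).comp (continuous_const_smul g)).add h1,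
      (Function.support_add _ _).trans (Set.union_subset hs1 h2), fun μ => ?_⟩
    change _ = ∫ S, A.indicator f (g • S) + f₁ S ∂μ.1
    rw [integral_add (hint μ (fun S => A.indicator f (g • S))
        ((hc A hA).comp (continuous_const_smul g)) hs1) (hint μ _ h1 h2),
      integral_smul μ g (A.indicator f), ← h3 μ,
      ← integral_add (integrable μ (hc A hA) hs') (integrable μ (hc _ hA.compl) hs)]
    congr 1
    funext S
    exact (congrFun (Set.indicator_self_add_compl A f) S).symm

/-- The possible intersections of a convex hull with the ball of radius `r`. -/
def types (N r : ℕ) : Finset (Set (F N)) := (finite_ball (N := N) r).finite_subsets.toFinset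

theorem inter_mem_types (r : ℕ) (S : Set (F N)) : S ∩ ball N r ∈ types N r := by
  simp [types]

theorem hullAtOne_eq_biUnion (r : ℕ) : hullAtOne N = ⋃ P ∈ types N r, typeClass r P := by
  ext S
  simp only [Set.mem_iUnion, exists_prop]
  constructor
  · exact fun h => ⟨_, inter_mem_types r _, h, rfl⟩
  · rintro ⟨P, _, h⟩
    exact h.1

theorem typeClass_disjoint (r : ℕ) {P P' : Set (F N)} (h : P ≠ P') :
    Disjoint (typeClass r P) (typeClass r P') :=
  Set.disjoint_left.2 fun _ h1 h2 => h (h1.2.symm.trans h2.2)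

theorem measure_hullAtOne (μ : SCurr N) (r : ℕ) :
    (μ.1 (hullAtOne N)).toReal = ∑ P ∈ types N r, (μ.1 (typeClass r P)).toReal := by
  rw [hullAtOne_eq_biUnion r, measure_biUnion_finset
    (fun P _ P' _ h => typeClass_disjoint r h) fun P _ => (isClopen_typeClass r P).1.measurableSet,
    ENNReal.toReal_sum fun P _ => typeClass_ne_top μ r P]

/-- By compactness `f` varies by at most `ε` on each class of sufficiently large radius, so it is
uniformly close to a step function. The coefficients do not depend on the current, which allows two
currents to be compared. -/
theorem exists_approx (f : ClosedSubsets N → ℝ) (hf : Continuous f)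
    (hs : Function.support f ⊆ hullAtOne N) {ε : ℝ} (hε : 0 < ε) :
    ∀ᶠ r in atTop, ∃ c : Set (F N) → ℝ, ∀ μ : SCurr N,
      |∫ S, f S ∂μ.1 - ∑ P ∈ types N r, c P * (μ.1 (typeClass r P)).toReal| ≤
        ε * (μ.1 (hullAtOne N)).toReal := by
  classical
  have h1 : ∀ S₀ : ClosedSubsets N, ∃ r, ∀ S ∈ typeClass r (conv S₀.1 ∩ ball N r),
      |f S - f S₀| < ε / 2 := fun S₀ =>
    exists_typeClass_subset (U := {S | |f S - f S₀| < ε / 2})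
      (isOpen_lt (by fun_prop) continuous_const) (by simpa using half_pos hε)
  choose r hr using h1
  obtain ⟨t, ht⟩ := isCompact_hullAtOne.elim_nhds_subcover
    (fun S₀ => typeClass (r S₀) (conv S₀.1 ∩ ball N (r S₀)))
    (fun S₀ hS₀ => (isClopen_typeClass _ _).2.mem_nhds ⟨hS₀, rfl⟩)
  filter_upwards [eventually_ge_atTop (t.sup r)] with n hn
  have key : ∀ P, ∀ S ∈ typeClass n P, ∀ S' ∈ typeClass n P, |f S - f S'| ≤ ε := by
    rintro P S hS S' ⟨h1', hS'⟩
    obtain ⟨S₀, hS₀, hm⟩ := Set.mem_iUnion₂.1 (ht.2 hS.1)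
    have hle : r S₀ ≤ n := (Finset.le_sup hS₀).trans hn
    have hm' : S' ∈ typeClass (r S₀) (conv S₀.1 ∩ ball N (r S₀)) := by
      rw [← hm.2]
      exact typeClass_anti hle S ⟨h1', by rw [hS', hS.2]⟩
    have a := abs_lt.1 (hr S₀ S hm)
    have b := abs_lt.1 (hr S₀ S' hm')
    rw [abs_le]
    constructor <;> linarith
  let c : Set (F N) → ℝ := fun P => if h : (typeClass n P).Nonempty then f h.some else 0
  refine ⟨c, fun μ => ?_⟩
  have hg : ∑ P ∈ types N n, c P * (μ.1 (typeClass n P)).toReal =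
      ∫ S, ∑ P ∈ types N n, (typeClass n P).indicator (fun _ => c P) S ∂μ.1 := by
    rw [integral_finsetSum]
    · refine Finset.sum_congr rfl fun P _ => ?_
      rw [integral_indicator_const _ (isClopen_typeClass n P).1.measurableSet, smul_eq_mul, mul_comm]
      rfl
    · intro P _
      exact (integrable_indicator_iff (isClopen_typeClass n P).1.measurableSet).2
        (integrableOn_const (typeClass_ne_top μ n P))
  have hgi : Integrable (fun S => ∑ P ∈ types N n, (typeClass n P).indicator (fun _ => c P) S) μ.1 :=
    integrable_finsetSum _ fun P _ =>
      (integrable_indicator_iff (isClopen_typeClass n P).1.measurableSet).2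
        (integrableOn_const (typeClass_ne_top μ n P))
  have hfi : Integrable f μ.1 := integrable μ hf (t := {1}) (by simpa [hullAtOne] using hs)
  rw [hg, ← integral_sub hfi hgi, ← Real.norm_eq_abs]
  have hb : ∀ S, ‖f S - ∑ P ∈ types N n, (typeClass n P).indicator (fun _ => c P) S‖ ≤
      (hullAtOne N).indicator (fun _ => ε) S := by
    intro S
    by_cases hS : S ∈ hullAtOne N
    · rw [Finset.sum_eq_single (conv S.1 ∩ ball N n), Set.indicator_of_mem hS,
        Set.indicator_of_mem (show S ∈ typeClass n _ from ⟨hS, rfl⟩), Real.norm_eq_abs]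
      · have hne : (typeClass n (conv S.1 ∩ ball N n)).Nonempty := ⟨S, hS, rfl⟩
        simp only [c, dif_pos hne]
        exact key _ _ ⟨hS, rfl⟩ _ hne.some_mem
      · intro P _ hP
        exact Set.indicator_of_notMem (fun h => hP h.2.symm) _
      · exact fun h => absurd (inter_mem_types n _) h
    · have h0 : f S = 0 := by
        by_contra h
        exact hS (hs h)
      rw [Set.indicator_of_notMem hS, h0, Finset.sum_eq_zero, sub_zero, norm_zero]
      exact fun P _ => Set.indicator_of_notMem (fun h => hS h.1) _
  refine (norm_integral_le_of_norm_le ?_ (Eventually.of_forall hb)).trans ?_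
  · exact (integrable_indicator_iff isClopen_hullAtOne.1.measurableSet).2
      (integrableOn_const μ.lt_top.ne)
  · rw [integral_indicator_const _ isClopen_hullAtOne.1.measurableSet, smul_eq_mul, mul_comm]
    rfl

/-- The radius is chosen first, to make `f` nearly a step function; then `δ`, depending on the
number of types and on the coefficients. Closeness on classes also bounds the mass of `ν` at the
identity, which enters the approximation error. -/
theorem eventually_integral_close (f : C_c(ClosedSubsets N, ℝ)) (μ : SCurr N) {η : ℝ} (hη : 0 < η) :
    ∀ᶠ r in atTop, ∀ᶠ δ in 𝓝[>] (0 : ℝ), ∀ ν : SCurr N,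
      (∀ P, |(ν.1 (typeClass r P)).toReal - (μ.1 (typeClass r P)).toReal| ≤ δ) →
        |∫ S, f S ∂ν.1 - ∫ S, f S ∂μ.1| < η := by
  obtain ⟨t, ht⟩ := exists_finset_cover f.hasCompactSupport
  obtain ⟨f₁, h1, h2, h3⟩ := exists_integral_eq t f f.continuous (subset_closure.trans ht)
  set m := (μ.1 (hullAtOne N)).toReal
  have hm : 0 ≤ m := ENNReal.toReal_nonneg
  -- The approximation errors for `μ` and `ν` are `ε` times masses of `m` and at most `m + 1`.
  obtain ⟨ε, hε, hεm⟩ : ∃ ε > 0, ε * (2 * m + 1) < η / 2 := by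
    refine ⟨η / (4 * (2 * m + 1)), by positivity, ?_⟩
    rw [div_mul_eq_mul_div, div_lt_iff₀ (by positivity)]
    nlinarith
  filter_upwards [exists_approx f₁ h1 h2 hε] with r ⟨c, hc⟩
  have e1 : ∀ᶠ δ in 𝓝[>] (0 : ℝ), ((types N r).card : ℝ) * δ < 1 := by
    have : Tendsto (fun δ : ℝ => ((types N r).card : ℝ) * δ) (𝓝[>] 0)
        (𝓝 (((types N r).card : ℝ) * 0)) :=
      ((continuous_const.mul continuous_id).tendsto 0).mono_left nhdsWithin_le_nhds
    rw [mul_zero] at this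
    exact this.eventually (gt_mem_nhds one_pos)
  have e2 : ∀ᶠ δ in 𝓝[>] (0 : ℝ), (∑ P ∈ types N r, |c P|) * δ < η / 2 := by
    have : Tendsto (fun δ : ℝ => (∑ P ∈ types N r, |c P|) * δ) (𝓝[>] 0)
        (𝓝 ((∑ P ∈ types N r, |c P|) * 0)) :=
      ((continuous_const.mul continuous_id).tendsto 0).mono_left nhdsWithin_le_nhds
    rw [mul_zero] at this
    exact this.eventually (gt_mem_nhds (half_pos hη))
  filter_upwards [e1, e2] with δ hδ1 hδ2 ν hν
  rw [h3, h3]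
  have a := abs_le.1 (hc ν)
  have b := abs_le.1 (hc μ)
  have hνm : (ν.1 (hullAtOne N)).toReal ≤ m + 1 := by
    have : (ν.1 (hullAtOne N)).toReal - m ≤ (types N r).card * δ := by
      simp only [m]
      rw [measure_hullAtOne ν r, measure_hullAtOne μ r, ← Finset.sum_sub_distrib, ← nsmul_eq_mul]
      exact Finset.sum_le_card_nsmul _ _ _ fun P _ => (abs_le.1 (hν P)).2
    linarith
  have hd : |∑ P ∈ types N r, c P * (ν.1 (typeClass r P)).toReal -
      ∑ P ∈ types N r, c P * (μ.1 (typeClass r P)).toReal| ≤ (∑ P ∈ types N r, |c P|) * δ := by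
    rw [← Finset.sum_sub_distrib, Finset.sum_mul]
    refine (Finset.abs_sum_le_sum_abs _ _).trans (Finset.sum_le_sum fun P _ => ?_)
    rw [← mul_sub, abs_mul]
    exact mul_le_mul_of_nonneg_left (hν P) (abs_nonneg _)
  have d := abs_le.1 hd
  have : ε * (ν.1 (hullAtOne N)).toReal ≤ ε * (m + 1) := mul_le_mul_of_nonneg_left hνm hε.le
  have e : ε * (2 * m + 1) = ε * m + ε * (m + 1) := by ring
  have a1 := a.1
  have a2 := a.2
  have b1 := b.1
  have b2 := b.2
  rw [abs_lt]
  constructor <;> linarith [d.1, d.2]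

/-- Approximation of the measures of all type classes implies weak-* approximation. -/
theorem mem_closure_of_approx {s : Set (SCurr N)} {μ : SCurr N}
    (h : ∀ r : ℕ, 1 ≤ r → ∀ δ > (0 : ℝ), ∃ ν ∈ s,
      ∀ P, |(ν.1 (typeClass r P)).toReal - (μ.1 (typeClass r P)).toReal| ≤ δ) : μ ∈ closure s := by
  rw [mem_closure_iff_nhds]
  intro U hU
  rw [nhds_induced, Filter.mem_comap, nhds_pi] at hU
  obtain ⟨V, hV, hVU⟩ := hU
  rw [Filter.mem_pi] at hV
  obtain ⟨I, hI, t, ht, htV⟩ := hV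
  have h1 : ∀ f ∈ I, ∀ᶠ r in atTop, ∀ᶠ δ in 𝓝[>] (0 : ℝ), ∀ ν : SCurr N,
      (∀ P, |(ν.1 (typeClass r P)).toReal - (μ.1 (typeClass r P)).toReal| ≤ δ) →
        ∫ S, f S ∂ν.1 ∈ t f := by
    intro f _
    obtain ⟨η, hη, hb⟩ := Metric.mem_nhds_iff.1 (ht f)
    filter_upwards [eventually_integral_close f μ hη] with r hr
    filter_upwards [hr] with δ hδ ν hν
    apply hb
    rw [Metric.mem_ball, Real.dist_eq]
    exact hδ ν hν
  rw [← Filter.eventually_all_finite hI] at h1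
  obtain ⟨r, hr, hr1⟩ := (h1.and (eventually_ge_atTop 1)).exists
  rw [← Filter.eventually_all_finite hI] at hr
  obtain ⟨δ, hδ, hδ0⟩ := (hr.and self_mem_nhdsWithin).exists
  obtain ⟨ν, hνs, hν⟩ := h r hr1 δ hδ0
  exact ⟨ν, hVU (htV fun f hf => hδ f hf ν hν), hνs⟩

end SCurr

/-! ### Ê and V̂ in terms of hulls through an edge and through a vertex -/

theorem lt_ne_one (x : Letter N) : lt x ≠ 1 := fun h => by
  have := congrArg FreeGroup.toWord h
  simp [lt, FreeGroup.toWord_mk] at this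

theorem toWord_lt (x : Letter N) : (lt x).toWord = [x] := by
  simp [lt, FreeGroup.toWord_mk]

theorem norm_lt (x : Letter N) : (lt x).norm = 1 := by simp [FreeGroup.norm, toWord_lt]

theorem cayley_adj {u v : F N} : (cayley N).Adj u v ↔ ∃ x : Letter N, v = u * lt x := by
  rw [cayley, SimpleGraph.mulCayley_adj']
  constructor
  · rintro ⟨-, _, ⟨a, rfl⟩, rfl | rfl⟩
    · exact ⟨(a, true), rfl⟩
    · refine ⟨linv (a, true), ?_⟩
      rw [lt_linv]
      change v = v * lt (a, true) * _
      rw [mul_inv_cancel_right]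
  · rintro ⟨⟨a, b⟩, rfl⟩
    refine ⟨fun h => lt_ne_one (a, b) (by simpa using h), FreeGroup.of a, ⟨a, rfl⟩, ?_⟩
    cases b
    · right
      change u = u * lt (linv (a, true)) * lt (a, true)
      rw [lt_linv, inv_mul_cancel_right]
    · exact Or.inl rfl

theorem mem_cyl {u : F N} {x : Letter N} {ξ : Boundary N} : ξ ∈ cyl u (u * lt x) ↔ dir u ξ = x := by
  change u * (u⁻¹ • ξ).pre 1 = _ ↔ _
  rw [Boundary.pre_one, mul_left_cancel_iff, lt_injective.eq_iff]
  rfl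

theorem mem_cyl_one {x : Letter N} {ξ : Boundary N} : ξ ∈ cyl 1 (lt x) ↔ dir 1 ξ = x := by
  have := mem_cyl (u := 1) (x := x) (ξ := ξ)
  rwa [one_mul] at this

theorem eq_one_or_lt_of_norm_le_one {g : F N} (h : g.norm ≤ 1) : g = 1 ∨ ∃ x, g = lt x := by
  rw [FreeGroup.norm] at h
  rcases hw : g.toWord with _ | ⟨x, _ | ⟨y, w⟩⟩
  · left
    exact FreeGroup.toWord_eq_nil_iff.1 hw
  · right
    exact ⟨x, by rw [lt, ← hw, FreeGroup.mk_toWord]⟩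
  · rw [hw] at h
    simp at h

theorem ncard_neighbors_edgeTree (a : Fin N) (u v : F N)
    (h : edgeTree a = {u, v}) (hne : u ≠ v) (hadj : (cayley N).Adj u v) :
    degreeIn (edgeTree a) u = 1 := by
  rw [degreeIn, Set.ncard_eq_one]
  refine ⟨v, ?_⟩
  ext w
  simp only [h, Set.mem_insert_iff, Set.mem_singleton_iff, Set.mem_ofPred_eq]
  constructor
  · rintro ⟨rfl | rfl, h'⟩
    · exact absurd h' (SimpleGraph.irrefl _)
    · rfl
  · rintro rfl
    exact ⟨Or.inr rfl, hadj⟩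

/-- Both endpoints have degree one, so both orientations of the edge are terminal. The two cylinders
are complementary; meeting both means that the edge lies in the hull. -/
theorem sCyl_edgeTree (a : Fin N) :
    sCyl (edgeTree a) = {S | 1 ∈ conv S.1 ∧ FreeGroup.of a ∈ conv S.1} := by
  set x : Letter N := (a, true)
  have hx : FreeGroup.of a = lt x := rfl
  have hadj : (cayley N).Adj 1 (lt x) := cayley_adj.2 ⟨x, by simp⟩
  have hd1 := ncard_neighbors_edgeTree a 1 (lt x) rfl (lt_ne_one x).symm hadj
  have hd2 := ncard_neighbors_edgeTree a (lt x) 1 (Set.pair_comm _ _) (lt_ne_one x) hadj.symm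
  have hlt : lt x * lt (linv x) = 1 := by rw [lt_linv, mul_inv_cancel]
  have hc2 : ∀ ξ : Boundary N, ξ ∈ cyl (lt x) 1 ↔ dir 1 ξ ≠ x := by
    intro ξ
    have h1 := mem_cyl (u := lt x) (x := linv x) (ξ := ξ)
    have h2 := dir_mul_lt 1 x ξ
    rw [hlt] at h1
    rw [one_mul] at h2
    rw [h1, ← not_iff_not, not_ne_iff, ← h2]
  have ht : terminalEdges (edgeTree a) = {(1, lt x), (lt x, 1)} := by
    ext ⟨u, v⟩
    simp only [terminalEdges, Set.mem_ofPred_eq, Set.mem_insert_iff, Set.mem_singleton_iff,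
      Prod.mk.injEq]
    constructor
    · rintro ⟨rfl | rfl, rfl | rfl, h, -⟩
      · exact absurd h (SimpleGraph.irrefl _)
      · exact Or.inl ⟨rfl, rfl⟩
      · exact Or.inr ⟨rfl, rfl⟩
      · exact absurd h (SimpleGraph.irrefl _)
    · rintro (⟨rfl, rfl⟩ | ⟨rfl, rfl⟩)
      · exact ⟨Or.inl rfl, Or.inr rfl, hadj, hd2⟩
      · exact ⟨Or.inr rfl, Or.inl rfl, hadj.symm, hd1⟩
  ext S
  simp only [sCyl, ht, Set.mem_ofPred_eq, Set.biUnion_insert,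
    Set.forall_mem_insert, Set.mem_singleton_iff, forall_eq]
  constructor
  · rintro ⟨-, ⟨ξ, hξ, h1⟩, ⟨ζ, hζ, h2⟩⟩
    rw [mem_cyl_one] at h1
    rw [hc2] at h2
    have h3 : 1 ∈ conv S.1 := ⟨ξ, hξ, ζ, hζ, fun e => h2 (Eq.trans e.symm h1)⟩
    refine ⟨h3, ?_⟩
    have := (mul_lt_mem_conv_iff h3 (x := x)).2 ⟨ξ, hξ, h1⟩
    rwa [one_mul] at this
  · rintro ⟨h1, h2⟩
    have h3 := mul_lt_mem_conv_iff h1 (x := x)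
    rw [one_mul] at h3
    obtain ⟨ξ, hξ, hd⟩ := h3.1 h2
    obtain ⟨ζ, hζ, hne⟩ := exists_dir_ne h1 x
    refine ⟨fun ζ _ => ?_, ⟨ξ, hξ, mem_cyl_one.2 hd⟩, ⟨ζ, hζ, (hc2 ζ).2 hne⟩⟩
    by_cases h : dir 1 ζ = x
    · exact Or.inl (mem_cyl_one.2 h)
    · exact Or.inr (Set.mem_biUnion rfl ((hc2 ζ).2 h))

/-- The sets whose convex hull contains the edge from the identity to `a`. -/
def hullAtEdge (a : Fin N) : Set (ClosedSubsets N) := {S | 1 ∈ conv S.1 ∧ FreeGroup.of a ∈ conv S.1}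

theorem isClopen_hullAtEdge (a : Fin N) : IsClopen (hullAtEdge a) :=
  isClopen_hullAtOne.inter (isClopen_mem_conv _)

theorem hullAtEdge_subset (a : Fin N) : hullAtEdge a ⊆ hullAtOne N := fun _ h => h.1

theorem eHat_eq (μ ν : SCurr N) : eHat μ ν = ∑ a : Fin N, μ.1 (hullAtEdge a) * ν.1 (hullAtEdge a) := by
  simp only [eHat, sCyl_edgeTree, hullAtEdge]

/-- A set of vertices containing the prefixes of its elements spans a connected subgraph. -/
theorem connected_of_take_mem {T : Set (F N)} (h1 : 1 ∈ T)
    (h : ∀ g ∈ T, ∀ n, FreeGroup.mk (g.toWord.take n) ∈ T) : ((cayley N).induce T).Connected := by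
  have key : ∀ g (hg : g ∈ T), ((cayley N).induce T).Reachable ⟨1, h1⟩ ⟨g, hg⟩ := by
    intro g hg
    have : ∀ n, ((cayley N).induce T).Reachable ⟨1, h1⟩ ⟨_, h g hg n⟩ := by
      intro n
      induction n with
      | zero => exact SimpleGraph.Reachable.refl _
      | succ n ih =>
        by_cases hn : n < g.toWord.length
        · refine ih.trans (SimpleGraph.Adj.reachable ?_)
          rw [SimpleGraph.comap_adj]
          refine cayley_adj.2 ⟨g.toWord[n], ?_⟩
          change FreeGroup.mk _ = FreeGroup.mk _ * _
          rw [← List.take_concat_get' _ _ hn, mk_append]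
          rfl
        · have e : g.toWord.take (n + 1) = g.toWord.take n := by
            rw [List.take_of_length_le (by omega), List.take_of_length_le (by omega)]
          simpa only [e] using ih
    have h2 := this g.toWord.length
    simpa only [List.take_length, FreeGroup.mk_toWord] using h2
  exact { preconnected := fun a b => (key a.1 a.2).symm.trans (key b.1 b.2), nonempty := ⟨⟨1, h1⟩⟩ }

theorem IsConvex.isFiniteSubtree {T : Set (F N)} (h : IsConvex T) (hf : T.Finite) (h1 : 1 ∈ T) :
    IsFiniteSubtree T := ⟨hf, connected_of_take_mem h1 fun _ hg n => h.take_mem h1 hg n⟩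

theorem exists_adj_of_connected {T : Set (F N)} (h : ((cayley N).induce T).Connected) {g k : F N}
    (hg : g ∈ T) (hk : k ∈ T) (hne : g ≠ k) : ∃ w ∈ T, (cayley N).Adj g w := by
  obtain ⟨p⟩ := h.preconnected ⟨g, hg⟩ ⟨k, hk⟩
  cases p with
  | nil => exact absurd rfl hne
  | cons h _ => exact ⟨_, Subtype.coe_prop _, h⟩

theorem norm_lt_mul_lt {x y : Letter N} (h : (lt x * lt y).norm ≤ 1) : lt x * lt y = 1 := by
  rcases toWord_mul_letter (lt x) y with e | e
  · rw [FreeGroup.norm] at h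
    change FreeGroup.toWord (lt x * lt y) = _ at e
    rw [e, toWord_lt] at h
    simp at h
  · change FreeGroup.toWord (lt x * lt y) = _ at e
    rw [toWord_lt] at e
    exact FreeGroup.toWord_eq_nil_iff.1 (by simpa using e)

/-- A vertex of maximal norm greater than one has a single neighbour in `T`, its predecessor on the
way to the identity. It would be a leaf not adjacent to the identity. -/
theorem subset_ball_of_mem_roundGraphs {T : Set (F N)} (hT : T ∈ roundGraphs N 1) :
    T ⊆ ball N 1 := by
  obtain ⟨⟨hf, hc⟩, h1, -, hd⟩ := hT
  obtain ⟨g, hg, hmax⟩ := Set.exists_max_image T FreeGroup.norm hf ⟨1, h1⟩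
  suffices g.norm ≤ 1 from fun k hk => (hmax k hk).trans this
  by_contra hn
  push Not at hn
  have hne : g ≠ 1 := fun h => by simp [h] at hn
  obtain ⟨w, hw, hadj⟩ := exists_adj_of_connected hc hg h1 hne
  have huniq : ∀ w ∈ T, (cayley N).Adj g w → w = FreeGroup.mk g.toWord.dropLast := by
    intro w hw hadj
    obtain ⟨x, rfl⟩ := cayley_adj.1 hadj
    have hm := hmax _ hw
    rcases toWord_mul_letter g x with e | e
    · change FreeGroup.toWord (g * lt x) = _ at e
      rw [FreeGroup.norm, FreeGroup.norm, e] at hm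
      simp at hm
    · rw [← e, FreeGroup.mk_toWord]
      rfl
  have hdeg : degreeIn T g = 1 := by
    rw [degreeIn, Set.ncard_eq_one]
    refine ⟨w, Set.eq_singleton_iff_unique_mem.2 ⟨⟨hw, hadj⟩, fun w' hw' => ?_⟩⟩
    rw [huniq w' hw'.1 hw'.2, huniq w hw hadj]
  have hdist := hd g hg hdeg
  rw [SimpleGraph.dist_eq_one_iff_adj] at hdist
  obtain ⟨x, rfl⟩ := cayley_adj.1 hdist
  rw [one_mul, norm_lt] at hn
  omega

theorem degreeIn_lt {T : Set (F N)} (h1 : 1 ∈ T) (hT : T ⊆ ball N 1) (x : Letter N) :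
    degreeIn T (lt x) = 1 := by
  rw [degreeIn, Set.ncard_eq_one]
  refine ⟨1, Set.eq_singleton_iff_unique_mem.2
    ⟨⟨h1, (cayley_adj.2 ⟨x, by simp⟩ : (cayley N).Adj 1 (lt x)).symm⟩, ?_⟩⟩
  rintro w ⟨hw, hadj⟩
  obtain ⟨y, rfl⟩ := cayley_adj.1 hadj
  exact norm_lt_mul_lt (hT hw)

/-- Such a tree is a star: its terminal edges lead from the identity to the other vertices, and the
cylinders record the first letters occurring in `S`. There are at least two of them, so the identity
lies in the hull. -/
theorem sCyl_roundGraph {T : Set (F N)} (hT : T ∈ roundGraphs N 1) : sCyl T = typeClass 1 T := by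
  have hb := subset_ball_of_mem_roundGraphs hT
  obtain ⟨-, h1, hdeg, -⟩ := hT
  have ht : ∀ e : F N × F N, e ∈ terminalEdges T ↔ ∃ x, lt x ∈ T ∧ e = (1, lt x) := by
    rintro ⟨u, v⟩
    constructor
    · rintro ⟨hu, hv, hadj, hd⟩
      simp only at hu hv hadj hd
      rcases eq_one_or_lt_of_norm_le_one (hb hv) with rfl | ⟨x, rfl⟩
      · omega
      · refine ⟨x, hv, ?_⟩
        obtain ⟨y, rfl⟩ := cayley_adj.1 hadj.symm
        rw [norm_lt_mul_lt (hb hu)]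
    · rintro ⟨x, hx, e⟩
      obtain ⟨rfl, rfl⟩ := Prod.mk.injEq _ _ _ _ ▸ e
      exact ⟨h1, hx, cayley_adj.2 ⟨x, by simp⟩, degreeIn_lt h1 hb x⟩
  obtain ⟨u, hu, v, hv, huv⟩ : ∃ u ∈ {w ∈ T | (cayley N).Adj 1 w},
      ∃ v ∈ {w ∈ T | (cayley N).Adj 1 w}, u ≠ v := by
    rw [degreeIn] at hdeg
    exact (Set.one_lt_ncard_iff_nontrivial_and_finite.1 hdeg).1
  obtain ⟨hu, x, rfl⟩ := hu.imp_right cayley_adj.1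
  obtain ⟨hv, y, rfl⟩ := hv.imp_right cayley_adj.1
  rw [one_mul] at hu
  rw [one_mul] at hv
  simp only [one_mul] at huv
  ext S
  constructor
  · rintro ⟨hs, hm⟩
    have hm' : ∀ x, lt x ∈ T → ∃ ξ ∈ S.1, dir 1 ξ = x := fun x hx => by
      obtain ⟨ξ, hξ, hc⟩ := hm (1, lt x) ((ht _).2 ⟨x, hx, rfl⟩)
      exact ⟨ξ, hξ, mem_cyl_one.1 hc⟩
    obtain ⟨ξ, hξ, hξx⟩ := hm' x hu
    obtain ⟨ζ, hζ, hζy⟩ := hm' y hv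
    have hc : 1 ∈ conv S.1 := ⟨ξ, hξ, ζ, hζ, fun e => huv (by rw [← hξx, ← hζy]; exact congrArg lt e)⟩
    refine ⟨hc, ?_⟩
    ext g
    constructor
    · rintro ⟨hg, hg1⟩
      rcases eq_one_or_lt_of_norm_le_one hg1 with rfl | ⟨z, rfl⟩
      · exact h1
      · rw [← one_mul (lt z), mul_lt_mem_conv_iff hc] at hg
        obtain ⟨η, hη, rfl⟩ := hg
        obtain ⟨e, he, hηe⟩ := Set.mem_iUnion₂.1 (hs hη)
        obtain ⟨z, hz, rfl⟩ := (ht e).1 he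
        rw [mem_cyl_one.1 hηe]
        exact hz
    · intro hg
      refine ⟨?_, hb hg⟩
      rcases eq_one_or_lt_of_norm_le_one (hb hg) with rfl | ⟨z, rfl⟩
      · exact hc
      · rw [← one_mul (lt z), mul_lt_mem_conv_iff hc]
        exact hm' z hg
  · rintro ⟨hc, rfl⟩
    constructor
    · intro ξ hξ
      have := mul_lt_mem_conv hc hξ
      rw [one_mul] at this
      exact Set.mem_iUnion₂.2 ⟨(1, lt (dir 1 ξ)),
        (ht _).2 ⟨_, ⟨this, (norm_lt _).le⟩, rfl⟩, mem_cyl_one.2 rfl⟩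
    · intro e he
      obtain ⟨z, hz, rfl⟩ := (ht e).1 he
      have := hz.1
      rw [← one_mul (lt z), mul_lt_mem_conv_iff hc] at this
      obtain ⟨ξ, hξ, h⟩ := this
      exact ⟨ξ, hξ, mem_cyl_one.2 h⟩

theorem conv_inter_ball_mem_roundGraphs {S : ClosedSubsets N} (h : 1 ∈ conv S.1) :
    conv S.1 ∩ ball N 1 ∈ roundGraphs N 1 := by
  set T := conv S.1 ∩ ball N 1
  have h1 : 1 ∈ T := ⟨h, by simp [ball]⟩
  have hb : T ⊆ ball N 1 := Set.inter_subset_right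
  have hf : T.Finite := (finite_ball 1).subset hb
  have hdeg : 1 < degreeIn T 1 := by
    obtain ⟨ξ, hξ, ζ, hζ, hne⟩ := h
    have hm : ∀ ξ ∈ S.1, lt (dir 1 ξ) ∈ {w ∈ T | (cayley N).Adj 1 w} := by
      intro ξ hξ
      have := mul_lt_mem_conv (g := 1) h1.1 hξ
      rw [one_mul] at this
      exact ⟨⟨this, (norm_lt _).le⟩, cayley_adj.2 ⟨dir 1 ξ, by simp⟩⟩
    rw [degreeIn, Set.one_lt_ncard_iff (hf.subset (Set.sep_subset _ _))]
    exact ⟨_, _, hm ξ hξ, hm ζ hζ, fun e => hne (lt_injective e)⟩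
  refine ⟨⟨hf, connected_of_take_mem h1 fun g hg n => ⟨?_, ?_⟩⟩, h1, hdeg, ?_⟩
  · exact (isConvex_conv S.1).take_mem h hg.1 n
  · change FreeGroup.norm _ ≤ 1
    rw [norm_mk_take]
    exact (min_le_right _ _).trans hg.2
  · intro u hu hd
    rw [SimpleGraph.dist_eq_one_iff_adj]
    rcases eq_one_or_lt_of_norm_le_one (hb hu) with rfl | ⟨z, rfl⟩
    · omega
    · exact cayley_adj.2 ⟨z, by simp⟩

/-- The subset cylinders of these round graphs are classes of radius one, which partition
`hullAtOne`. -/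
theorem tsum_roundGraphs (μ : SCurr N) :
    ∑' T : roundGraphs N 1, μ.1 (sCyl T.1) = μ.1 (hullAtOne N) := by
  have : Countable (roundGraphs N 1) := by
    refine (Set.Finite.subset (finite_ball (N := N) 1).finite_subsets fun T hT => ?_).countable.to_subtype
    exact subset_ball_of_mem_roundGraphs hT
  simp only [sCyl_roundGraph (Subtype.prop _)]
  rw [← measure_iUnion]
  · congr 1
    ext S
    simp only [Set.mem_iUnion]
    constructor
    · rintro ⟨T, h⟩
      exact h.1
    · exact fun h => ⟨⟨_, conv_inter_ball_mem_roundGraphs h⟩, h, rfl⟩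
  · intro T T' h
    exact SCurr.typeClass_disjoint 1 fun e => h (Subtype.ext e)
  · exact fun T => (isClopen_typeClass 1 _).1.measurableSet

theorem vHat_eq (μ ν : SCurr N) : vHat μ ν = μ.1 (hullAtOne N) * ν.1 (hullAtOne N) := by
  rw [vHat, tsum_roundGraphs, tsum_roundGraphs]

/-! ### The term ĉ: finiteness, bilinearity and continuity -/

/-- The pairs of types of radius `r + 1` whose intersection is `T`. -/
def typePairs (r : ℕ) (T : Set (F N)) : Finset (Set (F N) × Set (F N)) := by
  classical exact (SCurr.types N (r + 1) ×ˢ SCurr.types N (r + 1)).filter fun p => p.1 ∩ p.2 = T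

theorem mem_typePairs {r : ℕ} {T : Set (F N)} {p : Set (F N) × Set (F N)} :
    p ∈ typePairs r T ↔
      (p.1 ∈ SCurr.types N (r + 1) ∧ p.2 ∈ SCurr.types N (r + 1)) ∧ p.1 ∩ p.2 = T := by
  simp [typePairs]

/-- A vertex of `Y` outside `T` would be joined to the identity by a geodesic in `Y`, which crosses
the sphere of radius `r + 1`. This extra layer is the reason for the types of radius `r + 1` in
`typePairs`. -/
theorem IsConvex.eq_of_inter_ball {Y T : Set (F N)} (hY : IsConvex Y) (h1 : 1 ∈ Y) {r : ℕ}
    (hT : T ⊆ ball N r) (h : Y ∩ ball N (r + 1) = T) : Y = T := by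
  refine Set.Subset.antisymm (fun g hg => ?_) (h ▸ Set.inter_subset_left)
  by_contra hgT
  have hn : r + 1 < g.norm := by
    by_contra hn
    exact hgT (h ▸ ⟨hg, not_lt.1 hn⟩)
  have h2 := norm_mk_take g (r + 1)
  rw [min_eq_left hn.le] at h2
  have h3 : FreeGroup.mk (g.toWord.take (r + 1)) ∈ T := h ▸ ⟨hY.take_mem h1 hg _, h2.le⟩
  have h4 : FreeGroup.norm _ ≤ r := hT h3
  omega

/-- The patterns one layer beyond `T` decide the event, so it is a finite disjoint union of products
of compact open classes. Measurability, bilinearity, symmetry and continuity for a single `T` all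
come from this. -/
theorem pairsWithIntersection_eq {T : Set (F N)} (h1 : 1 ∈ T) {r : ℕ} (hT : T ⊆ ball N r) :
    pairsWithIntersection T =
      ⋃ p ∈ typePairs r T, typeClass (r + 1) p.1 ×ˢ typeClass (r + 1) p.2 := by
  ext ⟨S, S'⟩
  simp only [Set.mem_iUnion, Set.mem_prod, exists_prop, mem_typePairs]
  constructor
  · intro h
    have h' : conv S.1 ∩ conv S'.1 = T := h
    rw [← h'] at h1
    refine ⟨(conv S.1 ∩ ball N (r + 1), conv S'.1 ∩ ball N (r + 1)),
      ⟨⟨SCurr.inter_mem_types _ _, SCurr.inter_mem_types _ _⟩, ?_⟩, ⟨h1.1, rfl⟩, ⟨h1.2, rfl⟩⟩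
    rw [← Set.inter_inter_distrib_right, h', Set.inter_eq_left]
    exact hT.trans (ball_mono (Nat.le_succ r))
  · rintro ⟨⟨P, P'⟩, ⟨-, h⟩, ⟨h2, h3⟩, ⟨h4, h5⟩⟩
    simp only at h h3 h5
    subst h3 h5
    rw [← Set.inter_inter_distrib_right] at h
    exact ((isConvex_conv _).inter (isConvex_conv _)).eq_of_inter_ball ⟨h2, h4⟩ hT h

theorem exists_subset_ball {T : Set (F N)} (hT : T.Finite) : ∃ r, T ⊆ ball N r := by
  obtain ⟨M, hM⟩ := (hT.image FreeGroup.norm).bddAbove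
  exact ⟨M, fun g hg => hM ⟨g, hg, rfl⟩⟩

namespace SCurr

/-- The measure of the pairs of sets whose convex hulls intersect in `T`. -/
def pairMeasure (μ ν : SCurr N) (T : Set (F N)) : ℝ≥0∞ := (μ.1.prod ν.1) (pairsWithIntersection T)

theorem measurableSet_pairs (T : BasedSubtree N) : MeasurableSet (pairsWithIntersection T.1) := by
  obtain ⟨r, hr⟩ := exists_subset_ball T.2.1.finite
  rw [pairsWithIntersection_eq T.2.2 hr]
  exact (typePairs r T.1).measurableSet_biUnion fun p _ =>
    (isClopen_typeClass _ _).1.measurableSet.prod (isClopen_typeClass _ _).1.measurableSet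

theorem pairMeasure_eq (μ ν : SCurr N) {T : Set (F N)} (h1 : 1 ∈ T) {r : ℕ} (hT : T ⊆ ball N r) :
    pairMeasure μ ν T = ∑ p ∈ typePairs r T,
      μ.1 (typeClass (r + 1) p.1) * ν.1 (typeClass (r + 1) p.2) := by
  rw [pairMeasure, pairsWithIntersection_eq h1 hT, measure_biUnion_finset]
  · exact Finset.sum_congr rfl fun p _ => Measure.prod_prod _ _
  · intro p _ p' _ h
    refine Set.disjoint_left.2 fun q hq hq' => h (Prod.ext ?_ ?_)
    · exact hq.1.2.symm.trans hq'.1.2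
    · exact hq.2.2.symm.trans hq'.2.2
  · exact fun p _ => (isClopen_typeClass _ _).1.measurableSet.prod
      (isClopen_typeClass _ _).1.measurableSet

theorem pairMeasure_image (μ ν : SCurr N) (g : F N) (T T' : BasedSubtree N)
    (h : (g * ·) '' T.1 = T'.1) : pairMeasure μ ν T'.1 = pairMeasure μ ν T.1 := by
  have hp : μ.1.prod ν.1 = (μ.1.prod ν.1).map (Prod.map (g • ·) (g • ·)) := by
    rw [← Measure.map_prod_map _ _ (measurable_smul_F g) (measurable_smul_F g), μ.2.1, ν.2.1]
  rw [pairMeasure, hp, Measure.map_apply ((measurable_smul_F g).prodMap (measurable_smul_F g))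
    (measurableSet_pairs T'), pairMeasure]
  congr 1
  ext ⟨S, S'⟩
  change conv (g • S).1 ∩ conv (g • S').1 = T'.1 ↔ conv S.1 ∩ conv S'.1 = T.1
  have e : conv (g • S).1 ∩ conv (g • S').1 = (g * ·) '' (conv S.1 ∩ conv S'.1) := by
    ext k
    rw [Set.image_mul_left]
    simp only [Set.mem_inter_iff, mem_conv_smul, Set.mem_preimage]
  rw [e, ← h]
  exact (mul_right_injective g).image_injective.eq_iff

end SCurr

instance : Countable (BasedSubtree N) := by
  have : {T : Set (F N) | T.Finite}.Countable := Set.Countable.ofPred_finite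
  exact (this.mono fun T hT => (hT : IsFiniteSubtree T ∧ _).1.finite).to_subtype

/-- All powers of `g` would lie in the finite set `T`, but the free group is torsion-free. -/
theorem eq_one_of_image_eq {T : Set (F N)} (hf : T.Finite) (h1 : 1 ∈ T) {g : F N}
    (h : (g * ·) '' T = T) : g = 1 := by
  by_contra hg
  have hm : ∀ n : ℕ, g ^ n ∈ T := by
    intro n
    induction n with
    | zero => simpa using h1
    | succ n ih =>
      rw [← h, pow_succ']
      exact ⟨_, ih, rfl⟩
  have hi : Function.Injective fun n : ℕ => g ^ n := by
    have := not_isOfFinOrder_of_isMulTorsionFree hg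
    exact injective_pow_iff_not_isOfFinOrder.2 this
  exact Set.infinite_univ ((hf.preimage (f := fun n : ℕ => g ^ n) hi.injOn).subset fun n _ => hm n)

theorem isFiniteSubtree_image {T : Set (F N)} (h : IsFiniteSubtree T) (g : F N) :
    IsFiniteSubtree ((g * ·) '' T) := by
  refine ⟨h.finite.image _, ?_⟩
  let e : (cayley N).induce T ≃g (cayley N).induce ((g * ·) '' T) :=
    { toEquiv := Equiv.Set.image (g * ·) T (mul_right_injective g)
      map_rel_iff' := fun {a b} => by
        rw [SimpleGraph.comap_adj, SimpleGraph.comap_adj]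
        exact SimpleGraph.mulCayley_adj_mul_iff_right }
  exact e.connected_iff.1 h.connected

/-- The translate of `T` taking the vertex `g` to the identity. -/
def BasedSubtree.rebase (T : BasedSubtree N) (g : T.1) : BasedSubtree N :=
  ⟨(g.1⁻¹ * ·) '' T.1, isFiniteSubtree_image T.2.1 _, g.1, g.2, inv_mul_cancel _⟩

theorem BasedSubtree.mk_rebase (T : BasedSubtree N) (g : T.1) :
    Quotient.mk (subtreeSetoid N) (T.rebase g) = Quotient.mk _ T := by
  refine (Quotient.sound ?_).symm
  exact ⟨g.1⁻¹, rfl⟩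

/-- The based translates of a based subtree correspond to its vertices. -/
def translateEquiv (T : BasedSubtree N) :
    {T' : BasedSubtree N // (Quotient.mk (subtreeSetoid N) T') = Quotient.mk _ T} ≃ T.1 := by
  refine (Equiv.ofBijective (fun g : T.1 =>
    (⟨T.rebase g, T.mk_rebase g⟩ :
      {T' : BasedSubtree N // (Quotient.mk (subtreeSetoid N) T') = Quotient.mk _ T})) ⟨?_, ?_⟩).symm
  · intro g h e
    have e' : (g.1⁻¹ * ·) '' T.1 = (h.1⁻¹ * ·) '' T.1 := congrArg (fun T => T.1.1) e
    have : ((h.1 * g.1⁻¹) * ·) '' T.1 = T.1 := by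
      have e1 : ((h.1 * g.1⁻¹) * ·) '' T.1 = (h.1 * ·) '' ((g.1⁻¹ * ·) '' T.1) := by
        rw [Set.image_image]
        simp only [mul_assoc]
      rw [e1, e', Set.image_image]
      simp only [mul_inv_cancel_left, Set.image_id']
    have := eq_one_of_image_eq T.2.1.finite T.2.2 this
    exact Subtype.ext (mul_inv_eq_one.1 this).symm
  · rintro ⟨T', h⟩
    obtain ⟨g, hg⟩ := Quotient.exact h.symm
    have h1 : (1 : F N) ∈ (g * ·) '' T.1 := hg ▸ T'.2.2
    obtain ⟨k, hk, e⟩ := h1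
    refine ⟨⟨k, hk⟩, Subtype.ext (Subtype.ext ?_)⟩
    change (k⁻¹ * ·) '' T.1 = T'.1
    rw [← hg, ← eq_inv_of_mul_eq_one_left e]

theorem encard_eq_of_equiv {T T' : BasedSubtree N}
    (h : (Quotient.mk (subtreeSetoid N) T') = Quotient.mk _ T) :
    T'.1.encard = T.1.encard := by
  obtain ⟨g, hg⟩ := Quotient.exact h
  rw [← hg, (mul_right_injective g).encard_image]

theorem encard_ne_zero (T : BasedSubtree N) : (T.1.encard : ℝ≥0∞) ≠ 0 := by
  simpa using Set.Nonempty.ne_empty ⟨1, T.2.2⟩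

theorem encard_ne_top (T : BasedSubtree N) : (T.1.encard : ℝ≥0∞) ≠ ∞ := by
  simpa using T.2.1.finite

namespace SCurr

/-- The class of `T` contains exactly |T| trees through the identity, one for each vertex moved to
the identity, and they carry the same measure. Sharing the term equally among them removes the
choice of representatives and produces the weights 1/|T| on which continuity rests. -/
theorem cHat_eq_tsum (μ ν : SCurr N) :
    cHat μ ν = ∑' T : BasedSubtree N, (T.1.encard : ℝ≥0∞)⁻¹ * pairMeasure μ ν T.1 := by
  rw [← (Equiv.sigmaFiberEquiv (Quotient.mk (subtreeSetoid N))).tsum_eq, ENNReal.tsum_sigma', cHat]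
  refine tsum_congr fun C => ?_
  obtain ⟨T, rfl⟩ : ∃ T, C = Quotient.mk (subtreeSetoid N) T := ⟨C.out, by rw [Quotient.out_eq]⟩
  set T₀ := (Quotient.mk (subtreeSetoid N) T).out with hT₀
  have he : Quotient.mk (subtreeSetoid N) T = Quotient.mk _ T₀ := (Quotient.out_eq _).symm
  have hc : ∀ T' : {T' // Quotient.mk (subtreeSetoid N) T' = Quotient.mk (subtreeSetoid N) T},
      ((Equiv.sigmaFiberEquiv (Quotient.mk (subtreeSetoid N)) ⟨_, T'⟩).1.encard : ℝ≥0∞)⁻¹ *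
        pairMeasure μ ν (Equiv.sigmaFiberEquiv (Quotient.mk (subtreeSetoid N)) ⟨_, T'⟩).1 =
      (T₀.1.encard : ℝ≥0∞)⁻¹ * pairMeasure μ ν T₀.1 := by
    rintro ⟨T', hT'⟩
    rw [Equiv.sigmaFiberEquiv_apply]
    rw [he] at hT'
    obtain ⟨g, hg⟩ := Quotient.exact hT'.symm
    simp only
    rw [encard_eq_of_equiv hT', pairMeasure_image μ ν g T₀ T' hg]
  rw [tsum_congr hc, ENNReal.tsum_const]
  have hcard : (ENat.card {T' // Quotient.mk (subtreeSetoid N) T' =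
      Quotient.mk (subtreeSetoid N) T}) = T₀.1.encard := by
    rw [he, ENat.card_congr (translateEquiv T₀)]
    rfl
  rw [hcard, ← mul_assoc, ENNReal.mul_inv_cancel (encard_ne_zero _) (encard_ne_top _), one_mul]
  rfl

/-- The events for different `T` are disjoint, and each forces the identity into both hulls. -/
theorem tsum_pairMeasure_le (μ ν : SCurr N) :
    ∑' T : BasedSubtree N, pairMeasure μ ν T.1 ≤ μ.1 (hullAtOne N) * ν.1 (hullAtOne N) := by
  rw [← Measure.prod_prod]
  simp only [pairMeasure]
  rw [← measure_iUnion]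
  · refine measure_mono (Set.iUnion_subset fun T p hp => ?_)
    have h : (1 : F N) ∈ conv p.1.1 ∩ conv p.2.1 := by
      rw [show conv p.1.1 ∩ conv p.2.1 = T.1 from hp]
      exact T.2.2
    exact h
  · intro T T' h
    exact Set.disjoint_left.2 fun p hp hp' => h (Subtype.ext (Eq.trans (Eq.symm hp) hp'))
  · exact measurableSet_pairs

theorem one_le_encard (T : BasedSubtree N) : (T.1.encard : ℝ≥0∞)⁻¹ ≤ 1 := by
  rw [ENNReal.inv_le_one]
  exact_mod_cast Set.one_le_encard_iff_nonempty.2 ⟨1, T.2.2⟩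

theorem cHat_lt_top (μ ν : SCurr N) : cHat μ ν < ∞ := by
  rw [cHat_eq_tsum]
  refine lt_of_le_of_lt (ENNReal.tsum_le_tsum fun T => ?_) ((tsum_pairMeasure_le μ ν).trans_lt
    (ENNReal.mul_lt_top μ.lt_top ν.lt_top))
  exact mul_le_of_le_one_left' (one_le_encard T)

theorem eHat_lt_top (μ ν : SCurr N) : eHat μ ν < ∞ := by
  rw [eHat_eq]
  exact ENNReal.sum_lt_top.2 fun a _ => ENNReal.mul_lt_top
    ((measure_mono (hullAtEdge_subset a)).trans_lt μ.lt_top)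
    ((measure_mono (hullAtEdge_subset a)).trans_lt ν.lt_top)

theorem vHat_lt_top (μ ν : SCurr N) : vHat μ ν < ∞ := by
  rw [vHat_eq]
  exact ENNReal.mul_lt_top μ.lt_top ν.lt_top

theorem exists_pairMeasure_eq (T : BasedSubtree N) :
    ∃ r : ℕ, ∀ μ ν : SCurr N, pairMeasure μ ν T.1 = ∑ p ∈ typePairs r T.1,
      μ.1 (typeClass (r + 1) p.1) * ν.1 (typeClass (r + 1) p.2) := by
  obtain ⟨r, hr⟩ := exists_subset_ball T.2.1.finite
  exact ⟨r, fun μ ν => pairMeasure_eq μ ν T.2.2 hr⟩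

theorem pairMeasure_add (μ μ' ν : SCurr N) (T : BasedSubtree N) :
    pairMeasure (μ + μ') ν T.1 = pairMeasure μ ν T.1 + pairMeasure μ' ν T.1 := by
  obtain ⟨r, h⟩ := exists_pairMeasure_eq T
  simp only [h, ← Finset.sum_add_distrib, ← add_mul]
  rfl

theorem pairMeasure_smul (c : ℝ≥0) (μ ν : SCurr N) (T : BasedSubtree N) :
    pairMeasure (c • μ) ν T.1 = c * pairMeasure μ ν T.1 := by
  obtain ⟨r, h⟩ := exists_pairMeasure_eq T
  simp only [h, Finset.mul_sum, ← mul_assoc]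
  rfl

theorem typePairs_swap {r : ℕ} {T : Set (F N)} {p : Set (F N) × Set (F N)} :
    p.swap ∈ typePairs r T ↔ p ∈ typePairs r T := by
  simp only [mem_typePairs, Prod.fst_swap, Prod.snd_swap, Set.inter_comm]
  tauto

theorem pairMeasure_comm (μ ν : SCurr N) (T : BasedSubtree N) :
    pairMeasure μ ν T.1 = pairMeasure ν μ T.1 := by
  obtain ⟨r, h⟩ := exists_pairMeasure_eq T
  simp only [h]
  refine Finset.sum_equiv (Equiv.prodComm _ _) (fun p => typePairs_swap.symm) fun p _ => ?_
  rw [mul_comm]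
  rfl

theorem cHat_add (μ μ' ν : SCurr N) : cHat (μ + μ') ν = cHat μ ν + cHat μ' ν := by
  simp only [cHat_eq_tsum, pairMeasure_add, mul_add, ENNReal.tsum_add]

theorem cHat_smul (c : ℝ≥0) (μ ν : SCurr N) : cHat (c • μ) ν = c * cHat μ ν := by
  simp only [cHat_eq_tsum, pairMeasure_smul, mul_left_comm _ (c : ℝ≥0∞), ENNReal.tsum_mul_left]

theorem cHat_comm (μ ν : SCurr N) : cHat μ ν = cHat ν μ := by
  simp only [cHat_eq_tsum, pairMeasure_comm μ ν]

theorem eHat_add (μ μ' ν : SCurr N) : eHat (μ + μ') ν = eHat μ ν + eHat μ' ν := by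
  simp only [eHat_eq, ← Finset.sum_add_distrib, ← add_mul]
  rfl

theorem eHat_smul (c : ℝ≥0) (μ ν : SCurr N) : eHat (c • μ) ν = c * eHat μ ν := by
  simp only [eHat_eq, Finset.mul_sum, ← mul_assoc]
  rfl

theorem eHat_comm (μ ν : SCurr N) : eHat μ ν = eHat ν μ := by
  simp only [eHat_eq, mul_comm]

theorem vHat_add (μ μ' ν : SCurr N) : vHat (μ + μ') ν = vHat μ ν + vHat μ' ν := by
  simp only [vHat_eq, ← add_mul]
  rfl

theorem vHat_smul (c : ℝ≥0) (μ ν : SCurr N) : vHat (c • μ) ν = c * vHat μ ν := by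
  simp only [vHat_eq, ← mul_assoc]
  rfl

theorem vHat_comm (μ ν : SCurr N) : vHat μ ν = vHat ν μ := by
  simp only [vHat_eq, mul_comm]

theorem continuous_pairMeasure (T : BasedSubtree N) :
    Continuous fun p : SCurr N × SCurr N => (pairMeasure p.1 p.2 T.1).toReal := by
  obtain ⟨r, h⟩ := exists_pairMeasure_eq T
  have : (fun p : SCurr N × SCurr N => (pairMeasure p.1 p.2 T.1).toReal) = fun p =>
      ∑ q ∈ typePairs r T.1, (p.1.1 (typeClass (r + 1) q.1)).toReal *
        (p.2.1 (typeClass (r + 1) q.2)).toReal := by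
    funext p
    rw [h, ENNReal.toReal_sum fun q _ =>
      ENNReal.mul_ne_top (typeClass_ne_top _ _ _) (typeClass_ne_top _ _ _)]
    simp only [ENNReal.toReal_mul]
  rw [this]
  exact continuous_finsetSum _ fun q _ =>
    ((continuous_measure (isClopen_typeClass _ _) (isCompact_typeClass _ _)).comp continuous_fst).mul
    ((continuous_measure (isClopen_typeClass _ _) (isCompact_typeClass _ _)).comp continuous_snd)

theorem continuous_hullAtOne : Continuous fun μ : SCurr N => (μ.1 (hullAtOne N)).toReal :=
  continuous_measure isClopen_hullAtOne isCompact_hullAtOne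

theorem continuous_vHat : Continuous fun p : SCurr N × SCurr N => (vHat p.1 p.2).toReal := by
  simp only [vHat_eq, ENNReal.toReal_mul]
  exact (continuous_hullAtOne.comp continuous_fst).mul (continuous_hullAtOne.comp continuous_snd)

theorem continuous_eHat : Continuous fun p : SCurr N × SCurr N => (eHat p.1 p.2).toReal := by
  have hE : ∀ a, Continuous fun μ : SCurr N => (μ.1 (hullAtEdge a)).toReal := fun a =>
    continuous_measure (isClopen_hullAtEdge a)
      (isCompact_hullAtOne.of_isClosed_subset (isClopen_hullAtEdge a).1 (hullAtEdge_subset a))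
  have : (fun p : SCurr N × SCurr N => (eHat p.1 p.2).toReal) = fun p =>
      ∑ a, (p.1.1 (hullAtEdge a)).toReal * (p.2.1 (hullAtEdge a)).toReal := by
    funext p
    rw [eHat_eq, ENNReal.toReal_sum fun a _ => ENNReal.mul_ne_top
      ((measure_mono (hullAtEdge_subset a)).trans_lt p.1.lt_top).ne
      ((measure_mono (hullAtEdge_subset a)).trans_lt p.2.lt_top).ne]
    simp only [ENNReal.toReal_mul]
  rw [this]
  exact continuous_finsetSum _ fun a _ =>
    ((hE a).comp continuous_fst).mul ((hE a).comp continuous_snd)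

/-- The continuous function `h` is locally bounded, so the convergence is locally uniform. -/
theorem continuous_of_approx {X : Type*} [TopologicalSpace X] {f h : X → ℝ} {k : ℕ → X → ℝ}
    (hh : Continuous h) (hk : ∀ n, Continuous (k n))
    (hb : ∀ n x, |f x - k n x| ≤ h x / ((n : ℝ) + 1)) : Continuous f := by
  have : TendstoLocallyUniformly k f atTop := by
    rw [Metric.tendstoLocallyUniformly_iff]
    intro ε hε x
    refine ⟨{y | h y < h x + 1}, (isOpen_lt hh continuous_const).mem_nhds (by simp), ?_⟩
    obtain ⟨n₀, hn₀⟩ := exists_nat_gt ((h x + 1) / ε)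
    filter_upwards [eventually_ge_atTop n₀] with n hn y hy
    rw [Real.dist_eq]
    refine (hb n y).trans_lt ?_
    rw [div_lt_iff₀ (by positivity)]
    rw [div_lt_iff₀ hε] at hn₀
    have h1 : (n₀ : ℝ) ≤ n := by exact_mod_cast hn
    have h2 : h y < h x + 1 := hy
    nlinarith
  exact this.continuous (Frequently.of_forall hk)

theorem norm_le_of_mem_convex {T : Set (F N)} (h : IsConvex T) (h1 : 1 ∈ T)
    {g : F N} (hg : g ∈ T) : ((g.norm + 1 : ℕ) : ℕ∞) ≤ T.encard := by
  have hi : Set.InjOn (fun n => FreeGroup.mk (g.toWord.take n)) (Set.Iio (g.norm + 1)) := by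
    intro m hm n hn e
    have := congrArg FreeGroup.norm e
    simp only [norm_mk_take] at this
    simp only [Set.mem_Iio] at hm hn
    omega
  calc ((g.norm + 1 : ℕ) : ℕ∞) = (Set.Iio (g.norm + 1)).encard := by
        rw [← Finset.coe_Iio, Set.encard_coe_eq_coe_finsetCard]
        simp
    _ = _ := hi.encard_image.symm
    _ ≤ T.encard := Set.encard_le_encard (by rintro _ ⟨n, -, rfl⟩; exact h.take_mem h1 hg n)

theorem pairMeasure_eq_zero (μ ν : SCurr N) {T : Set (F N)} (h : ¬ IsConvex T) :
    pairMeasure μ ν T = 0 := by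
  have : pairsWithIntersection T = ∅ := by
    ext p
    simp only [Set.mem_empty_iff_false, iff_false]
    intro hp
    have hp' : conv p.1.1 ∩ conv p.2.1 = T := hp
    exact h (hp' ▸ (isConvex_conv _).inter (isConvex_conv _))
  rw [pairMeasure, this, measure_empty]

/-- The based subtrees of the ball of radius `n`. -/
def basedSubtreesIn (N n : ℕ) : Finset (BasedSubtree N) :=
  (show {T : BasedSubtree N | T.1 ⊆ ball N n}.Finite from
    ((finite_ball (N := N) n).finite_subsets).preimage Subtype.val_injective.injOn).toFinset

/-- The partial sums run over the trees inside the ball of radius `n`. A tree that leaves this ball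
has more than `n` vertices, hence weight at most 1/(n+1); as all pair measures add up to at most V̂,
the remainder is at most V̂/(n+1). -/
theorem continuous_cHat : Continuous fun p : SCurr N × SCurr N => (cHat p.1 p.2).toReal := by
  refine continuous_of_approx (h := fun p => (vHat p.1 p.2).toReal)
    (k := fun n p => ∑ T ∈ basedSubtreesIn N n,
      (T.1.encard : ℝ≥0∞)⁻¹.toReal * (pairMeasure p.1 p.2 T.1).toReal)
    continuous_vHat (fun n => continuous_finsetSum _ fun T _ =>
      continuous_const.mul (continuous_pairMeasure T)) ?_
  rintro n ⟨μ, ν⟩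
  have hsplit := ENNReal.sum_add_tsum_compl (basedSubtreesIn N n)
    (fun T => (T.1.encard : ℝ≥0∞)⁻¹ * pairMeasure μ ν T.1)
  rw [← cHat_eq_tsum] at hsplit
  have hfin := (cHat_lt_top μ ν).ne
  rw [← hsplit] at hfin
  obtain ⟨hf1, hf2⟩ := ENNReal.add_ne_top.1 hfin
  have hsum : (∑ T ∈ basedSubtreesIn N n, (T.1.encard : ℝ≥0∞)⁻¹ * pairMeasure μ ν T.1).toReal =
      ∑ T ∈ basedSubtreesIn N n, (T.1.encard : ℝ≥0∞)⁻¹.toReal * (pairMeasure μ ν T.1).toReal := by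
    rw [ENNReal.toReal_sum (ENNReal.sum_ne_top.1 hf1)]
    simp only [ENNReal.toReal_mul]
  simp only
  rw [← hsplit, ENNReal.toReal_add hf1 hf2, hsum, add_sub_cancel_left, abs_of_nonneg
    ENNReal.toReal_nonneg]
  have hle : ∑' T : {T // T ∉ basedSubtreesIn N n}, (T.1.1.encard : ℝ≥0∞)⁻¹ * pairMeasure μ ν T.1.1 ≤
      ((n + 1 : ℕ) : ℝ≥0∞)⁻¹ * vHat μ ν := by
    calc _ ≤ ∑' T : {T // T ∉ basedSubtreesIn N n},
          ((n + 1 : ℕ) : ℝ≥0∞)⁻¹ * pairMeasure μ ν T.1.1 := by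
          refine ENNReal.tsum_le_tsum fun T => ?_
          -- Intersections of hulls are convex, so sets that are not convex have pair measure zero
          -- and only convex ones need a bound on their weight.
          by_cases hc : IsConvex T.1.1
          · refine mul_le_mul_left (ENNReal.inv_le_inv.2 ?_) _
            have hT := T.2
            simp only [basedSubtreesIn, Set.Finite.mem_toFinset, Set.mem_ofPred_eq,
              Set.not_subset] at hT
            obtain ⟨g, hg, hn⟩ := hT
            have hn' : n < g.norm := not_le.1 hn
            have h1 := norm_le_of_mem_convex hc T.1.2.2 hg
            have h2 : ((n + 1 : ℕ) : ℕ∞) ≤ T.1.1.encard :=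
              le_trans (by exact_mod_cast (by omega)) h1
            exact_mod_cast ENat.toENNReal_le.2 h2
          · rw [pairMeasure_eq_zero μ ν hc]
            simp
      _ = ((n + 1 : ℕ) : ℝ≥0∞)⁻¹ * ∑' T : {T // T ∉ basedSubtreesIn N n}, pairMeasure μ ν T.1.1 :=
          ENNReal.tsum_mul_left
      _ ≤ _ := by
          refine mul_le_mul_right ?_ _
          rw [vHat_eq]
          exact (ENNReal.tsum_comp_le_tsum_of_injective Subtype.val_injective _).trans
            (tsum_pairMeasure_le μ ν)
  refine (ENNReal.toReal_mono (ENNReal.mul_ne_top (by simp) (vHat_lt_top μ ν).ne) hle).trans ?_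
  rw [ENNReal.toReal_mul, ENNReal.toReal_inv, div_eq_inv_mul, ENNReal.toReal_natCast, Nat.cast_succ]

end SCurr

/-! ### Limit sets and quasiconvexity of finitely generated subgroups -/

theorem ConvergesTo.eventually_norm_gt {u : ℕ → F N} {ξ : Boundary N} (h : ConvergesTo u ξ) (i : ℕ) :
    ∀ᶠ k in atTop, i < (u k).norm := by
  filter_upwards [h i] with k hk
  exact (List.getElem?_eq_some_iff.1 hk).1

theorem ConvergesTo.of_norm_le {u v : ℕ → F N} {ξ : Boundary N} (h : ConvergesTo u ξ) {L : ℕ}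
    (hL : ∀ k, ((u k)⁻¹ * v k).norm ≤ L) : ConvergesTo v ξ := by
  intro i
  filter_upwards [h i, h.eventually_norm_gt (i + L)] with k h1 h2
  rw [← h1]
  exact getElem?_of_norm_inv_mul_le (hL k) h2

theorem exists_convergesTo_of_prefix {u : ℕ → F N}
    (h : ∀ k, (u k).toWord <+: (u (k + 1)).toWord) (hn : ∀ k, k ≤ (u k).norm) :
    ∃ ξ, ConvergesTo u ξ := by
  have hp : ∀ {k l}, k ≤ l → (u k).toWord <+: (u l).toWord := by
    intro k l hkl
    induction l, hkl using Nat.le_induction with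
    | base => exact List.prefix_refl _
    | succ l _ ih => exact ih.trans (h l)
  have hlt : ∀ i, i < (u (i + 1)).toWord.length := fun i => hn (i + 1)
  have he : ∀ i k, i + 1 ≤ k → (u k).toWord[i]? = some ((u (i + 1)).toWord[i]'(hlt i)) := by
    intro i k hk
    rw [← List.getElem?_eq_getElem]
    exact List.prefix_iff_getElem?.1 (hp hk) i (hlt i) ▸ (List.getElem?_eq_getElem _).symm
  refine ⟨⟨fun i => (u (i + 1)).toWord[i]'(hlt i), fun n => ?_⟩, fun i => ?_⟩
  · have hr : FreeGroup.IsReduced (u (n + 2)).toWord := FreeGroup.isReduced_toWord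
    rw [FreeGroup.IsReduced, List.isChain_iff_getElem] at hr
    have := hr n (hlt (n + 1))
    obtain ⟨_, h1⟩ := List.getElem?_eq_some_iff.1 (he n (n + 2) (by omega))
    rw [h1] at this
    exact this
  · filter_upwards [eventually_ge_atTop (i + 1)] with k hk
    exact he i k hk

theorem mem_limitSet_iff {H : Subgroup (F N)} {ξ : Boundary N} :
    ξ ∈ limitSet H ↔ ∀ n, ∃ h ∈ H, ∀ i < n, h.toWord[i]? = some (ξ.1 i) := by
  constructor
  · rintro ⟨u, hu, hc⟩ n
    have : ∀ᶠ k in atTop, ∀ i ∈ Finset.range n, (u k).toWord[i]? = some (ξ.1 i) :=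
      (Filter.eventually_all_finset _).2 fun i _ => hc i
    obtain ⟨k, hk⟩ := this.exists
    exact ⟨u k, hu k, fun i hi => hk i (Finset.mem_range.2 hi)⟩
  · intro h
    choose u hu hc using h
    refine ⟨u, hu, fun i => ?_⟩
    filter_upwards [eventually_gt_atTop i] with k hk
    exact hc k i hk

theorem isClosed_limitSet (H : Subgroup (F N)) : IsClosed (limitSet H) := by
  refine isClosed_of_closure_subset fun ξ hξ => ?_
  rw [mem_limitSet_iff]
  intro n
  have hopen : IsOpen {ζ : Boundary N | ∀ i ∈ Finset.range n, ζ.1 i = ξ.1 i} := by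
    have e : {ζ : Boundary N | ∀ i ∈ Finset.range n, ζ.1 i = ξ.1 i} =
        ⋂ i ∈ Finset.range n, (fun ζ : Boundary N => ζ.1 i) ⁻¹' {ξ.1 i} := by
      ext ζ
      simp
    rw [e]
    exact isOpen_biInter_finset fun i _ => (isOpen_discrete _).preimage (continuous_letter i)
  obtain ⟨ζ, h1, h2⟩ := mem_closure_iff.1 hξ _ hopen (fun _ _ => rfl)
  obtain ⟨h, hh, hi⟩ := mem_limitSet_iff.1 h2 n
  exact ⟨h, hh, fun i hin => by rw [hi i hin, h1 i (Finset.mem_range.2 hin)]⟩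

theorem mem_conj {g h : F N} {H : Subgroup (F N)} : h ∈ conj g H ↔ g⁻¹ * h * g ∈ H := by
  simp only [conj, Subgroup.mem_map]
  constructor
  · rintro ⟨k, hk, rfl⟩
    simpa [mul_assoc] using hk
  · intro hk
    exact ⟨_, hk, by simp [mul_assoc]⟩

theorem conj_conj (g h : F N) (H : Subgroup (F N)) : conj g (conj h H) = conj (g * h) H := by
  ext k
  simp only [mem_conj, mul_inv_rev, mul_assoc]

theorem conj_one (H : Subgroup (F N)) : conj 1 H = H := by
  ext k
  simp [mem_conj]

theorem limitSet_mono {H K : Subgroup (F N)} (h : H ≤ K) : limitSet H ⊆ limitSet K :=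
  fun _ ⟨u, hu, hc⟩ => ⟨u, fun k => h (hu k), hc⟩

theorem limitSet_conj (g : F N) (H : Subgroup (F N)) :
    limitSet (conj g H) = (g • ·) '' limitSet H := by
  have key : ∀ (g : F N) (H : Subgroup (F N)), (g • ·) '' limitSet H ⊆ limitSet (conj g H) := by
    rintro g H _ ⟨ξ, ⟨u, hu, hc⟩, rfl⟩
    refine ⟨fun k => g * u k * g⁻¹, fun k => by simpa [mem_conj, mul_assoc] using hu k, ?_⟩
    exact (smul_boundary_spec hc).of_norm_le (L := g⁻¹.norm) fun k =>
      le_of_eq (congrArg FreeGroup.norm (by group))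
  refine Set.Subset.antisymm (fun ξ hξ => ?_) (key g H)
  have := key g⁻¹ (conj g H) ⟨ξ, hξ, rfl⟩
  rw [conj_conj, inv_mul_cancel, conj_one] at this
  exact ⟨_, this, smul_inv_smul g ξ⟩

theorem image_limitSet_of_mem {H : Subgroup (F N)} {g : F N} (hg : g ∈ H) :
    (g • ·) '' limitSet H = limitSet H := by
  rw [← limitSet_conj]
  congr 1
  ext k
  rw [mem_conj, H.mul_mem_cancel_right hg, H.mul_mem_cancel_left (H.inv_mem hg)]

/-- The powers of a cyclically reduced element converge to a boundary point with the same first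
letter. -/
theorem exists_mem_limitSet_head {H : Subgroup (F N)} {x : Letter N} {w : List (Letter N)}
    (hc : FreeGroup.IsCyclicallyReduced (x :: w)) (hm : FreeGroup.mk (x :: w) ∈ H) :
    ∃ ξ ∈ limitSet H, ξ.1 0 = x := by
  have hw : ∀ k : ℕ, (FreeGroup.mk (x :: w) ^ k).toWord = (List.replicate k (x :: w)).flatten := by
    intro k
    rw [FreeGroup.toWord_pow, toWord_mk_of_isReduced hc.isReduced]
    exact (hc.flatten_replicate k).isReduced.reduce_eq
  obtain ⟨ξ, hξ⟩ := exists_convergesTo_of_prefix (u := fun k => FreeGroup.mk (x :: w) ^ k)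
    (fun k => by
      rw [hw, hw, List.replicate_succ', List.flatten_concat]
      exact List.prefix_append _ _)
    (fun k => by
      rw [FreeGroup.norm, hw, List.length_flatten, List.map_replicate, List.sum_replicate,
        List.length_cons, smul_eq_mul]
      exact Nat.le_mul_of_pos_right k (Nat.succ_pos _))
  refine ⟨ξ, ⟨_, fun k => H.pow_mem hm k, hξ⟩, ?_⟩
  obtain ⟨k, h1, h2⟩ := ((hξ 0).and (eventually_ge_atTop 1)).exists
  obtain ⟨k, rfl⟩ := Nat.exists_eq_add_of_le' h2
  rw [hw, List.replicate_succ, List.flatten_cons] at h1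
  simpa using h1.symm

/-- After conjugation `H` contains a non-empty cyclically reduced word. Its positive and its
negative powers converge to boundary points with different first letters. -/
theorem limitSet_nontrivial {H : Subgroup (F N)} (hH : H ≠ ⊥) : (limitSet H).Nontrivial := by
  obtain ⟨⟨h, hh⟩, hne⟩ := Subgroup.ne_bot_iff_exists_ne_one.1 hH
  replace hne : h ≠ 1 := fun e => hne (Subtype.ext e)
  set k : F N := FreeGroup.mk (FreeGroup.reduceCyclically.conjugator h.toWord)
  set L := FreeGroup.reduceCyclically h.toWord with hL
  have hc : FreeGroup.IsCyclicallyReduced L :=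
    FreeGroup.reduceCyclically.isCyclicallyReduced FreeGroup.isReduced_toWord
  have e : h = k * FreeGroup.mk L * k⁻¹ := by
    have := congrArg FreeGroup.mk
      (FreeGroup.reduceCyclically.conj_conjugator_reduceCyclically h.toWord)
    rw [mk_append, mk_append, ← FreeGroup.inv_mk, FreeGroup.mk_toWord] at this
    exact this.symm
  suffices hs : (limitSet (conj k⁻¹ H)).Nontrivial by
    have := hs.image (MulAction.injective k)
    have e2 : (k • ·) '' limitSet (conj k⁻¹ H) = limitSet H := by
      rw [← limitSet_conj, conj_conj, mul_inv_cancel, conj_one]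
    rwa [← e2]
  have hm : FreeGroup.mk L ∈ conj k⁻¹ H := by
    rw [mem_conj, inv_inv, ← e]
    exact hh
  clear_value L
  rcases L with _ | ⟨x, w⟩
  · exact absurd (by simpa [← FreeGroup.one_eq_mk] using e) hne
  · obtain ⟨ξ, hξ, hx⟩ := exists_mem_limitSet_head hc hm
    obtain ⟨w', y, hy⟩ : ∃ w' y, x :: w = w' ++ [y] := by
      rcases List.eq_nil_or_concat (x :: w) with h | ⟨w', y, h⟩
      · simp at h
      · exact ⟨w', y, by simpa using h⟩
    have hinv : FreeGroup.invRev (x :: w) = linv y :: FreeGroup.invRev w' := by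
      rw [hy]
      simp [FreeGroup.invRev, linv]
    have hxy : x ≠ linv y := by
      rw [ne_linv_iff]
      exact hc.2 y (by simp [hy]) x rfl
    have hc' : FreeGroup.IsCyclicallyReduced (linv y :: FreeGroup.invRev w') := by
      refine ⟨?_, ?_⟩
      · rw [← hinv, FreeGroup.isReduced_iff_reduce_eq, FreeGroup.reduce_invRev,
          hc.isReduced.reduce_eq]
      · intro a ha b hb
        rw [← hinv] at ha hb
        have e1 : (FreeGroup.invRev (x :: w)).getLast? = some (linv x) := by
          simp [FreeGroup.invRev, linv]
        have e2 : (FreeGroup.invRev (x :: w)).head? = some (linv y) := by rw [hinv]; rfl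
        rw [e1] at ha
        rw [e2] at hb
        obtain rfl := Option.some.inj ha
        obtain rfl := Option.some.inj hb
        refine ne_linv_iff.1 ?_
        rw [linv_linv]
        exact hxy.symm
    obtain ⟨ζ, hζ, hz⟩ := exists_mem_limitSet_head (H := conj k⁻¹ H) hc' (by
      rw [← hinv, ← FreeGroup.inv_mk]
      exact inv_mem hm)
    exact ⟨ξ, hξ, ζ, hζ, fun e => hxy (by rw [← hx, ← hz, e])⟩

/-- The vertices at distance at most `M` from `H`. -/
def nearby (H : Subgroup (F N)) (M : ℕ) : Set (F N) := {g | ∃ h ∈ H, (h⁻¹ * g).norm ≤ M}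

theorem mul_mem_nearby {H : Subgroup (F N)} {M : ℕ} {h g : F N} (hh : h ∈ H)
    (hg : g ∈ nearby H M) : h * g ∈ nearby H M := by
  obtain ⟨k, hk, hn⟩ := hg
  exact ⟨h * k, H.mul_mem hh hk, by simpa [mul_assoc] using hn⟩

/-- Right multiplication by a letter alters a reduced word only at its end. Hence the geodesic to `x
L` stays in the union of the geodesic to `x` and the path reading `L` from `x`, even if `L` is not
reduced. -/
theorem exists_take_mul_mk (x : F N) (L : List (Letter N)) (n : ℕ) :
    ∃ m, FreeGroup.mk ((x * FreeGroup.mk L).toWord.take n) = FreeGroup.mk (x.toWord.take m) ∨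
      FreeGroup.mk ((x * FreeGroup.mk L).toWord.take n) = x * FreeGroup.mk (L.take m) := by
  induction L using List.reverseRecOn generalizing n with
  | nil => exact ⟨n, Or.inl (by rw [← FreeGroup.one_eq_mk, mul_one])⟩
  | append_singleton L z ih =>
    have ih' : ∀ n, ∃ m, FreeGroup.mk ((x * FreeGroup.mk L).toWord.take n) =
          FreeGroup.mk (x.toWord.take m) ∨
        FreeGroup.mk ((x * FreeGroup.mk L).toWord.take n) =
          x * FreeGroup.mk ((L ++ [z]).take m) := by
      intro n
      obtain ⟨m, h | h⟩ := ih n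
      · exact ⟨m, Or.inl h⟩
      · refine ⟨min m L.length, Or.inr ?_⟩
        rw [h, List.take_append_of_le_length (min_le_right _ _), List.take_eq_take_min]
    have e : x * FreeGroup.mk (L ++ [z]) = x * FreeGroup.mk L * FreeGroup.mk [z] := by
      rw [mk_append, mul_assoc]
    rcases toWord_mul_letter (x * FreeGroup.mk L) z with h | h
    · by_cases hn : n ≤ (x * FreeGroup.mk L).toWord.length
      · rw [e, h, List.take_append_of_le_length hn]
        exact ih' n
      · refine ⟨(L ++ [z]).length, Or.inr ?_⟩
        rw [List.take_length, List.take_of_length_le, FreeGroup.mk_toWord]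
        rw [e, h, List.length_append, List.length_singleton]
        omega
    · rw [e, h, List.dropLast_eq_take, List.take_take]
      exact ih' _

/-- Quasiconvexity: multiplying by one more generator adds to the geodesic only vertices that are no
farther from an element of `H` than the longest generator is from the identity. -/
theorem exists_take_mem_nearby {H : Subgroup (F N)} (hH : H.FG) :
    ∃ M, ∀ h ∈ H, ∀ n, FreeGroup.mk (h.toWord.take n) ∈ nearby H M := by
  obtain ⟨s, rfl⟩ := hH
  refine ⟨s.sup FreeGroup.norm, fun h hh => ?_⟩
  have step : ∀ x ∈ Subgroup.closure (s : Set (F N)), ∀ y : F N, y.norm ≤ s.sup FreeGroup.norm →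
      (∀ n, FreeGroup.mk (x.toWord.take n) ∈ nearby (Subgroup.closure (s : Set (F N)))
        (s.sup FreeGroup.norm)) →
      ∀ n, FreeGroup.mk ((x * y).toWord.take n) ∈ nearby (Subgroup.closure (s : Set (F N)))
        (s.sup FreeGroup.norm) := by
    intro x hx y hy ih n
    obtain ⟨m, h | h⟩ := exists_take_mul_mk x y.toWord n
    · rw [FreeGroup.mk_toWord] at h
      rw [h]
      exact ih m
    · rw [FreeGroup.mk_toWord] at h
      rw [h]
      refine ⟨x, hx, ?_⟩
      rw [inv_mul_cancel_left, norm_mk_take]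
      exact (min_le_right _ _).trans hy
  induction hh using Subgroup.closure_induction_right with
  | one => exact fun n => ⟨1, one_mem _, by simp [← FreeGroup.one_eq_mk]⟩
  | mul_right x hx y hy ih => exact step x hx y (Finset.le_sup (f := FreeGroup.norm) hy) ih
  | mul_inv_cancel x hx y hy ih =>
    refine step x hx y⁻¹ ?_ ih
    rw [FreeGroup.norm_inv_eq]
    exact Finset.le_sup (f := FreeGroup.norm) hy

/-- Let `g` lie on the geodesic from `ξ` to `ζ`, approximated by `u` and `v` in `H`. For suitable
indices the words from `g` to `u k` and to `v l` start with different letters, so `g` lies on the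
geodesic from `u k` to `v l`; translation by the inverse of `u k` leads back to quasiconvexity. -/
theorem conv_limitSet_subset_nearby {H : Subgroup (F N)} {M : ℕ}
    (hM : ∀ h ∈ H, ∀ n, FreeGroup.mk (h.toWord.take n) ∈ nearby H M) :
    conv (limitSet H) ⊆ nearby H M := by
  rintro g ⟨ξ, ⟨u, hu, hcu⟩, ζ, ⟨v, hv, hcv⟩, hne⟩
  obtain ⟨k, h1⟩ := (smul_boundary_spec (g := g⁻¹) hcu 0).exists
  obtain ⟨l, h2⟩ := (smul_boundary_spec (g := g⁻¹) hcv 0).exists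
  generalize (g⁻¹ • ξ).1 0 = x at h1 hne
  generalize (g⁻¹ • ζ).1 0 = y at h2 hne
  have r1 : FreeGroup.IsReduced (FreeGroup.invRev (g⁻¹ * u k).toWord) := by
    rw [← FreeGroup.toWord_inv]; exact FreeGroup.isReduced_toWord
  have r2 : FreeGroup.IsReduced (g⁻¹ * v l).toWord := FreeGroup.isReduced_toWord
  have hred : FreeGroup.IsReduced (FreeGroup.invRev (g⁻¹ * u k).toWord ++ (g⁻¹ * v l).toWord) := by
    rw [FreeGroup.IsReduced, List.isChain_append]
    refine ⟨r1, r2, fun a ha b hb => ?_⟩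
    rw [List.head?_eq_getElem?, h2] at hb
    obtain rfl := Option.some.inj hb
    have e : (FreeGroup.invRev (g⁻¹ * u k).toWord).getLast? = some (linv x) := by
      rw [FreeGroup.invRev, List.getLast?_reverse, List.head?_map, List.head?_eq_getElem?, h1]
      rfl
    rw [e] at ha
    obtain rfl := Option.some.inj ha
    refine ne_linv_iff.1 ?_
    rw [linv_linv]
    exact hne.symm
  have e : (u k)⁻¹ * v l =
      FreeGroup.mk (FreeGroup.invRev (g⁻¹ * u k).toWord ++ (g⁻¹ * v l).toWord) := by
    rw [mk_append, ← FreeGroup.inv_mk, FreeGroup.mk_toWord, FreeGroup.mk_toWord]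
    group
  have h3 := hM _ (H.mul_mem (H.inv_mem (hu k)) (hv l)) (FreeGroup.invRev (g⁻¹ * u k).toWord).length
  rw [e, toWord_mk_of_isReduced hred, List.take_left, ← FreeGroup.inv_mk, FreeGroup.mk_toWord,
    mul_inv_rev, inv_inv] at h3
  have h4 := mul_mem_nearby (hu k) h3
  rwa [mul_inv_cancel_left] at h4

/-- Such a coset has a representative y b⁻¹ with `b` in the ball of radius `M`. -/
theorem finite_cosets_nearby (H : Subgroup (F N)) (M : ℕ) (y : F N) :
    {q : F N ⧸ H | ∃ g : F N, q = g ∧ g⁻¹ * y ∈ nearby H M}.Finite := by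
  refine ((finite_norm_le (N := N) M).image fun b => ((y * b⁻¹ : F N) : F N ⧸ H)).subset ?_
  rintro _ ⟨g, rfl, h, hh, hn⟩
  refine ⟨_, hn, ?_⟩
  rw [QuotientGroup.eq]
  have e : (y * (h⁻¹ * (g⁻¹ * y))⁻¹)⁻¹ * g = h⁻¹ := by group
  rw [e]
  exact inv_mem hh

/-- Local finiteness: only finitely many cosets give a translate of the hull that passes through a
given vertex. The finiteness of η_H on compact sets and of the commensurator index both come from
here. -/
theorem finite_cosets_conv {H : Subgroup (F N)} (hH : H.FG) (y : F N) :
    {q : F N ⧸ H | ∃ g : F N, q = g ∧ g⁻¹ * y ∈ conv (limitSet H)}.Finite := by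
  obtain ⟨M, hM⟩ := exists_take_mem_nearby hH
  refine (finite_cosets_nearby H M y).subset ?_
  rintro _ ⟨g, rfl, hg⟩
  exact ⟨g, rfl, conv_limitSet_subset_nearby hM hg⟩

/-! ### Commensurators and counting currents -/

/-- A sequence in `H` is corrected into `K` by right factors from finitely many coset
representatives; a bounded change does not affect the limit. -/
theorem limitSet_eq_of_relIndex_ne_zero {H K : Subgroup (F N)} (h : K ≤ H)
    (hi : K.relIndex H ≠ 0) : limitSet K = limitSet H := by
  refine Set.Subset.antisymm (limitSet_mono h) ?_
  rintro ξ ⟨u, hu, hc⟩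
  have : Finite (H ⧸ K.subgroupOf H) := Nat.finite_of_card_ne_zero hi
  let r : H → H := fun x => (Quotient.out (x : H ⧸ K.subgroupOf H))
  have hr : Set.Finite (Set.range r) := by
    have : Set.range r ⊆ Set.range (Quotient.out : H ⧸ K.subgroupOf H → H) := by
      rintro _ ⟨x, rfl⟩
      exact ⟨_, rfl⟩
    exact (Set.finite_range _).subset this
  obtain ⟨L, hL⟩ := (hr.image fun x : H => x.1.norm).bddAbove
  let s : ℕ → H := fun k => r ⟨(u k)⁻¹, H.inv_mem (hu k)⟩
  refine ⟨fun k => u k * (s k).1, fun k => ?_, hc.of_norm_le (L := L) fun k => ?_⟩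
  · have h1 : ((s k : H) : H ⧸ K.subgroupOf H) = ((⟨(u k)⁻¹, H.inv_mem (hu k)⟩ : H) : H ⧸ _) :=
      Quotient.out_eq' _
    rw [eq_comm, QuotientGroup.eq, Subgroup.mem_subgroupOf] at h1
    simpa using h1
  · rw [inv_mul_cancel_left]
    exact hL ⟨_, ⟨_, rfl⟩, rfl⟩

/-- The stabilizer of the limit set. -/
def limitStabilizer (H : Subgroup (F N)) : Subgroup (F N) where
  carrier := {g | (g • ·) '' limitSet H = limitSet H}
  one_mem' := by simp
  mul_mem' {g h} hg hh := by
    simp only [Set.mem_ofPred_eq] at *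
    simp only [mul_smul]
    rw [← Set.image_image (g • ·) (h • ·), hh, hg]
  inv_mem' {g} hg := by
    simp only [Set.mem_ofPred_eq] at *
    conv_lhs => rw [← hg, Set.image_image]
    simp

theorem mem_limitStabilizer {H : Subgroup (F N)} {g : F N} :
    g ∈ limitStabilizer H ↔ (g • ·) '' limitSet H = limitSet H := Iff.rfl

theorem le_limitStabilizer (H : Subgroup (F N)) : H ≤ limitStabilizer H :=
  fun _ hg => image_limitSet_of_mem hg

/-- Elements of the stabilizer preserve the hull, so all their cosets give translates through one
fixed hull vertex `y`; there are finitely many of these. -/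
theorem relIndex_limitStabilizer_ne_zero {H : Subgroup (F N)} (hH : H.FG) (h : H ≠ ⊥) :
    H.relIndex (limitStabilizer H) ≠ 0 := by
  obtain ⟨y, hy⟩ := exists_mem_conv (limitSet_nontrivial h)
  have hf := (finite_cosets_conv hH y).to_subtype
  have hmem : ∀ g : limitStabilizer H, (g.1 : F N ⧸ H) ∈
      {q : F N ⧸ H | ∃ g : F N, q = g ∧ g⁻¹ * y ∈ conv (limitSet H)} := by
    intro g
    refine ⟨g.1, rfl, ?_⟩
    rw [← mem_conv_image, mem_limitStabilizer.1 g.2]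
    exact hy
  let f : limitStabilizer H ⧸ H.subgroupOf (limitStabilizer H) →
      {q : F N ⧸ H | ∃ g : F N, q = g ∧ g⁻¹ * y ∈ conv (limitSet H)} :=
    Quotient.lift (fun g => ⟨(g.1 : F N ⧸ H), hmem g⟩) fun a b hab => by
      have := QuotientGroup.leftRel_apply.1 hab
      exact Subtype.ext (QuotientGroup.eq.2 (Subgroup.mem_subgroupOf.1 this))
  have hinj : Function.Injective f := by
    intro a b
    induction a using QuotientGroup.induction_on
    induction b using QuotientGroup.induction_on
    intro h
    have := QuotientGroup.eq.1 (congrArg Subtype.val h)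
    exact QuotientGroup.eq.2 (Subgroup.mem_subgroupOf.2 this)
  have := Finite.of_injective f hinj
  exact Nat.card_pos.ne'

theorem toConjAct_smul (g : F N) (H : Subgroup (F N)) :
    (letI := Subgroup.pointwiseMulAction (α := ConjAct (F N)) (G := F N)
     ConjAct.toConjAct g • H) = conj g H := by
  ext k
  rw [mem_conj, Subgroup.mem_pointwise_smul_iff_inv_smul_mem, ← map_inv, ConjAct.toConjAct_smul,
    inv_inv]

theorem conj_limitStabilizer {H : Subgroup (F N)} {g : F N} (hg : g ∈ limitStabilizer H) :
    conj g (limitStabilizer H) = limitStabilizer H := by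
  ext k
  rw [mem_conj, Subgroup.mul_mem_cancel_right _ hg,
    Subgroup.mul_mem_cancel_left _ (inv_mem hg)]

theorem conj_le_conj {H K : Subgroup (F N)} (g : F N) (h : H ≤ K) : conj g H ≤ conj g K :=
  Subgroup.map_mono h

theorem relIndex_conj (g : F N) (H K : Subgroup (F N)) :
    (conj g H).relIndex (conj g K) = H.relIndex K :=
  Subgroup.relIndex_map_map_of_injective _ _ (MulAut.conj g).injective

/-- Subgroups of finite index have the same limit set, so commensurating elements fix Λ(H).
Conversely, for `g` in the stabilizer both `H` and gHg⁻¹ have finite index in the stabilizer, hence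
are commensurable. -/
theorem commensurator_eq {H : Subgroup (F N)} (hH : H.FG) (h : H ≠ ⊥) :
    Subgroup.Commensurable.commensurator H = limitStabilizer H := by
  ext g
  rw [Subgroup.Commensurable.commensurator_mem_iff]
  rw [toConjAct_smul]
  constructor
  · rintro ⟨h1, h2⟩
    rw [mem_limitStabilizer, ← limitSet_conj]
    have e1 := limitSet_eq_of_relIndex_ne_zero (H := H) (K := conj g H ⊓ H) inf_le_right
      (by rwa [Subgroup.inf_relIndex_right])
    have e2 := limitSet_eq_of_relIndex_ne_zero (H := conj g H) (K := conj g H ⊓ H) inf_le_left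
      (by rwa [Subgroup.inf_relIndex_left])
    rw [← e1, ← e2]
  · intro hg
    have h0 := relIndex_limitStabilizer_ne_zero hH h
    have h1 : (conj g H).relIndex (limitStabilizer H) ≠ 0 := by
      rw [← conj_limitStabilizer hg, relIndex_conj]
      exact h0
    have hle : conj g H ≤ limitStabilizer H := by
      rw [← conj_limitStabilizer hg]
      exact conj_le_conj g (le_limitStabilizer H)
    constructor
    · exact fun h' => h1 (Nat.eq_zero_of_zero_dvd (by
        have := Subgroup.relIndex_mul_relIndex (conj g H ⊓ H) H (limitStabilizer H) inf_le_right
          (le_limitStabilizer H)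
        rw [Subgroup.inf_relIndex_right, h', zero_mul] at this
        exact absurd this.symm (Subgroup.relIndex_inf_ne_zero h1 h0)))
    · exact fun h' => h0 (Nat.eq_zero_of_zero_dvd (by
        have := Subgroup.relIndex_mul_relIndex (H ⊓ conj g H) (conj g H) (limitStabilizer H)
          inf_le_right hle
        rw [Subgroup.inf_relIndex_right, h', zero_mul] at this
        exact absurd this.symm (Subgroup.relIndex_inf_ne_zero h0 h1)))

/-- The limit set of a non-trivial subgroup as a point of `𝒞_N`. -/
def limitPoint (H : Subgroup (F N)) (h : H ≠ ⊥) : ClosedSubsets N :=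
  ⟨limitSet H, isClosed_limitSet H, limitSet_nontrivial h⟩

/-- The translate `gΛ(H)` as a function of the coset `gH`. -/
def cosetLimit (H : Subgroup (F N)) (h : H ≠ ⊥) : F N ⧸ H → ClosedSubsets N :=
  Quotient.lift (fun g : F N => g • limitPoint H h) fun a b hab => by
    have := QuotientGroup.leftRel_apply.1 hab
    have e : (a⁻¹ * b) • limitPoint H h = limitPoint H h :=
      Subtype.ext (image_limitSet_of_mem this)
    rw [mul_smul, inv_smul_eq_iff] at e
    exact e.symm

theorem cosetLimit_mk (H : Subgroup (F N)) (h : H ≠ ⊥) (g : F N) :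
    cosetLimit H h (g : F N ⧸ H) = g • limitPoint H h := rfl

theorem cosetLimit_smul (H : Subgroup (F N)) (h : H ≠ ⊥) (g : F N) (q : F N ⧸ H) :
    cosetLimit H h (g • q) = g • cosetLimit H h q := by
  induction q using QuotientGroup.induction_on with
  | H k => exact mul_smul g k (limitPoint H h)

theorem finite_cosetLimit {H : Subgroup (F N)} (hH : H.FG) (h : H ≠ ⊥) (y : F N) :
    {q : F N ⧸ H | y ∈ conv (cosetLimit H h q).1}.Finite := by
  refine (finite_cosets_conv hH y).subset fun q hq => ?_
  induction q using QuotientGroup.induction_on with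
  | H g => exact ⟨g, rfl, mem_conv_smul.1 hq⟩

theorem diracAt_conj_eq {H : Subgroup (F N)} (h : H ≠ ⊥) (g : F N) {K : Subgroup (F N)}
    (hK : limitSet K = limitSet H) :
    diracAt (limitSet (conj g K)) = Measure.dirac (cosetLimit H h (g : F N ⧸ H)) := by
  have e : limitSet (conj g K) = (cosetLimit H h (g : F N ⧸ H)).1 := by
    rw [limitSet_conj, hK]
    rfl
  rw [diracAt, e, dif_pos (cosetLimit H h (g : F N ⧸ H)).2]
  rfl

theorem conj_eq_self_of_mem {H : Subgroup (F N)} {g : F N} (hg : g ∈ H) : conj g H = H := by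
  ext k
  rw [mem_conj, Subgroup.mul_mem_cancel_right _ hg, Subgroup.mul_mem_cancel_left _ (inv_mem hg)]

/-- The map `gH ↦ g(Stab Λ(H))g⁻¹`. -/
def cosetConj (H : Subgroup (F N)) :
    F N ⧸ H → {H' : Subgroup (F N) // ∃ g, H' = conj g (limitStabilizer H)} :=
  Quotient.lift (fun g : F N => ⟨conj g (limitStabilizer H), g, rfl⟩) fun a b hab => by
    have := le_limitStabilizer H (QuotientGroup.leftRel_apply.1 hab)
    apply Subtype.ext
    change conj a _ = conj b _
    conv_lhs => rw [← conj_eq_self_of_mem this, conj_conj, mul_inv_cancel_left]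

theorem limitSet_limitStabilizer {H : Subgroup (F N)} (hH : H.FG) (h : H ≠ ⊥) :
    limitSet (limitStabilizer H) = limitSet H :=
  (limitSet_eq_of_relIndex_ne_zero (le_limitStabilizer H)
    (relIndex_limitStabilizer_ne_zero hH h)).symm

/-- A conjugate of the stabilizer determines its limit set and thereby the conjugating element
modulo the stabilizer. So the fibre over the conjugate by `g` consists of the cosets gkH with `k` in
the stabilizer. -/
theorem card_cosetConj_fiber {H : Subgroup (F N)} (hH : H.FG) (h : H ≠ ⊥)
    (K : {H' : Subgroup (F N) // ∃ g, H' = conj g (limitStabilizer H)}) :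
    ENat.card {q // cosetConj H q = K} = H.relIndex (limitStabilizer H) := by
  obtain ⟨_, g, rfl⟩ := K
  let f : limitStabilizer H ⧸ H.subgroupOf (limitStabilizer H) → F N ⧸ H :=
    Quotient.lift (fun k => ((g * k.1 : F N) : F N ⧸ H)) fun a b hab => by
      have := Subgroup.mem_subgroupOf.1 (QuotientGroup.leftRel_apply.1 hab)
      refine QuotientGroup.eq.2 ?_
      rw [mul_inv_rev, mul_assoc, inv_mul_cancel_left]
      exact this
  have hinj : Function.Injective f := by
    intro a b
    induction a using QuotientGroup.induction_on
    induction b using QuotientGroup.induction_on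
    intro h
    have h' := QuotientGroup.eq.1 h
    rw [mul_inv_rev, mul_assoc, inv_mul_cancel_left] at h'
    exact QuotientGroup.eq.2 (Subgroup.mem_subgroupOf.2 h')
  have hrange : Set.range f =
      {q | cosetConj H q = ⟨conj g (limitStabilizer H), g, rfl⟩} := by
    ext q
    constructor
    · rintro ⟨a, rfl⟩
      induction a using QuotientGroup.induction_on with
      | H k =>
        apply Subtype.ext
        change conj (g * k.1) _ = conj g _
        rw [← conj_conj, conj_eq_self_of_mem k.2]
    · intro hq
      induction q using QuotientGroup.induction_on with
      | H k =>
        have h1 : conj k (limitStabilizer H) = conj g (limitStabilizer H) := congrArg Subtype.val hq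
        have h2 := congrArg limitSet h1
        rw [limitSet_conj, limitSet_conj, limitSet_limitStabilizer hH h] at h2
        have h3 : g⁻¹ * k ∈ limitStabilizer H := by
          rw [mem_limitStabilizer]
          simp only [mul_smul]
          rw [← Set.image_image (g⁻¹ • ·) (k • ·), h2, Set.image_image]
          simp
        refine ⟨((⟨_, h3⟩ : limitStabilizer H) : _ ⧸ H.subgroupOf (limitStabilizer H)), ?_⟩
        change ((g * (g⁻¹ * k) : F N) : F N ⧸ H) = _
        rw [mul_inv_cancel_left]
  have hfin : Finite (limitStabilizer H ⧸ H.subgroupOf (limitStabilizer H)) :=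
    Nat.finite_of_card_ne_zero (relIndex_limitStabilizer_ne_zero hH h)
  change ENat.card {q | cosetConj H q = ⟨conj g (limitStabilizer H), g, rfl⟩} = _
  rw [← hrange, ENat.card_congr (Equiv.ofInjective f hinj).symm, ENat.card_eq_coe_natCard]
  rfl

/-- Grouping the cosets by the conjugate of the commensurator that they define, each group has [Ĥ :
H] members with the same limit set. This absorbs the index into a sum over cosets, the form used in
all computations. -/
theorem countingMeasure_eq_sum {H : Subgroup (F N)} (hH : H.FG) (h : H ≠ ⊥) :
    countingMeasure H = Measure.sum fun q : F N ⧸ H => Measure.dirac (cosetLimit H h q) := by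
  rw [countingMeasure, if_neg h, commensurator_eq hH h]
  ext A hA
  rw [Measure.smul_apply, conjClassMeasure, Measure.sum_apply _ hA, Measure.sum_apply _ hA,
    ← (Equiv.sigmaFiberEquiv (cosetConj H)).tsum_eq, ENNReal.tsum_sigma', smul_eq_mul,
    ← ENNReal.tsum_mul_left]
  refine tsum_congr fun K => ?_
  have hc : ∀ q : {q // cosetConj H q = K},
      Measure.dirac (cosetLimit H h (Equiv.sigmaFiberEquiv (cosetConj H) ⟨K, q⟩)) A =
        diracAt (limitSet K.1) A := by
    rintro ⟨q, rfl⟩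
    rw [Equiv.sigmaFiberEquiv_apply]
    induction q using QuotientGroup.induction_on with
    | H g =>
      change _ = diracAt (limitSet (conj g (limitStabilizer H))) A
      rw [diracAt_conj_eq h g (limitSet_limitStabilizer hH h)]
  rw [tsum_congr hc, ENNReal.tsum_const, card_cosetConj_fiber hH h]
  rfl

theorem countingMeasure_bot : countingMeasure (⊥ : Subgroup (F N)) = 0 := by
  rw [countingMeasure, if_pos rfl]

theorem countingMeasure_apply {H : Subgroup (F N)} (hH : H.FG) (h : H ≠ ⊥)
    {A : Set (ClosedSubsets N)} (hA : MeasurableSet A) :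
    countingMeasure H A = {q : F N ⧸ H | cosetLimit H h q ∈ A}.encard := by
  rw [countingMeasure_eq_sum hH h, Measure.sum_apply _ hA]
  have : ∀ q : F N ⧸ H, Measure.dirac (cosetLimit H h q) A =
      {q : F N ⧸ H | cosetLimit H h q ∈ A}.indicator 1 q := by
    intro q
    rw [Measure.dirac_apply' _ hA]
    rfl
  rw [tsum_congr this, ← tsum_subtype, ← ENNReal.tsum_set_one]
  rfl

theorem countingMeasure_mem {H : Subgroup (F N)} (hH : H.FG) :
    countingMeasure H ∈ subsetCurrents N := by
  by_cases h : H = ⊥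
  · rw [h, countingMeasure_bot]
    exact zero_mem _
  refine mem_subsetCurrents_of_hullAtOne (fun g => ?_) ?_
  · ext A hA
    rw [Measure.map_apply (measurable_smul_F g) hA, countingMeasure_apply hH h hA,
      countingMeasure_apply hH h (measurable_smul_F g hA)]
    congr 1
    have : {q : F N ⧸ H | cosetLimit H h q ∈ A} =
        (g • ·) '' {q | cosetLimit H h q ∈ (fun S => g • S) ⁻¹' A} := by
      ext q
      constructor
      · intro hq
        refine ⟨g⁻¹ • q, ?_, smul_inv_smul g q⟩
        change g • cosetLimit H h (g⁻¹ • q) ∈ A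
        rw [← cosetLimit_smul, smul_inv_smul]
        exact hq
      · rintro ⟨q, hq, rfl⟩
        change cosetLimit H h (g • q) ∈ A
        rw [cosetLimit_smul]
        exact hq
    rw [this, (MulAction.injective g).encard_image]
  · rw [countingMeasure_apply hH h isClopen_hullAtOne.1.measurableSet]
    have : {q : F N ⧸ H | cosetLimit H h q ∈ hullAtOne N}.Finite := finite_cosetLimit hH h 1
    simpa [lt_top_iff_ne_top] using this

/-- The counting subset current of a finitely generated subgroup. -/
def countingCurrent (H : Subgroup (F N)) (hH : H.FG) : SCurr N :=
  ⟨countingMeasure H, countingMeasure_mem hH⟩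

/-! ### Integration along the tree and the Euler characteristic of a component -/

/-- The translation of `F × ℚ` along an edge, with the increment `b`. -/
def incrementPerm (b : Fin N → F N → ℚ) (a : Fin N) : Equiv.Perm (F N × ℚ) where
  toFun p := (p.1 * FreeGroup.of a, p.2 + b a p.1)
  invFun p := (p.1 * (FreeGroup.of a)⁻¹, p.2 - b a (p.1 * (FreeGroup.of a)⁻¹))
  left_inv p := by simp
  right_inv p := by simp

/-- The holonomy of the increments `b`. -/
def holonomy (b : Fin N → F N → ℚ) : F N →* Equiv.Perm (F N × ℚ) :=
  -- Walking along a product means walking along the left factor first, which is an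
  -- anti-homomorphism into permutations; inverses turn it into a homomorphism, and `integ` inverts
  -- back.
  FreeGroup.lift fun a => (incrementPerm b a)⁻¹

/-- The function with increments `b` along the edges of `X`, vanishing at the identity. -/
def integ (b : Fin N → F N → ℚ) (g : F N) : ℚ := ((holonomy b g)⁻¹ (1, 0)).2

theorem holonomy_of (b : Fin N → F N → ℚ) (a : Fin N) :
    (holonomy b (FreeGroup.of a))⁻¹ = incrementPerm b a := by
  rw [holonomy, FreeGroup.lift_apply_of, inv_inv]

theorem holonomy_fst (b : Fin N → F N → ℚ) (g : F N) (p : F N × ℚ) :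
    ((holonomy b g)⁻¹ p).1 = p.1 * g := by
  induction g using FreeGroup.induction_on generalizing p with
  | C1 => simp
  | of a => rw [holonomy_of]; rfl
  | inv_of a _ =>
    rw [map_inv, holonomy_of]
    rfl
  | mul x y hx hy =>
    rw [map_mul, mul_inv_rev, Equiv.Perm.mul_apply, hy, hx, mul_assoc]

theorem integ_one (b : Fin N → F N → ℚ) : integ b 1 = 0 := by simp [integ]

theorem integ_mul_of (b : Fin N → F N → ℚ) (g : F N) (a : Fin N) :
    integ b (g * FreeGroup.of a) = integ b g + b a g := by
  rw [integ, map_mul, mul_inv_rev, Equiv.Perm.mul_apply, holonomy_of]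
  change _ + b a ((holonomy b g)⁻¹ (1, 0)).1 = _
  rw [holonomy_fst, one_mul]
  rfl

/-- A function on the vertices of a subtree without increments along its edges is constant. -/
theorem IsConvex.const {α : Type*} {T : Set (F N)} (hT : IsConvex T) (h1 : 1 ∈ T) {f : F N → α}
    (hf : ∀ g ∈ T, ∀ a, g * FreeGroup.of a ∈ T → f (g * FreeGroup.of a) = f g) {g : F N}
    (hg : g ∈ T) : f g = f 1 := by
  have step : ∀ g ∈ T, ∀ x : Letter N, g * lt x ∈ T → f (g * lt x) = f g := by
    rintro g hg ⟨a, b⟩ hx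
    cases b
    · have e : g * lt (a, false) * FreeGroup.of a = g := by
        change g * lt (linv (a, true)) * lt (a, true) = g
        rw [lt_linv, inv_mul_cancel_right]
      have := hf _ hx a (by rwa [e])
      rw [e] at this
      exact this.symm
    · exact hf g hg a hx
  have key : ∀ w : List (Letter N), FreeGroup.IsReduced w → ∀ k ∈ T, k * FreeGroup.mk w ∈ T →
      f (k * FreeGroup.mk w) = f k := by
    intro w
    induction w with
    | nil => intro _ k _ _; rw [← FreeGroup.one_eq_mk, mul_one]
    | cons x w ih =>
      intro hw k hk hm
      have h2 := hT k hk x w hw hm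
      rw [mk_cons, ← mul_assoc] at hm ⊢
      rw [ih (hw.infix ⟨[x], [], by simp⟩) _ h2 hm, step k hk x h2]
  have := key g.toWord FreeGroup.isReduced_toWord 1 h1 (by rwa [FreeGroup.mk_toWord, one_mul])
  rwa [FreeGroup.mk_toWord, one_mul] at this

theorem isConvex_univ : IsConvex (Set.univ : Set (F N)) := fun _ _ _ _ _ _ => trivial

theorem eq_integ {b : Fin N → F N → ℚ} {f : F N → ℚ} (h1 : f 1 = 0)
    (h : ∀ g a, f (g * FreeGroup.of a) = f g + b a g) : f = integ b := by
  funext g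
  have := isConvex_univ.const (f := fun g => f g - integ b g) trivial
    (fun g _ a _ => by rw [h, integ_mul_of]; ring) (Set.mem_univ g)
  simp only [h1, integ_one, sub_self] at this
  linarith

/-- `integ` as a linear map. -/
def integLinear (N : ℕ) : (Fin N → F N → ℚ) →ₗ[ℚ] (F N → ℚ) where
  toFun b := integ b
  map_add' b b' := (eq_integ (by simp [integ_one]) fun g a => by
    simp only [Pi.add_apply, integ_mul_of]; ring).symm
  map_smul' c b := (eq_integ (by simp [integ_one]) fun g a => by
    simp only [Pi.smul_apply, smul_eq_mul, integ_mul_of, RingHom.id_apply]; ring).symm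

/-- Used to see that a stabilizer has finite rank: the functions on its free basis form a quotient
of the finite-dimensional space of edge functions. -/
theorem finite_of_finite_pi {ι : Type*} [Module.Finite ℚ (ι → ℚ)] : Finite ι := by
  by_contra h
  have : Infinite ι := not_finite_iff_infinite.1 h
  set n := Module.finrank ℚ (ι → ℚ)
  let e : Fin (n + 1) ↪ ι := (Fin.valEmbedding).trans (Infinite.natEmbedding ι)
  have hs : Function.Surjective (LinearMap.funLeft ℚ ℚ e) :=
    LinearMap.funLeft_surjective_of_injective ℚ ℚ e e.injective
  have := LinearMap.finrank_le_finrank_of_surjective hs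
  rw [Module.finrank_fin_fun] at this
  omega

section Euler

variable {Ω : Type} [MulAction (F N) Ω] {T : Ω → Set (F N)}

/-- The vertices of the component of `ω₀`. -/
def orbitVertices (T : Ω → Set (F N)) (ω₀ : Ω) : Set Ω :=
  {ω | ω ∈ MulAction.orbit (F N) ω₀ ∧ 1 ∈ T ω}

/-- The edges of the component of `ω₀`. -/
def orbitEdges (T : Ω → Set (F N)) (ω₀ : Ω) : Set (Fin N × Ω) :=
  {p | p.2 ∈ MulAction.orbit (F N) ω₀ ∧ 1 ∈ T p.2 ∧ FreeGroup.of p.1 ∈ T p.2}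

/-- Extension of a function on a subset by zero. -/
def extZero {α : Type} (A : Set α) : (A → ℚ) →ₗ[ℚ] (α → ℚ) where
  toFun f x := by classical exact if h : x ∈ A then f ⟨x, h⟩ else 0
  map_add' f g := by
    funext x
    by_cases h : x ∈ A <;> simp [h]
  map_smul' c f := by
    funext x
    by_cases h : x ∈ A <;> simp [h]

theorem extZero_mem {α : Type} {A : Set α} (f : A → ℚ) {x : α} (h : x ∈ A) :
    extZero A f x = f ⟨x, h⟩ := by
  simp [extZero, h]

/-- The pull-back to `X` of an edge function of the component of `ω₀`. -/
def orbitIncr (T : Ω → Set (F N)) (ω₀ : Ω) :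
    (orbitEdges T ω₀ → ℚ) →ₗ[ℚ] (Fin N → F N → ℚ) where
  toFun c a g := extZero (orbitEdges T ω₀) c (a, g⁻¹ • ω₀)
  map_add' c c' := by rw [map_add]; rfl
  map_smul' q c := by rw [map_smul]; rfl

/-- The integral along `X` of an edge function of the component of `ω₀`. -/
def orbitInteg (T : Ω → Set (F N)) (ω₀ : Ω) (c : orbitEdges T ω₀ → ℚ) : F N → ℚ :=
  integ (orbitIncr T ω₀ c)

theorem orbitInteg_one (ω₀ : Ω) (c : orbitEdges T ω₀ → ℚ) : orbitInteg T ω₀ c 1 = 0 := integ_one _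

theorem orbitInteg_mul_of (ω₀ : Ω) (c : orbitEdges T ω₀ → ℚ) (g : F N) (a : Fin N) :
    orbitInteg T ω₀ c (g * FreeGroup.of a) =
      orbitInteg T ω₀ c g + extZero (orbitEdges T ω₀) c (a, g⁻¹ • ω₀) := integ_mul_of _ _ _

/-- The increments are invariant under the stabilizer, so the translated integral differs from the
original by a constant. Hence integrals restrict to homomorphisms on the stabilizer. -/
theorem orbitInteg_mul (ω₀ : Ω) (c : orbitEdges T ω₀ → ℚ) {h : F N}
    (hh : h ∈ MulAction.stabilizer (F N) ω₀) (g : F N) :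
    orbitInteg T ω₀ c (h * g) = orbitInteg T ω₀ c h + orbitInteg T ω₀ c g := by
  have e : (fun g => orbitInteg T ω₀ c (h * g) - orbitInteg T ω₀ c h) = orbitInteg T ω₀ c := by
    refine eq_integ (by rw [mul_one, sub_self]) fun g a => ?_
    have h' : (h * g)⁻¹ • ω₀ = g⁻¹ • ω₀ := by
      rw [mul_inv_rev, mul_smul, inv_smul_eq_iff.2 (MulAction.mem_stabilizer_iff.1 hh).symm]
    rw [← mul_assoc, orbitInteg_mul_of, h', add_sub_right_comm]
    rfl
  have : orbitInteg T ω₀ c (h * g) - orbitInteg T ω₀ c h = orbitInteg T ω₀ c g := congrFun e g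
  linarith

/-- The restriction of the integral to the stabilizer. -/
def orbitHom (ω₀ : Ω) (c : orbitEdges T ω₀ → ℚ) :
    MulAction.stabilizer (F N) ω₀ →* Multiplicative ℚ where
  toFun h := Multiplicative.ofAdd (orbitInteg T ω₀ c h)
  map_one' := by rw [Subgroup.coe_one, orbitInteg_one, ofAdd_zero]
  map_mul' h k := by
    rw [Subgroup.coe_mul, orbitInteg_mul ω₀ c h.2, ofAdd_add]

/-- The periods of an edge function. -/
def periods (T : Ω → Set (F N)) (ω₀ : Ω) : (orbitEdges T ω₀ → ℚ) →ₗ[ℚ]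
    (IsFreeGroup.Generators (MulAction.stabilizer (F N) ω₀) → ℚ) :=
  LinearMap.funLeft ℚ ℚ (fun i => (IsFreeGroup.of i : MulAction.stabilizer (F N) ω₀).1) ∘ₗ
    integLinear N ∘ₗ orbitIncr T ω₀

theorem periods_apply (ω₀ : Ω) (c : orbitEdges T ω₀ → ℚ)
    (i : IsFreeGroup.Generators (MulAction.stabilizer (F N) ω₀)) :
    periods T ω₀ c i = orbitInteg T ω₀ c (IsFreeGroup.of i : MulAction.stabilizer (F N) ω₀) := rfl

theorem orbitInteg_eq_zero_of_periods {ω₀ : Ω} {c : orbitEdges T ω₀ → ℚ}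
    (h : periods T ω₀ c = 0) {g : F N} (hg : g ∈ MulAction.stabilizer (F N) ω₀) :
    orbitInteg T ω₀ c g = 0 := by
  have : orbitHom ω₀ c = 1 := IsFreeGroup.ext_hom fun i => by
    have := congrFun h i
    rw [periods_apply, Pi.zero_apply] at this
    change Multiplicative.ofAdd (orbitInteg T ω₀ c _) = 1
    rw [this, ofAdd_zero]
  have h2 : Multiplicative.ofAdd (orbitInteg T ω₀ c g) = 1 := DFunLike.congr_fun this ⟨g, hg⟩
  exact ofAdd_eq_one.1 h2

/-- The coboundary of a vertex function. -/
def coboundary (T : Ω → Set (F N)) (ω₀ : Ω) :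
    (orbitVertices T ω₀ → ℚ) →ₗ[ℚ] (orbitEdges T ω₀ → ℚ) where
  toFun f p := extZero (orbitVertices T ω₀) f ((FreeGroup.of p.1.1)⁻¹ • p.1.2) -
    extZero (orbitVertices T ω₀) f p.1.2
  map_add' f f' := by
    funext p
    simp only [map_add, Pi.add_apply]
    ring
  map_smul' c f := by
    funext p
    simp only [map_smul, Pi.smul_apply, smul_eq_mul, RingHom.id_apply]
    ring

/-- The map taking `g` to g⁻¹ω₀ identifies the quotient of the tree `T ω₀` by the stabilizer with
the component of `ω₀`. -/
theorem mem_orbitVertices_iff (hg : ∀ (g : F N) ω h, h ∈ T (g • ω) ↔ g⁻¹ * h ∈ T ω)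
    {ω₀ : Ω} {g : F N} : g⁻¹ • ω₀ ∈ orbitVertices T ω₀ ↔ g ∈ T ω₀ := by
  rw [orbitVertices, Set.mem_ofPred_eq, hg]
  simp

theorem mem_orbitEdges_iff (hg : ∀ (g : F N) ω h, h ∈ T (g • ω) ↔ g⁻¹ * h ∈ T ω)
    {ω₀ : Ω} {g : F N} {a : Fin N} :
    (a, g⁻¹ • ω₀) ∈ orbitEdges T ω₀ ↔ g ∈ T ω₀ ∧ g * FreeGroup.of a ∈ T ω₀ := by
  rw [orbitEdges, Set.mem_ofPred_eq, hg, hg]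
  simp

theorem stabilizer_subset (hg : ∀ (g : F N) ω h, h ∈ T (g • ω) ↔ g⁻¹ * h ∈ T ω)
    {ω₀ : Ω} (h1 : 1 ∈ T ω₀) {g : F N}
    (h : g ∈ MulAction.stabilizer (F N) ω₀) : g ∈ T ω₀ := by
  rw [← MulAction.mem_stabilizer_iff.1 h, hg, inv_mul_cancel]
  exact h1

theorem exists_inv_smul_eq {ω₀ ω : Ω} (h : ω ∈ MulAction.orbit (F N) ω₀) :
    ∃ g : F N, g⁻¹ • ω₀ = ω := by
  obtain ⟨g, hg⟩ := h
  exact ⟨g⁻¹, by rw [inv_inv]; exact hg⟩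

theorem inv_smul_mul (g h : F N) (ω : Ω) : (g * h)⁻¹ • ω = h⁻¹ • g⁻¹ • ω := by
  rw [mul_inv_rev, mul_smul]

theorem coboundary_eq_zero_iff (hT : ∀ ω, IsConvex (T ω)) 
    (hg : ∀ (g : F N) ω h, h ∈ T (g • ω) ↔ g⁻¹ * h ∈ T ω)
    {ω₀ : Ω} (h1 : 1 ∈ T ω₀) (f : orbitVertices T ω₀ → ℚ) :
    coboundary T ω₀ f = 0 ↔ ∃ c : ℚ, f = fun _ => c := by
  constructor
  · intro h
    have key : ∀ g ∈ T ω₀, extZero (orbitVertices T ω₀) f (g⁻¹ • ω₀) =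
        extZero (orbitVertices T ω₀) f ((1 : F N)⁻¹ • ω₀) := fun g hgT =>
      (hT ω₀).const (f := fun g => extZero (orbitVertices T ω₀) f (g⁻¹ • ω₀)) h1
        (fun g h2 a h3 => by
          have := congrFun h ⟨_, (mem_orbitEdges_iff hg).2 ⟨h2, h3⟩⟩
          rw [inv_smul_mul]
          exact sub_eq_zero.1 this) hgT
    refine ⟨extZero (orbitVertices T ω₀) f ((1 : F N)⁻¹ • ω₀), funext fun ω => ?_⟩
    obtain ⟨ω, hω⟩ := ω
    obtain ⟨g, rfl⟩ := exists_inv_smul_eq hω.1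
    rw [← key g ((mem_orbitVertices_iff hg).1 hω), extZero_mem]
  · rintro ⟨c, rfl⟩
    funext p
    obtain ⟨⟨a, ω⟩, hp⟩ := p
    obtain ⟨g, rfl⟩ := exists_inv_smul_eq hp.1
    obtain ⟨h2, h3⟩ := (mem_orbitEdges_iff hg).1 hp
    change extZero _ _ _ - extZero _ _ _ = 0
    simp only [← inv_smul_mul]
    rw [extZero_mem _ ((mem_orbitVertices_iff hg).2 h2),
      extZero_mem _ ((mem_orbitVertices_iff hg).2 h3), sub_self]

/-- An edge function is a coboundary exactly when its integral over the tree descends to the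
quotient, that is, when the associated homomorphism on the stabilizer vanishes; it suffices to test
the free basis. -/
theorem range_coboundary (hT : ∀ ω, IsConvex (T ω)) 
    (hg : ∀ (g : F N) ω h, h ∈ T (g • ω) ↔ g⁻¹ * h ∈ T ω)
    {ω₀ : Ω} (h1 : 1 ∈ T ω₀) :
    LinearMap.range (coboundary T ω₀) = LinearMap.ker (periods T ω₀) := by
  ext c
  rw [LinearMap.mem_range, LinearMap.mem_ker]
  constructor
  · rintro ⟨f, rfl⟩
    funext i
    set h := (IsFreeGroup.of i : MulAction.stabilizer (F N) ω₀)
    have key := (hT ω₀).const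
      (f := fun g => orbitInteg T ω₀ (coboundary T ω₀ f) g -
        extZero (orbitVertices T ω₀) f (g⁻¹ • ω₀)) h1
      (fun g h2 a h3 => by
        simp only [orbitInteg_mul_of]
        rw [extZero_mem _ ((mem_orbitEdges_iff hg).2 ⟨h2, h3⟩), inv_smul_mul]
        simp only [coboundary, LinearMap.coe_mk, AddHom.coe_mk]
        ring)
      (stabilizer_subset hg h1 h.2)
    have e : (h.1)⁻¹ • ω₀ = ω₀ := inv_smul_eq_iff.2 (MulAction.mem_stabilizer_iff.1 h.2).symm
    simp only [e, inv_one, one_smul] at key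
    rw [orbitInteg_one] at key
    rw [periods_apply, Pi.zero_apply]
    linarith
  · intro hc
    have hwd : ∀ g g' : F N, g⁻¹ • ω₀ = g'⁻¹ • ω₀ → orbitInteg T ω₀ c g = orbitInteg T ω₀ c g' := by
      intro g g' e
      have hs : g' * g⁻¹ ∈ MulAction.stabilizer (F N) ω₀ := by
        rw [MulAction.mem_stabilizer_iff, mul_smul, e, smul_inv_smul]
      have := orbitInteg_mul (T := T) ω₀ c hs g
      rw [inv_mul_cancel_right, orbitInteg_eq_zero_of_periods hc hs, zero_add] at this
      exact this.symm
    choose s hs using fun ω : orbitVertices T ω₀ => exists_inv_smul_eq ω.2.1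
    refine ⟨fun ω => orbitInteg T ω₀ c (s ω), funext fun p => ?_⟩
    obtain ⟨⟨a, ω⟩, hp⟩ := p
    obtain ⟨g, rfl⟩ := exists_inv_smul_eq hp.1
    obtain ⟨h2, h3⟩ := (mem_orbitEdges_iff hg).1 hp
    change extZero _ _ _ - extZero _ _ _ = _
    simp only [← inv_smul_mul]
    rw [extZero_mem _ ((mem_orbitVertices_iff hg).2 h2),
      extZero_mem _ ((mem_orbitVertices_iff hg).2 h3), hwd _ (g * FreeGroup.of a) (hs ⟨_, (mem_orbitVertices_iff hg).2 h3⟩),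
      hwd _ g (hs ⟨_, (mem_orbitVertices_iff hg).2 h2⟩),
      orbitInteg_mul_of, extZero_mem _ hp, add_sub_cancel_left]

/-- Since the stabilizer is free, the prescribed periods extend to a homomorphism `φ`. Orbit
representatives turn `φ` into a function on the whole group with f(hg) = φ(h) + f(g), and its
increments are the required edge function. -/
theorem periods_surjective (hT : ∀ ω, IsConvex (T ω)) 
    (hg : ∀ (g : F N) ω h, h ∈ T (g • ω) ↔ g⁻¹ * h ∈ T ω)
    {ω₀ : Ω} (h1 : 1 ∈ T ω₀) : Function.Surjective (periods T ω₀) := by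
  intro v
  let φ : MulAction.stabilizer (F N) ω₀ →* Multiplicative ℚ :=
    IsFreeGroup.lift fun i => Multiplicative.ofAdd (v i)
  choose s hs using fun ω : MulAction.orbit (F N) ω₀ => exists_inv_smul_eq ω.2
  have hmem : ∀ g : F N, g⁻¹ • ω₀ ∈ MulAction.orbit (F N) ω₀ := fun g => ⟨g⁻¹, rfl⟩
  have hstab : ∀ g : F N, g * (s ⟨_, hmem g⟩)⁻¹ ∈ MulAction.stabilizer (F N) ω₀ := fun g => by
    rw [MulAction.mem_stabilizer_iff, mul_smul, hs, smul_inv_smul]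
  let f : F N → ℚ := fun g => (φ ⟨_, hstab g⟩).toAdd
  have hf : ∀ (h : MulAction.stabilizer (F N) ω₀) (g : F N), f (h * g) = (φ h).toAdd + f g := by
    intro h g
    have e : (h.1 * g)⁻¹ • ω₀ = g⁻¹ • ω₀ := by
      rw [inv_smul_mul, inv_smul_eq_iff.2 (MulAction.mem_stabilizer_iff.1 h.2).symm]
    have e2 : (⟨_, hstab (h.1 * g)⟩ : MulAction.stabilizer (F N) ω₀) = h * ⟨_, hstab g⟩ := by
      apply Subtype.ext
      simp only [Subgroup.coe_mul, e, mul_assoc]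
    simp only [f, e2, map_mul, toAdd_mul]
  refine ⟨fun p => f (s ⟨p.1.2, p.2.1⟩ * FreeGroup.of p.1.1) - f (s ⟨p.1.2, p.2.1⟩), funext fun i => ?_⟩
  set c : orbitEdges T ω₀ → ℚ :=
    fun p => f (s ⟨p.1.2, p.2.1⟩ * FreeGroup.of p.1.1) - f (s ⟨p.1.2, p.2.1⟩)
  set h := (IsFreeGroup.of i : MulAction.stabilizer (F N) ω₀) with hh
  have key := (hT ω₀).const (f := fun g => orbitInteg T ω₀ c g - f g) h1
    (fun g h2 a h3 => by
      simp only [orbitInteg_mul_of]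
      rw [extZero_mem _ ((mem_orbitEdges_iff hg).2 ⟨h2, h3⟩)]
      simp only [c]
      have e := hf ⟨_, hstab g⟩ (s ⟨_, hmem g⟩)
      have e' := hf ⟨_, hstab g⟩ (s ⟨_, hmem g⟩ * FreeGroup.of a)
      simp only [inv_mul_cancel_right, ← mul_assoc] at e e'
      rw [e, e']
      ring)
    (stabilizer_subset hg h1 h.2)
  have e := hf h 1
  rw [mul_one] at e
  rw [orbitInteg_one, e] at key
  have e3 : (φ h).toAdd = v i := by
    rw [hh, IsFreeGroup.lift_of]
    rfl
  rw [periods_apply]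
  linarith

/-- The Euler characteristic of the component of `ω₀` in terms of the rank of its fundamental
group. -/
theorem card_generators_add (hT : ∀ ω, IsConvex (T ω)) 
    (hg : ∀ (g : F N) ω h, h ∈ T (g • ω) ↔ g⁻¹ * h ∈ T ω)
    {ω₀ : Ω} (h1 : 1 ∈ T ω₀) (hfin : (orbitVertices T ω₀).Finite) :
    ENat.card (IsFreeGroup.Generators (MulAction.stabilizer (F N) ω₀)) +
      (orbitVertices T ω₀).encard = (orbitEdges T ω₀).encard + 1 := by
  have hE : (orbitEdges T ω₀).Finite :=
    (Set.finite_univ.prod hfin).subset fun p hp => ⟨trivial, hp.1, hp.2.1⟩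
  have := hfin.fintype
  have := hE.fintype
  have hm : Module.Finite ℚ (IsFreeGroup.Generators (MulAction.stabilizer (F N) ω₀) → ℚ) :=
    Module.Finite.of_surjective _ (periods_surjective hT hg h1)
  have hG : Finite (IsFreeGroup.Generators (MulAction.stabilizer (F N) ω₀)) := finite_of_finite_pi
  have := Fintype.ofFinite (IsFreeGroup.Generators (MulAction.stabilizer (F N) ω₀))
  -- Dimension count in the exact sequence of constants, vertex functions, edge functions and
  -- functions on the free basis, with the maps `coboundary` and `periods`.
  have r1 := LinearMap.finrank_range_add_finrank_ker (periods T ω₀)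
  have r2 := LinearMap.finrank_range_add_finrank_ker (coboundary T ω₀)
  rw [LinearMap.range_eq_top.2 (periods_surjective hT hg h1), finrank_top,
    ← range_coboundary hT hg h1] at r1
  have r3 : Module.finrank ℚ (LinearMap.ker (coboundary T ω₀)) = 1 := by
    have hne : (fun _ => 1 : orbitVertices T ω₀ → ℚ) ≠ 0 := fun h => by
      have := congrFun h ⟨ω₀, MulAction.mem_orbit_self _, h1⟩
      simp at this
    rw [show LinearMap.ker (coboundary T ω₀) = Submodule.span ℚ {fun _ => 1} from ?_]
    · exact finrank_span_singleton hne
    · ext f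
      rw [LinearMap.mem_ker, coboundary_eq_zero_iff hT hg h1, Submodule.mem_span_singleton]
      constructor
      · rintro ⟨c, rfl⟩
        exact ⟨c, by funext; simp⟩
      · rintro ⟨c, rfl⟩
        exact ⟨c, by funext; simp⟩
  rw [r3] at r2
  simp only [Module.finrank_fintype_fun_eq_card] at r1 r2
  rw [ENat.card_eq_coe_fintype_card, Set.encard_eq_coe_toFinset_card,
    Set.encard_eq_coe_toFinset_card, Set.toFinset_card, Set.toFinset_card]
  norm_cast
  omega

end Euler

/-! ### Reduced rank of a stabilizer -/

/-- The cardinality of a free basis. -/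
def freeRank (H : Subgroup (F N)) : ℕ∞ := ENat.card (IsFreeGroup.Generators H)

theorem freeRank_congr {H K : Subgroup (F N)} (e : H ≃* K) : freeRank H = freeRank K :=
  ENat.card_congr (Equiv.ofIsFreeGroupEquiv e)

theorem freeRank_map (φ : MulAut (F N)) (H : Subgroup (F N)) :
    freeRank (H.map φ.toMonoidHom) = freeRank H :=
  (freeRank_congr (H.equivMapOfInjective φ.toMonoidHom φ.injective)).symm

theorem freeRank_conj (g : F N) (H : Subgroup (F N)) : freeRank (conj g H) = freeRank H :=
  freeRank_map _ H

theorem freeRank_eq_zero_iff {H : Subgroup (F N)} : freeRank H = 0 ↔ H = ⊥ := by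
  rw [freeRank, ENat.card_eq_zero_iff_empty]
  constructor
  · intro h
    rw [Subgroup.eq_bot_iff_forall]
    intro x hx
    have := IsFreeGroup.ext_hom (f := MonoidHom.id H) (g := 1) (fun a => h.elim a)
    exact congrArg Subtype.val (DFunLike.congr_fun this ⟨x, hx⟩)
  · rintro rfl
    refine ⟨fun a => ?_⟩
    have h1 : IsFreeGroup.mulEquiv (⊥ : Subgroup (F N)) (FreeGroup.of a) =
      IsFreeGroup.mulEquiv (⊥ : Subgroup (F N)) 1 := Subsingleton.elim _ _
    exact FreeGroup.of_ne_one a ((IsFreeGroup.mulEquiv _).injective h1)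

theorem reducedRank_eq (H : Subgroup (F N)) : reducedRank H = freeRank H - 1 := rfl

theorem tsum_encard {ι α : Type*} {s : ι → Set α} (h : Pairwise (Function.onFun Disjoint s)) :
    ∑' i, ((s i).encard : ℝ≥0∞) = (⋃ i, s i).encard := by
  simp only [← ENNReal.tsum_set_one]
  rw [← ENNReal.tsum_sigma' (f := fun _ => (1 : ℝ≥0∞)),
    ← (Set.unionEqSigmaOfDisjoint h).tsum_eq]

section Orbits

variable {Ω : Type} [MulAction (F N) Ω] {T : Ω → Set (F N)}

theorem orbitVertices_smul (ω : Ω) (g : F N) : orbitVertices T (g • ω) = orbitVertices T ω := by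
  simp only [orbitVertices, MulAction.orbit_smul]

theorem orbitEdges_smul (ω : Ω) (g : F N) : orbitEdges T (g • ω) = orbitEdges T ω := by
  simp only [orbitEdges, MulAction.orbit_smul]

theorem freeRank_stabilizer_smul (ω : Ω) (g : F N) :
    freeRank (MulAction.stabilizer (F N) (g • ω)) = freeRank (MulAction.stabilizer (F N) ω) := by
  rw [MulAction.stabilizer_smul_eq_stabilizer_map_conj]
  exact freeRank_conj g _

theorem one_mem_of_mem (hg : ∀ (g : F N) ω h, h ∈ T (g • ω) ↔ g⁻¹ * h ∈ T ω) {ω : Ω} {g : F N}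
    (h : g ∈ T ω) : 1 ∈ T (g⁻¹ • ω) := by
  rw [hg, inv_inv, mul_one]
  exact h

theorem freeRank_add (hT : ∀ ω, IsConvex (T ω))
    (hg : ∀ (g : F N) ω h, h ∈ T (g • ω) ↔ g⁻¹ * h ∈ T ω) {ω : Ω} (h : (T ω).Nonempty)
    (hfin : (orbitVertices T ω).Finite) :
    freeRank (MulAction.stabilizer (F N) ω) + (orbitVertices T ω).encard =
      (orbitEdges T ω).encard + 1 := by
  obtain ⟨g, hgT⟩ := h
  have := card_generators_add hT hg (one_mem_of_mem hg hgT) (by rwa [orbitVertices_smul])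
  rw [orbitVertices_smul, orbitEdges_smul] at this
  rw [← this, ← freeRank_stabilizer_smul ω g⁻¹]
  rfl

theorem image_eq_of_equivariant (hg : ∀ (g : F N) ω h, h ∈ T (g • ω) ↔ g⁻¹ * h ∈ T ω) (g : F N)
    (ω : Ω) : T (g • ω) = (g * ·) '' T ω := by
  ext h
  rw [hg, Set.image_mul_left]
  rfl

/-- No non-trivial element preserves a finite tree. If the stabilizer is trivial, the tree injects
into the finite set of vertices of the component. -/
theorem finite_iff_stabilizer_eq_bot (hg : ∀ (g : F N) ω h, h ∈ T (g • ω) ↔ g⁻¹ * h ∈ T ω) {ω : Ω}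
    (h : (T ω).Nonempty) (hfin : (orbitVertices T ω).Finite) :
    (T ω).Finite ↔ MulAction.stabilizer (F N) ω = ⊥ := by
  constructor
  · intro hf
    obtain ⟨k, hk⟩ := h
    rw [Subgroup.eq_bot_iff_forall]
    intro x hx
    have h1 := one_mem_of_mem hg hk
    have e : T ((k⁻¹ * x * k) • k⁻¹ • ω) = T (k⁻¹ • ω) := by
      rw [mul_smul, smul_inv_smul, mul_smul, MulAction.mem_stabilizer_iff.1 hx]
    rw [image_eq_of_equivariant hg] at e
    have hf' : (T (k⁻¹ • ω)).Finite := by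
      rw [image_eq_of_equivariant hg]
      exact hf.image _
    have := eq_one_of_image_eq hf' h1 e
    rwa [mul_assoc, inv_mul_eq_one, eq_comm, mul_eq_right] at this
  · intro hs
    refine (hfin.preimage (f := fun g : F N => g⁻¹ • ω) ?_).subset fun g hgT => ?_
    · intro g _ g' _ e
      have : g' * g⁻¹ ∈ MulAction.stabilizer (F N) ω := by
        rw [MulAction.mem_stabilizer_iff, mul_smul]
        simp only at e
        rw [e, smul_inv_smul]
      rw [hs, Subgroup.mem_bot, mul_inv_eq_one] at this
      exact this.symm
    · exact ⟨⟨g⁻¹, rfl⟩, one_mem_of_mem hg hgT⟩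

open Classical in
/-- Whether the tree of `ω` is finite and non-empty. -/
def isFiniteTree (T : Ω → Set (F N)) (ω : Ω) : ℕ∞ := if (T ω).Nonempty ∧ (T ω).Finite then 1 else 0

/-- The local form of 𝒩 = Ê - V̂ + ĉ. For a non-trivial stabilizer the rank is at least one, so
truncation is harmless. For a trivial one the rank is zero and the component is a finite tree: the
missing 1 is `isFiniteTree`. All terms vanish for an empty tree. -/
theorem reducedRank_add (hT : ∀ ω, IsConvex (T ω))
    (hg : ∀ (g : F N) ω h, h ∈ T (g • ω) ↔ g⁻¹ * h ∈ T ω) {ω : Ω}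
    (hs : T ω = ∅ → MulAction.stabilizer (F N) ω = ⊥) (hfin : (orbitVertices T ω).Finite) :
    reducedRank (MulAction.stabilizer (F N) ω) + (orbitVertices T ω).encard =
      (orbitEdges T ω).encard + isFiniteTree T ω := by
  have hE : (orbitEdges T ω).Finite :=
    (Set.finite_univ.prod hfin).subset fun p hp => ⟨trivial, hp.1, hp.2.1⟩
  rcases Set.eq_empty_or_nonempty (T ω) with h | h
  · have hV : orbitVertices T ω = ∅ := by
      ext ω'
      simp only [Set.mem_empty_iff_false, iff_false]
      rintro ⟨⟨g, rfl⟩, h1⟩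
      simp only at h1
      rw [image_eq_of_equivariant hg, h, Set.image_empty] at h1
      exact h1
    have hE : orbitEdges T ω = ∅ := by
      ext p
      simp only [Set.mem_empty_iff_false, iff_false]
      intro hp
      exact Set.notMem_empty p.2 (hV ▸ ⟨hp.1, hp.2.1⟩)
    rw [hV, hE, reducedRank_eq, freeRank_eq_zero_iff.2 (hs h), isFiniteTree, if_neg (by simp [h])]
    simp
  · have key := freeRank_add hT hg h hfin
    rw [reducedRank_eq, isFiniteTree, finite_iff_stabilizer_eq_bot hg h hfin]
    by_cases hb : MulAction.stabilizer (F N) ω = ⊥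
    · rw [freeRank_eq_zero_iff.2 hb] at key ⊢
      rw [if_pos ⟨h, hb⟩, ← key]
      simp
    · rw [if_neg (fun h' => hb h'.2)]
      have hne : freeRank (MulAction.stabilizer (F N) ω) ≠ 0 := fun h' => hb (freeRank_eq_zero_iff.1 h')
      generalize freeRank (MulAction.stabilizer (F N) ω) = x at key hne ⊢
      obtain ⟨v, hv⟩ := ENat.ne_top_iff_exists.1 (Set.encard_ne_top_iff.2 hfin)
      obtain ⟨e, he⟩ := ENat.ne_top_iff_exists.1 (Set.encard_ne_top_iff.2 hE)
      rw [← hv, ← he] at key ⊢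
      have hx : x ≠ ⊤ := by
        rintro rfl
        rw [top_add] at key
        exact absurd key.symm (by exact_mod_cast ENat.natCast_ne_top (e + 1))
      obtain ⟨n, rfl⟩ := ENat.ne_top_iff_exists.1 hx
      norm_cast at key hne ⊢
      omega

end Orbits

/-! ### Pairs of cosets: the three terms at counting currents -/

section Product

variable {H K : Subgroup (F N)} (hH : H ≠ ⊥) (hK : K ≠ ⊥)

/-- The intersection of the convex hulls of two translates. -/
def pairTree (hH : H ≠ ⊥) (hK : K ≠ ⊥) (ω : (F N ⧸ H) × (F N ⧸ K)) : Set (F N) :=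
  conv (cosetLimit H hH ω.1).1 ∩ conv (cosetLimit K hK ω.2).1

theorem isConvex_pairTree (ω : (F N ⧸ H) × (F N ⧸ K)) : IsConvex (pairTree hH hK ω) :=
  (isConvex_conv _).inter (isConvex_conv _)

theorem mem_pairTree_smul (g : F N) (ω : (F N ⧸ H) × (F N ⧸ K)) (h : F N) :
    h ∈ pairTree hH hK (g • ω) ↔ g⁻¹ * h ∈ pairTree hH hK ω := by
  simp only [pairTree, Prod.smul_fst, Prod.smul_snd, cosetLimit_smul, Set.mem_inter_iff,
    mem_conv_smul]

theorem finite_pairTree (hHf : H.FG) (hKf : K.FG) :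
    {ω | 1 ∈ pairTree hH hK ω}.Finite :=
  ((finite_cosetLimit hHf hH 1).prod (finite_cosetLimit hKf hK 1)).subset fun _ h => h

theorem finite_orbitVertices (hHf : H.FG) (hKf : K.FG) (ω : (F N ⧸ H) × (F N ⧸ K)) :
    (orbitVertices (pairTree hH hK) ω).Finite :=
  (finite_pairTree hH hK hHf hKf).subset fun _ h => h.2

/-- The representative of the orbit corresponding to a double coset. -/
def doubleCosetRep (D : DoubleCoset.Quotient (H : Set (F N)) (K : Set (F N))) :
    (F N ⧸ H) × (F N ⧸ K) := (((1 : F N) : F N ⧸ H), (Quotient.out D : F N))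

theorem smul_coset (g h : F N) : g • (h : F N ⧸ H) = ((g * h : F N) : F N ⧸ H) := rfl

/-- Diagonal orbits of pairs of cosets are classified by double cosets: the pair (aH, bK) goes to
Ha⁻¹bK. -/
theorem mem_orbit_iff (a b d : F N) :
    ((a : F N ⧸ H), (b : F N ⧸ K)) ∈ MulAction.orbit (F N) (((1 : F N) : F N ⧸ H), (d : F N ⧸ K)) ↔
      DoubleCoset.mk H K (a⁻¹ * b) = DoubleCoset.mk H K d := by
  rw [eq_comm, DoubleCoset.eq]
  constructor
  · rintro ⟨g, hg⟩
    simp only [Prod.smul_mk, smul_coset, Prod.mk.injEq, QuotientGroup.eq, mul_one] at hg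
    refine ⟨a⁻¹ * g, ?_, (g * d)⁻¹ * b, hg.2, by group⟩
    have := H.inv_mem hg.1
    simpa using this
  · rintro ⟨h, hh, k, hk, e⟩
    refine ⟨a * h, ?_⟩
    simp only [Prod.smul_mk, smul_coset, Prod.mk.injEq, QuotientGroup.eq, mul_one]
    refine ⟨by simpa using hh, ?_⟩
    have : (a * h * d)⁻¹ * b = k := by
      have e' : b = a * (h * d * k) := by rw [← e, mul_inv_cancel_left]
      rw [e']
      group
    rwa [this]

theorem mem_orbit_doubleCosetRep (D : DoubleCoset.Quotient (H : Set (F N)) (K : Set (F N)))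
    (a b : F N) : ((a : F N ⧸ H), (b : F N ⧸ K)) ∈ MulAction.orbit (F N) (doubleCosetRep D) ↔
      DoubleCoset.mk H K (a⁻¹ * b) = D := by
  rw [doubleCosetRep, mem_orbit_iff, DoubleCoset.out_eq']

theorem exists_mem_orbit (ω : (F N ⧸ H) × (F N ⧸ K)) :
    ∃ D, ω ∈ MulAction.orbit (F N) (doubleCosetRep (H := H) (K := K) D) := by
  obtain ⟨p, q⟩ := ω
  induction p using QuotientGroup.induction_on with
  | H a =>
    induction q using QuotientGroup.induction_on with
    | H b => exact ⟨_, (mem_orbit_doubleCosetRep _ a b).2 rfl⟩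

theorem orbit_unique {ω : (F N ⧸ H) × (F N ⧸ K)}
    {D D' : DoubleCoset.Quotient (H : Set (F N)) (K : Set (F N))}
    (h : ω ∈ MulAction.orbit (F N) (doubleCosetRep D))
    (h' : ω ∈ MulAction.orbit (F N) (doubleCosetRep D')) : D = D' := by
  obtain ⟨p, q⟩ := ω
  induction p using QuotientGroup.induction_on with
  | H a =>
    induction q using QuotientGroup.induction_on with
    | H b =>
      rw [mem_orbit_doubleCosetRep] at h h'
      exact h.symm.trans h'

theorem stabilizer_pair (g : F N) :
    MulAction.stabilizer (F N) (((1 : F N) : F N ⧸ H), (g : F N ⧸ K)) = H ⊓ conj g K := by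
  ext x
  rw [MulAction.mem_stabilizer_iff, Prod.smul_mk, smul_coset, smul_coset, Prod.mk.injEq,
    eq_comm, QuotientGroup.eq, eq_comm, QuotientGroup.eq, Subgroup.mem_inf, mem_conj]
  simp [mul_assoc]

/-- A non-trivial intersection of the two subgroups has a limit set of its own, contained in both
limit sets, so its non-empty hull lies in the tree. -/
theorem stabilizer_eq_bot_of_pairTree_eq_empty
    (D : DoubleCoset.Quotient (H : Set (F N)) (K : Set (F N)))
    (h : pairTree hH hK (doubleCosetRep D) = ∅) :
    MulAction.stabilizer (F N) (doubleCosetRep D) = ⊥ := by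
  by_contra hne
  obtain ⟨y, hy⟩ := exists_mem_conv (limitSet_nontrivial hne)
  rw [doubleCosetRep, stabilizer_pair] at hy
  refine Set.notMem_empty y (h ▸ ⟨?_, ?_⟩)
  · rw [doubleCosetRep, cosetLimit_mk, one_smul]
    exact conv_mono (limitSet_mono inf_le_left) hy
  · have := conv_mono (limitSet_mono inf_le_right) hy
    rwa [limitSet_conj] at this

theorem pairwise_disjoint_of_orbit {α : Type*} (f : α → (F N ⧸ H) × (F N ⧸ K))
    (s : DoubleCoset.Quotient (H : Set (F N)) (K : Set (F N)) → Set α)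
    (hs : ∀ D, ∀ x ∈ s D, f x ∈ MulAction.orbit (F N) (doubleCosetRep D)) :
    Pairwise (Function.onFun Disjoint s) := fun D D' hne =>
  Set.disjoint_left.2 fun x hx hx' => hne (orbit_unique (hs D x hx) (hs D' x hx'))

/-- Both sides count the pairs of cosets whose two hulls contain the identity, on the right sorted
by orbits. -/
theorem vHat_counting (hHf : H.FG) (hKf : K.FG) :
    vHat (countingCurrent H hHf) (countingCurrent K hKf) =
      ∑' D, ((orbitVertices (pairTree hH hK) (doubleCosetRep D)).encard : ℝ≥0∞) := by
  rw [tsum_encard (pairwise_disjoint_of_orbit id _ fun D x hx => hx.1), vHat_eq]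
  change countingMeasure H _ * countingMeasure K _ = _
  rw [countingMeasure_apply hHf hH isClopen_hullAtOne.1.measurableSet,
    countingMeasure_apply hKf hK isClopen_hullAtOne.1.measurableSet, ← ENat.toENNReal_mul,
    ← Set.encard_prod]
  congr 2
  ext ω
  simp only [Set.mem_iUnion]
  constructor
  · intro h
    obtain ⟨D, hD⟩ := exists_mem_orbit ω
    exact ⟨D, hD, h⟩
  · rintro ⟨D, h⟩
    exact h.2

theorem eHat_counting (hHf : H.FG) (hKf : K.FG) :
    eHat (countingCurrent H hHf) (countingCurrent K hKf) =
      ∑' D, ((orbitEdges (pairTree hH hK) (doubleCosetRep D)).encard : ℝ≥0∞) := by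
  rw [tsum_encard (pairwise_disjoint_of_orbit Prod.snd _ fun D x hx => hx.1), eHat_eq,
    ← tsum_fintype (L := .unconditional _)]
  have : ∀ a : Fin N, countingMeasure H (hullAtEdge a) * countingMeasure K (hullAtEdge a) =
      ((Prod.mk a '' {ω | 1 ∈ pairTree hH hK ω ∧ FreeGroup.of a ∈ pairTree hH hK ω}).encard
        : ℝ≥0∞) := by
    intro a
    rw [countingMeasure_apply hHf hH (isClopen_hullAtEdge a).1.measurableSet,
      countingMeasure_apply hKf hK (isClopen_hullAtEdge a).1.measurableSet, ← ENat.toENNReal_mul,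
      ← Set.encard_prod, (Prod.mk_right_injective a).encard_image]
    congr 2
    ext ω
    change ((_ ∧ _) ∧ (_ ∧ _)) ↔ ((_ ∧ _) ∧ (_ ∧ _))
    exact and_and_and_comm
  refine (tsum_congr this).trans ?_
  rw [tsum_encard]
  · congr 2
    ext ⟨a, ω⟩
    simp only [Set.mem_iUnion]
    constructor
    · rintro ⟨b, ω', h, e⟩
      obtain ⟨rfl, rfl⟩ := Prod.mk.inj e
      obtain ⟨D, hD⟩ := exists_mem_orbit ω'
      exact ⟨D, hD, h⟩
    · rintro ⟨D, h⟩
      exact ⟨a, ω, h.2, rfl⟩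
  · intro a b hab
    refine Set.disjoint_left.2 ?_
    rintro _ ⟨ω, _, rfl⟩ ⟨ω', _, e⟩
    exact hab (congrArg Prod.fst e).symm

theorem pairMeasure_counting (hHf : H.FG) (hKf : K.FG) (T : BasedSubtree N) :
    ((countingMeasure H).prod (countingMeasure K)) (pairsWithIntersection T.1) =
      {ω | pairTree hH hK ω = T.1}.encard := by
  have : Countable (F N ⧸ H) := Quotient.countable
  have : Countable (F N ⧸ K) := Quotient.countable
  rw [countingMeasure_eq_sum hHf hH, countingMeasure_eq_sum hKf hK, Measure.prod_sum,
    Measure.sum_apply _ (SCurr.measurableSet_pairs T)]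
  have : ∀ ω : (F N ⧸ H) × (F N ⧸ K), ((Measure.dirac (cosetLimit H hH ω.1)).prod
      (Measure.dirac (cosetLimit K hK ω.2))) (pairsWithIntersection T.1) =
        {ω | pairTree hH hK ω = T.1}.indicator 1 ω := by
    intro ω
    rw [Measure.dirac_prod_dirac, Measure.dirac_apply' _ (SCurr.measurableSet_pairs T)]
    rfl
  rw [tsum_congr this, ← tsum_subtype, ← ENNReal.tsum_set_one]
  rfl

/-- If the trees of an orbit are finite and non-empty, a translation reaches the chosen
representative of their class, and only one pair does so because no non-trivial translation
preserves a finite tree. -/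
theorem encard_orbit_inter
    (D : DoubleCoset.Quotient (H : Set (F N)) (K : Set (F N))) :
    {ω | ω ∈ MulAction.orbit (F N) (doubleCosetRep D) ∧
      ∃ C : Quotient (subtreeSetoid N), pairTree hH hK ω = C.out.1}.encard =
    isFiniteTree (pairTree hH hK) (doubleCosetRep D) := by
  have hg := mem_pairTree_smul hH hK
  rw [isFiniteTree]
  split_ifs with h
  · rw [Set.encard_eq_one]
    obtain ⟨⟨g, hgT⟩, hf⟩ := h
    have hfin : (pairTree hH hK (g⁻¹ • doubleCosetRep D)).Finite := by
      rw [image_eq_of_equivariant hg]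
      exact hf.image _
    have h1 := one_mem_of_mem hg hgT
    let T : BasedSubtree N :=
      ⟨_, (isConvex_pairTree hH hK (g⁻¹ • doubleCosetRep D)).isFiniteSubtree hfin h1, h1⟩
    obtain ⟨k, hk⟩ := Quotient.exact (Quotient.out_eq (Quotient.mk (subtreeSetoid N) T)).symm
    refine ⟨k • g⁻¹ • doubleCosetRep D, Set.eq_singleton_iff_unique_mem.2 ⟨⟨?_,
      Quotient.mk (subtreeSetoid N) T, ?_⟩, ?_⟩⟩
    · rw [← mul_smul]
      exact ⟨_, rfl⟩
    · rw [image_eq_of_equivariant hg]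
      exact hk
    · rintro ω ⟨⟨l, rfl⟩, C, hC⟩
      simp only at hC ⊢
      set ω₁ := k • g⁻¹ • doubleCosetRep D with hω₁
      have e1 : pairTree hH hK ω₁ = (Quotient.mk (subtreeSetoid N) T).out.1 := by
        rw [hω₁, image_eq_of_equivariant hg]
        exact hk
      have e2 : doubleCosetRep D = (g * k⁻¹) • ω₁ := by
        rw [hω₁, mul_smul, inv_smul_smul, smul_inv_smul]
      rw [e2, ← mul_smul] at hC ⊢
      rw [image_eq_of_equivariant hg, e1] at hC
      have hCeq : Quotient.mk (subtreeSetoid N) T = C := by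
        rw [← Quotient.out_eq (Quotient.mk (subtreeSetoid N) T), ← Quotient.out_eq C]
        exact Quotient.sound ⟨_, hC⟩
      rw [← hCeq] at hC
      have hout := (Quotient.mk (subtreeSetoid N) T).out.2
      rw [eq_one_of_image_eq hout.1.finite hout.2 hC, one_smul]
  · rw [Set.encard_eq_zero]
    ext ω
    simp only [Set.mem_empty_iff_false, iff_false]
    rintro ⟨⟨g, rfl⟩, C, hC⟩
    simp only at hC
    have hf := C.out.2.1.finite
    rw [← hC, image_eq_of_equivariant hg] at hf
    have hn : (pairTree hH hK (g • doubleCosetRep D)).Nonempty := hC ▸ ⟨1, C.out.2.2⟩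
    rw [image_eq_of_equivariant hg] at hn
    exact h ⟨hn.of_image, hf.of_finite_image (mul_right_injective g).injOn⟩

theorem cHat_counting (hHf : H.FG) (hKf : K.FG) :
    cHat (countingCurrent H hHf) (countingCurrent K hKf) =
      ∑' D, (isFiniteTree (pairTree hH hK) (doubleCosetRep D) : ℝ≥0∞) := by
  rw [cHat]
  change ∑' C : Quotient (subtreeSetoid N),
    ((countingMeasure H).prod (countingMeasure K)) (pairsWithIntersection C.out.1) = _
  simp only [pairMeasure_counting hH hK hHf hKf, ← encard_orbit_inter hH hK]
  rw [tsum_encard, tsum_encard (pairwise_disjoint_of_orbit id _ fun D x hx => hx.1)]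
  · congr 2
    ext ω
    simp only [Set.mem_iUnion]
    constructor
    · rintro ⟨C, hC⟩
      obtain ⟨D, hD⟩ := exists_mem_orbit ω
      exact ⟨D, hD, C, hC⟩
    · rintro ⟨D, _, C, hC⟩
      exact ⟨C, hC⟩
  · intro C C' hne
    refine Set.disjoint_left.2 fun ω h h' => hne ?_
    rw [← Quotient.out_eq C, ← Quotient.out_eq C']
    congr 1
    exact Subtype.ext (Eq.trans (Eq.symm h) h')

end Product

theorem productN_bot_left (K : Subgroup (F N)) : productN ⊥ K = 0 := by
  simp [productN, reducedRank_eq, freeRank_eq_zero_iff.2]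

theorem conj_bot (g : F N) : conj g (⊥ : Subgroup (F N)) = ⊥ := Subgroup.map_bot _

theorem productN_bot_right (H : Subgroup (F N)) : productN H ⊥ = 0 := by
  simp [productN, reducedRank_eq, freeRank_eq_zero_iff.2, conj_bot]

theorem eHat_zero (ν : SCurr N) : eHat 0 ν = 0 := by
  have := SCurr.eHat_smul 0 0 ν
  simpa using this

theorem vHat_zero (ν : SCurr N) : vHat 0 ν = 0 := by
  have := SCurr.vHat_smul 0 0 ν
  simpa using this

theorem cHat_zero (ν : SCurr N) : cHat 0 ν = 0 := by
  have := SCurr.cHat_smul 0 0 ν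
  simpa using this

theorem countingCurrent_bot (h : (⊥ : Subgroup (F N)).FG) : countingCurrent ⊥ h = 0 :=
  Subtype.ext countingMeasure_bot

/-- The sum of `reducedRank_add` over all double cosets. It avoids subtraction because the
finiteness of 𝒩(H, K) is itself deduced from it. Trivial subgroups are separate, having no limit
point in 𝒞_N. -/
theorem productN_add_vHat {H K : Subgroup (F N)} (hHf : H.FG) (hKf : K.FG) :
    productN H K + vHat (countingCurrent H hHf) (countingCurrent K hKf) =
      eHat (countingCurrent H hHf) (countingCurrent K hKf) +
      cHat (countingCurrent H hHf) (countingCurrent K hKf) := by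
  by_cases hH : H = ⊥
  · subst hH
    rw [productN_bot_left, countingCurrent_bot, vHat_zero, eHat_zero, cHat_zero]
  by_cases hK : K = ⊥
  · subst hK
    rw [productN_bot_right, countingCurrent_bot, SCurr.vHat_comm, SCurr.eHat_comm, SCurr.cHat_comm,
      vHat_zero, eHat_zero, cHat_zero]
  rw [vHat_counting hH hK, eHat_counting hH hK, cHat_counting hH hK, productN, ← ENNReal.tsum_add,
    ← ENNReal.tsum_add]
  refine tsum_congr fun D => ?_
  have := reducedRank_add (isConvex_pairTree hH hK) (mem_pairTree_smul hH hK)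
    (stabilizer_eq_bot_of_pairTree_eq_empty hH hK D)
    (finite_orbitVertices hH hK hHf hKf (doubleCosetRep D))
  rw [doubleCosetRep, stabilizer_pair] at this
  rw [doubleCosetRep]
  exact_mod_cast congrArg ENat.toENNReal this

/-! ### Contractible components of the fiber product -/

section Coding

variable {Ω : Type} [MulAction (F N) Ω]

/-- A labelling of the vertices of `Γ` by the elements `ω` with `1 ∈ T ω`, such that the edges with
label `a` join `ω` to `a⁻¹ω` whenever `1` and `a` belong to `T ω`. -/
structure RoseGraph.IsCoding (Γ : RoseGraph N) (T : Ω → Set (F N)) (κ : Γ.V → Ω) : Prop where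
  inj : Function.Injective κ
  one_mem : ∀ v, 1 ∈ T (κ v)
  surj : ∀ ω, 1 ∈ T ω → ∃ v, κ v = ω
  edge_inj : ∀ e e', Γ.label e = Γ.label e' → Γ.o e = Γ.o e' → e = e'
  edge_surj : ∀ ω a, 1 ∈ T ω → FreeGroup.of a ∈ T ω → ∃ e, Γ.label e = a ∧ κ (Γ.o e) = ω
  map_t : ∀ e, κ (Γ.t e) = (FreeGroup.of (Γ.label e))⁻¹ • κ (Γ.o e)

namespace RoseGraph

theorem IsCoding.fiberProduct {Ω' : Type} [MulAction (F N) Ω'] {Γ Δ : RoseGraph N}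
    {T : Ω → Set (F N)} {T' : Ω' → Set (F N)} {κ : Γ.V → Ω} {κ' : Δ.V → Ω'}
    (h : Γ.IsCoding T κ) (h' : Δ.IsCoding T' κ') :
    (Γ.fiberProduct Δ).IsCoding (fun ω : Ω × Ω' => T ω.1 ∩ T' ω.2) (Prod.map κ κ') where
  inj := h.inj.prodMap h'.inj
  one_mem v := ⟨h.one_mem v.1, h'.one_mem v.2⟩
  surj ω hω := by
    obtain ⟨v, hv⟩ := h.surj ω.1 hω.1
    obtain ⟨v', hv'⟩ := h'.surj ω.2 hω.2
    exact ⟨(v, v'), Prod.ext hv hv'⟩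
  edge_inj := by
    rintro ⟨⟨e, e'⟩, he⟩ ⟨⟨f, f'⟩, hf⟩ h1 h2
    simp only [RoseGraph.fiberProduct, Prod.mk.injEq] at h1 h2 he hf
    obtain rfl := h.edge_inj e f h1 h2.1
    obtain rfl := h'.edge_inj e' f' (he.symm.trans hf) h2.2
    rfl
  edge_surj := by
    rintro ⟨ω, ω'⟩ a h1 ha
    obtain ⟨e, he, hv⟩ := h.edge_surj ω a h1.1 ha.1
    obtain ⟨e', he', hv'⟩ := h'.edge_surj ω' a h1.2 ha.2
    exact ⟨⟨(e, e'), he.trans he'.symm⟩, he, Prod.ext hv hv'⟩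
  map_t e := by
    refine Prod.ext (h.map_t e.1.1) ((h'.map_t e.1.2).trans ?_)
    rw [← e.2]
    rfl

variable {Γ : RoseGraph N} {T : Ω → Set (F N)} {κ : Γ.V → Ω}

/-- The letter read along an oriented edge. -/
def letter (Γ : RoseGraph N) (e : Γ.E × Bool) : Letter N := (Γ.label e.1, e.2)

theorem IsCoding.map_tgt (h : Γ.IsCoding T κ) (e : Γ.E × Bool) :
    κ (Γ.tgt e) = (lt (Γ.letter e))⁻¹ • κ (Γ.src e) := by
  obtain ⟨e, b⟩ := e
  cases b
  · change κ (Γ.o e) = (lt (Γ.label e, false))⁻¹ • κ (Γ.t e)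
    rw [h.map_t, eq_inv_smul_iff]
    rfl
  · exact h.map_t e

theorem IsCoding.map_path (h : Γ.IsCoding T κ) {p : List (Γ.E × Bool)} {v w : Γ.V}
    (hp : Γ.IsPath v p w) : κ w = (FreeGroup.mk (p.map Γ.letter))⁻¹ • κ v := by
  induction p generalizing v with
  | nil =>
    obtain rfl : v = w := hp
    rw [List.map_nil, ← FreeGroup.one_eq_mk, inv_one, one_smul]
  | cons e p ih =>
    obtain ⟨rfl, hp⟩ := hp
    rw [ih hp, h.map_tgt, List.map_cons, mk_cons, mul_inv_rev, mul_smul]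

/-- Label and origin determine an edge, and so do label and end, because the code of the end
determines that of the origin. Thus a cancellation between labels is a backtracking of the path. -/
theorem IsCoding.isReduced (h : Γ.IsCoding T κ) {p : List (Γ.E × Bool)} {v w : Γ.V}
    (hp : Γ.IsPath v p w) (hr : p.IsChain (fun e e' => e' ≠ (e.1, !e.2))) :
    FreeGroup.IsReduced (p.map Γ.letter) := by
  induction p generalizing v with
  | nil => exact FreeGroup.IsReduced.nil
  | cons e p ih =>
    obtain ⟨rfl, hp⟩ := hp
    cases p with
    | nil => exact FreeGroup.IsReduced.singleton
    | cons e' p =>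
      rw [List.map_cons, List.map_cons, isReduced_cons_cons, ← List.map_cons (f := Γ.letter)]
      rw [List.isChain_cons_cons] at hr
      refine ⟨fun hc => hr.1 ?_, ih hp hr.2⟩
      have hsrc := hp.1
      obtain ⟨e, b⟩ := e
      obtain ⟨e', b'⟩ := e'
      have h1 := congrArg Prod.fst hc
      have h2 := congrArg Prod.snd hc
      change Γ.label e' = Γ.label e at h1
      change b' = !b at h2
      subst h2
      have : e' = e := by
        cases b
        · exact h.edge_inj _ _ h1 hsrc
        · refine h.edge_inj _ _ h1 (h.inj ?_)
          have := congrArg κ (show Γ.t e' = Γ.t e from hsrc)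
          rw [h.map_t, h.map_t, h1] at this
          exact smul_left_cancel _ this
      rw [this]

theorem IsCoding.exists_path (h : Γ.IsCoding T κ) (hT : ∀ ω, IsConvex (T ω))
    (hg : ∀ (g : F N) ω k, k ∈ T (g • ω) ↔ g⁻¹ * k ∈ T ω) {l : List (Letter N)}
    (hl : FreeGroup.IsReduced l) (v : Γ.V) (hm : FreeGroup.mk l ∈ T (κ v)) :
    ∃ p w, Γ.IsPath v p w ∧ p.map Γ.letter = l := by
  induction l generalizing v with
  | nil => exact ⟨[], v, rfl, rfl⟩
  | cons x l ih =>
    have hx : lt x ∈ T (κ v) := by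
      have := hT (κ v) 1 (h.one_mem v) x l hl (by rwa [one_mul])
      rwa [one_mul] at this
    obtain ⟨e, rfl, rfl⟩ : ∃ e, Γ.letter e = x ∧ Γ.src e = v := by
      obtain ⟨a, b⟩ := x
      cases b
      -- An inverse letter is read along an edge that ends at `v`; its origin is coded by the
      -- translate by `a`.
      · obtain ⟨e, he, hv⟩ := h.edge_surj ((FreeGroup.of a) • κ v) a
          (by rw [hg, mul_one]; exact hx) (by rw [hg, inv_mul_cancel]; exact h.one_mem v)
        refine ⟨(e, false), Prod.ext he rfl, h.inj ?_⟩
        change κ (Γ.t e) = _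
        rw [h.map_t, hv, he, inv_smul_smul]
      · obtain ⟨e, he, hv⟩ := h.edge_surj (κ v) a (h.one_mem v) hx
        exact ⟨(e, true), Prod.ext he rfl, h.inj hv⟩
    obtain ⟨p, w, hp, rfl⟩ := ih (hl.infix ⟨[Γ.letter e], [], by simp⟩) (Γ.tgt e) (by
      rw [h.map_tgt, hg, inv_inv, ← mk_cons]
      exact hm)
    exact ⟨e :: p, w, ⟨rfl, hp⟩, rfl⟩

/-- Reduced closed paths at `v` read exactly the elements of the stabilizer, which is the
fundamental group of the component. -/
theorem IsCoding.closed_path_iff (h : Γ.IsCoding T κ) (hT : ∀ ω, IsConvex (T ω))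
    (hg : ∀ (g : F N) ω k, k ∈ T (g • ω) ↔ g⁻¹ * k ∈ T ω) (v : Γ.V) :
    (∀ p : List (Γ.E × Bool), Γ.IsPath v p v → p.IsChain (fun e e' => e' ≠ (e.1, !e.2)) → p = []) ↔
      MulAction.stabilizer (F N) (κ v) = ⊥ := by
  constructor
  · intro hp
    rw [Subgroup.eq_bot_iff_forall]
    intro g hgs
    have hgT : FreeGroup.mk g.toWord ∈ T (κ v) := by
      rw [FreeGroup.mk_toWord, ← MulAction.mem_stabilizer_iff.1 hgs, hg, inv_mul_cancel]
      exact h.one_mem v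
    obtain ⟨p, w, hpath, hw⟩ := h.exists_path hT hg FreeGroup.isReduced_toWord v hgT
    have hwv : w = v := h.inj (by
      rw [h.map_path hpath, hw, FreeGroup.mk_toWord, inv_smul_eq_iff]
      exact (MulAction.mem_stabilizer_iff.1 hgs).symm)
    subst hwv
    have hr : FreeGroup.IsReduced (p.map Γ.letter) := hw ▸ FreeGroup.isReduced_toWord
    have := hp p hpath (by
      rw [FreeGroup.IsReduced, List.isChain_map] at hr
      refine hr.imp fun e e' hee he => ?_
      subst he
      have := hee rfl
      simp [letter] at this)
    subst this
    rw [← FreeGroup.toWord_eq_nil_iff, ← hw, List.map_nil]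
  · intro hs p hp hr
    have h1 : FreeGroup.mk (p.map Γ.letter) ∈ MulAction.stabilizer (F N) (κ v) := by
      rw [MulAction.mem_stabilizer_iff, ← eq_inv_smul_iff]
      exact h.map_path hp
    rw [hs, Subgroup.mem_bot] at h1
    have := congrArg FreeGroup.toWord h1
    rw [toWord_mk_of_isReduced (h.isReduced hp hr), FreeGroup.toWord_one, List.map_eq_nil_iff] at this
    exact this

theorem IsCoding.component_eq (h : Γ.IsCoding T κ) (hT : ∀ ω, IsConvex (T ω))
    (hg : ∀ (g : F N) ω k, k ∈ T (g • ω) ↔ g⁻¹ * k ∈ T ω) {v w : Γ.V}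
    (hvw : κ w ∈ MulAction.orbit (F N) (κ v)) :
    (Quot.mk _ v : Γ.Component) = Quot.mk _ w := by
  obtain ⟨g, hgw⟩ := hvw
  -- The component of the vertex coded by k⁻¹κ(v), as a set, so that it is defined also where no
  -- such vertex exists. It does not change along the edges of the tree `T (κ v)`.
  let f : F N → Set Γ.Component := fun k => {C | ∃ u, κ u = k⁻¹ • κ v ∧ Quot.mk _ u = C}
  have hf : ∀ k u, κ u = k⁻¹ • κ v → f k = {Quot.mk _ u} := fun k u hu => by
    ext C
    constructor
    · rintro ⟨u', hu', rfl⟩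
      rw [h.inj (hu'.trans hu.symm)]
      rfl
    · rintro rfl
      exact ⟨u, hu, rfl⟩
  have key := (hT (κ v)).const (h.one_mem v) (f := f) (fun k hk a ha => by
    obtain ⟨e, he, hev⟩ := h.edge_surj (k⁻¹ • κ v) a (one_mem_of_mem hg hk)
      (by rw [hg, inv_inv]; exact ha)
    rw [hf _ _ hev, hf _ (Γ.t e) (by rw [h.map_t, hev, he, mul_inv_rev, mul_smul])]
    congr 1
    exact (Quot.sound ⟨(e, true), rfl, rfl⟩).symm) (g := g⁻¹) (by
      rw [← mul_one g⁻¹, ← hg, show g • κ v = κ w from hgw]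
      exact h.one_mem w)
  rw [hf 1 v (by simp), hf g⁻¹ w (by rw [inv_inv]; exact hgw.symm)] at key
  exact (Set.singleton_injective key).symm

theorem IsCoding.numContractible_eq (h : Γ.IsCoding T κ) (hT : ∀ ω, IsConvex (T ω))
    (hg : ∀ (g : F N) ω k, k ∈ T (g • ω) ↔ g⁻¹ * k ∈ T ω) {𝒟 : Type*} (δ : Ω → 𝒟)
    (hδ : ∀ ω ω', δ ω = δ ω' ↔ ω' ∈ MulAction.orbit (F N) ω) :
    Γ.numContractible =
      {D | ∃ ω, δ ω = D ∧ 1 ∈ T ω ∧ MulAction.stabilizer (F N) ω = ⊥}.encard := by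
  let f : Γ.Component → 𝒟 := Quot.lift (fun v => δ (κ v)) (by
    rintro _ _ ⟨e, rfl, rfl⟩
    rw [hδ, h.map_tgt]
    exact ⟨_, rfl⟩)
  have hf : Function.Injective f := by
    rintro ⟨v⟩ ⟨w⟩ hvw
    exact h.component_eq hT hg ((hδ _ _).1 hvw)
  change {C : Γ.Component | C.Contractible}.encard = _
  rw [← hf.encard_image]
  congr 1
  ext D
  constructor
  · rintro ⟨⟨v⟩, hC, rfl⟩
    exact ⟨κ v, rfl, h.one_mem v, (h.closed_path_iff hT hg v).1 (hC v rfl)⟩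
  · rintro ⟨ω, rfl, h1, hs⟩
    obtain ⟨v, rfl⟩ := h.surj ω h1
    refine ⟨Quot.mk _ v, fun w hw => (h.closed_path_iff hT hg w).2 ?_, rfl⟩
    have e : δ (κ w) = δ (κ v) := congrArg f hw
    obtain ⟨g, hgw⟩ := (hδ _ _).1 e.symm
    rw [← hgw, MulAction.stabilizer_smul_eq_stabilizer_map_conj, hs, Subgroup.map_bot]

end RoseGraph

/-- The coset `u⁻¹H` of the vertex `Hu` of the core graph of `H`. -/
def coreCoset (H : Subgroup (F N)) : (coreGraph H).V → F N ⧸ H :=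
  Quot.lift (fun u => ((u.1⁻¹ : F N) : F N ⧸ H)) (by
    rintro u w ⟨h, hh, e⟩
    rw [QuotientGroup.eq, ← e]
    simpa using hh)

/-- Moving `u` to the identity takes the hull of Λ(H) to that of u⁻¹Λ(H), which is why the vertex Hu
is coded by the coset u⁻¹H. -/
theorem isCoding_coreGraph {H : Subgroup (F N)} (hH : H ≠ ⊥) :
    (coreGraph H).IsCoding (fun q : F N ⧸ H => conv (cosetLimit H hH q).1) (coreCoset H) := by
  have key : ∀ u k : F N, k ∈ conv (cosetLimit H hH ((u⁻¹ : F N) : F N ⧸ H)).1 ↔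
      u * k ∈ conv (limitSet H) := fun u k => by
    rw [cosetLimit_mk, mem_conv_smul, inv_inv]
    rfl
  have lift : ∀ q : F N ⧸ H, ∃ u : F N, ((u⁻¹ : F N) : F N ⧸ H) = q := fun q => by
    obtain ⟨g, rfl⟩ := QuotientGroup.mk_surjective q
    exact ⟨g⁻¹, by rw [inv_inv]⟩
  have hrel : ∀ u w : F N, ((u⁻¹ : F N) : F N ⧸ H) = ((w⁻¹ : F N) : F N ⧸ H) →
      ∃ h ∈ H, h * u = w := fun u w huw => by
    rw [QuotientGroup.eq, inv_inv] at huw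
    exact ⟨w * u⁻¹, by simpa using H.inv_mem huw, by simp⟩
  constructor
  · rintro ⟨u⟩ ⟨w⟩ huw
    exact Quot.sound (hrel u.1 w.1 huw)
  · rintro ⟨u⟩
    exact (key u.1 1).2 (by rw [mul_one]; exact u.2)
  · intro q hq
    obtain ⟨u, rfl⟩ := lift q
    rw [key, mul_one] at hq
    exact ⟨Quot.mk _ ⟨u, hq⟩, rfl⟩
  · rintro ⟨⟨⟨u, a⟩, hu⟩⟩ ⟨⟨⟨w, b⟩, hw⟩⟩ hl ho
    have hab : a = b := hl
    obtain ⟨h, hh, e⟩ := hrel u w (congrArg (coreCoset H) ho)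
    exact Quot.sound ⟨h, hh, e, hab⟩
  · intro q a h1 ha
    obtain ⟨u, rfl⟩ := lift q
    rw [key] at h1 ha
    rw [mul_one] at h1
    exact ⟨Quot.mk _ ⟨(u, a), h1, ha⟩, rfl, rfl⟩
  · rintro ⟨⟨⟨u, a⟩, hu⟩⟩
    change (((u * FreeGroup.of a)⁻¹ : F N) : F N ⧸ H) =
      (FreeGroup.of a)⁻¹ • ((u⁻¹ : F N) : F N ⧸ H)
    rw [mul_inv_rev, smul_coset]

end Coding

theorem isEmpty_coreGraph_bot : IsEmpty (coreGraph (⊥ : Subgroup (F N))).V := by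
  refine ⟨?_⟩
  rintro ⟨⟨u, ξ, ⟨w, hw, hc⟩, _⟩⟩
  obtain ⟨k, hk⟩ := (hc 0).exists
  rw [Subgroup.mem_bot.1 (hw k)] at hk
  simp at hk

theorem RoseGraph.numContractible_of_isEmpty {Γ : RoseGraph N} (h : IsEmpty Γ.V) :
    Γ.numContractible = 0 := by
  rw [RoseGraph.numContractible, ENat.card_eq_zero_iff_empty]
  refine ⟨?_⟩
  rintro ⟨⟨v⟩, _⟩
  exact h.elim v

/-- Both sides count the orbits with non-empty tree and trivial stabilizer; by
`finite_iff_stabilizer_eq_bot` these are the orbits with finite non-empty tree. -/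
theorem cHat_eq_numContractible {H K : Subgroup (F N)} (hHf : H.FG) (hKf : K.FG) :
    cHat (countingCurrent H hHf) (countingCurrent K hKf) =
      (((coreGraph H).fiberProduct (coreGraph K)).numContractible : ℝ≥0∞) := by
  by_cases hH : H = ⊥
  · subst hH
    rw [RoseGraph.numContractible_of_isEmpty ⟨fun v => isEmpty_coreGraph_bot.elim (Prod.fst v)⟩,
      countingCurrent_bot, cHat_zero, ENat.toENNReal_zero]
  by_cases hK : K = ⊥
  · subst hK
    rw [RoseGraph.numContractible_of_isEmpty ⟨fun v => isEmpty_coreGraph_bot.elim (Prod.snd v)⟩,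
      countingCurrent_bot, SCurr.cHat_comm, cHat_zero, ENat.toENNReal_zero]
  choose δ hδ using exists_mem_orbit (H := H) (K := K)
  have hδ' : ∀ ω D, δ ω = D ↔ ω ∈ MulAction.orbit (F N) (doubleCosetRep D) := fun ω D =>
    ⟨fun h => h ▸ hδ ω, fun h => orbit_unique (hδ ω) h⟩
  rw [((isCoding_coreGraph hH).fiberProduct (isCoding_coreGraph hK)).numContractible_eq
    (isConvex_pairTree hH hK) (mem_pairTree_smul hH hK) δ (fun ω ω' => by
      rw [eq_comm, hδ', ← MulAction.orbit_eq_iff.2 (hδ ω)]), cHat_counting hH hK, ← ENNReal.tsum_set_one,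
      tsum_subtype _ (fun _ => (1 : ℝ≥0∞))]
  refine tsum_congr fun D => ?_
  have hiff : ((pairTree hH hK (doubleCosetRep D)).Nonempty ∧
      (pairTree hH hK (doubleCosetRep D)).Finite) ↔
      ∃ ω, δ ω = D ∧ 1 ∈ pairTree hH hK ω ∧ MulAction.stabilizer (F N) ω = ⊥ := by
    have hg := mem_pairTree_smul hH hK
    constructor
    · rintro ⟨hn, hf⟩
      have hs := (finite_iff_stabilizer_eq_bot hg hn (finite_orbitVertices hH hK hHf hKf _)).1 hf
      obtain ⟨g, hgT⟩ := hn
      refine ⟨g⁻¹ • doubleCosetRep D, (hδ' _ _).2 ⟨_, rfl⟩, one_mem_of_mem hg hgT, ?_⟩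
      rw [MulAction.stabilizer_smul_eq_stabilizer_map_conj, hs, Subgroup.map_bot]
    · rintro ⟨ω, hω, h1, hs⟩
      obtain ⟨g, hgω⟩ := (hδ' _ _).1 hω
      have e : doubleCosetRep D = g⁻¹ • ω := by rw [← hgω, inv_smul_smul]
      have hs' : MulAction.stabilizer (F N) (doubleCosetRep D) = ⊥ := by
        rw [e, MulAction.stabilizer_smul_eq_stabilizer_map_conj, hs, Subgroup.map_bot]
      have hn : (pairTree hH hK (doubleCosetRep D)).Nonempty :=
        ⟨g⁻¹, by rw [e, hg, inv_inv, mul_inv_cancel]; exact h1⟩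
      exact ⟨hn, (finite_iff_stabilizer_eq_bot hg hn (finite_orbitVertices hH hK hHf hKf _)).2 hs'⟩
  rw [isFiniteTree]
  by_cases hD : (pairTree hH hK (doubleCosetRep D)).Nonempty ∧
      (pairTree hH hK (doubleCosetRep D)).Finite
  · rw [if_pos hD, ENat.toENNReal_one]
    refine (Set.indicator_of_mem (f := fun _ => (1 : ℝ≥0∞)) ?_).symm
    exact hiff.1 hD
  · rw [if_neg hD, ENat.toENNReal_zero]
    refine (Set.indicator_of_notMem (f := fun _ => (1 : ℝ≥0∞)) ?_).symm
    exact fun h => hD (hiff.2 h)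

/-! ### Finite graphs glued from local patterns and their fundamental groups -/

section Gluing

variable {V : Type} [MulAction (F N) V]

/-- A compatible family of subtrees of radius `R`, indexed by the vertices of a graph whose edges
with label `a` join `v` to `a⁻¹v` whenever `a ∈ P v`. -/
structure IsGluing (R : ℕ) (P : V → Set (F N)) : Prop where
  one_le : 1 ≤ R
  head_mem : ∀ v x l, FreeGroup.IsReduced (x :: l) → FreeGroup.mk (x :: l) ∈ P v → lt x ∈ P v
  one_mem : ∀ v, 1 ∈ P v
  subset_ball : ∀ v, P v ⊆ ball N R
  nontrivial : ∀ v, ∃ x y, x ≠ y ∧ lt x ∈ P v ∧ lt y ∈ P v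
  glue : ∀ v x, lt x ∈ P v → ∀ h ∈ ball N R, (lt x)⁻¹ * h ∈ ball N R →
    (h ∈ P v ↔ (lt x)⁻¹ * h ∈ P ((lt x)⁻¹ • v))

/-- The word `w` can be read along a path starting at `v`. -/
def Reads (P : V → Set (F N)) : V → List (Letter N) → Prop
  | _, [] => True
  | v, x :: w => lt x ∈ P v ∧ Reads P ((lt x)⁻¹ • v) w

/-- The universal covering tree based at `v`. -/
def coverTree (P : V → Set (F N)) (v : V) : Set (F N) := {g | Reads P v g.toWord}

variable {R : ℕ} {P : V → Set (F N)}

theorem reads_append {v : V} {l l' : List (Letter N)} :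
    Reads P v (l ++ l') ↔ Reads P v l ∧ Reads P ((FreeGroup.mk l)⁻¹ • v) l' := by
  induction l generalizing v with
  | nil => simp [Reads, ← FreeGroup.one_eq_mk]
  | cons x l ih =>
    rw [List.cons_append, Reads, Reads, ih, mk_cons, mul_inv_rev, mul_smul, and_assoc]

theorem Reads.step {v : V} {l l' : List (Letter N)} (h : FreeGroup.Red.Step l l')
    (hl : Reads P v l) : Reads P v l' := by
  obtain @⟨l₁, l₂, a, b⟩ := h
  rw [reads_append] at hl ⊢
  refine ⟨hl.1, ?_⟩
  have := hl.2.2.2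
  change Reads P ((lt (linv (a, b)))⁻¹ • (lt (a, b))⁻¹ • _) l₂ at this
  rwa [lt_linv, inv_inv, smul_inv_smul] at this

theorem Reads.red {v : V} {l l' : List (Letter N)} (h : FreeGroup.Red l l')
    (hl : Reads P v l) : Reads P v l' := by
  induction h with
  | refl => exact hl
  | tail _ hs ih => exact ih.step hs

theorem Reads.mk_mem {v : V} {l : List (Letter N)} (hl : Reads P v l) :
    FreeGroup.mk l ∈ coverTree P v := by
  rw [coverTree, Set.mem_ofPred_eq, FreeGroup.toWord_mk]
  exact hl.red FreeGroup.reduce.red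

theorem mk_mem_coverTree {v : V} {l : List (Letter N)} (hl : FreeGroup.IsReduced l) :
    FreeGroup.mk l ∈ coverTree P v ↔ Reads P v l := by
  rw [coverTree, Set.mem_ofPred_eq, toWord_mk_of_isReduced hl]

theorem one_mem_coverTree (v : V) : 1 ∈ coverTree P v := by
  rw [coverTree, Set.mem_ofPred_eq, FreeGroup.toWord_one]
  trivial

theorem lt_mem_coverTree {v : V} {x : Letter N} : lt x ∈ coverTree P v ↔ lt x ∈ P v := by
  rw [lt, mk_mem_coverTree FreeGroup.IsReduced.singleton]
  simp [Reads, lt]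

theorem mul_mem_coverTree {v : V} {g h : F N} (hg : g ∈ coverTree P v)
    (hh : h ∈ coverTree P (g⁻¹ • v)) : g * h ∈ coverTree P v := by
  have : Reads P v (g.toWord ++ h.toWord) := by
    rw [reads_append, FreeGroup.mk_toWord]
    exact ⟨hg, hh⟩
  have := this.mk_mem
  rwa [mk_append, FreeGroup.mk_toWord, FreeGroup.mk_toWord] at this

namespace IsGluing

theorem exists_ne (hP : IsGluing R P) (v : V) (x : Letter N) : ∃ y, y ≠ x ∧ lt y ∈ P v := by
  obtain ⟨y, z, hyz, hy, hz⟩ := hP.nontrivial v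
  by_cases h : y = x
  · exact ⟨z, fun e => hyz (h.trans e.symm), hz⟩
  · exact ⟨y, h, hy⟩

theorem inv_lt_mem (hP : IsGluing R P) {v : V} {x : Letter N} (h : lt x ∈ P v) :
    lt (linv x) ∈ P ((lt x)⁻¹ • v) := by
  have := (hP.glue v x h 1 (by simp [ball]) (by
    rw [mul_one, ball, Set.mem_ofPred_eq, FreeGroup.norm_inv_eq, norm_lt]
    exact hP.one_le)).1 (hP.one_mem v)
  rwa [mul_one, ← lt_linv] at this

theorem reads_invRev (hP : IsGluing R P) {v : V} {l : List (Letter N)} (h : Reads P v l) :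
    Reads P ((FreeGroup.mk l)⁻¹ • v) (FreeGroup.invRev l) := by
  induction l generalizing v with
  | nil => trivial
  | cons x l ih =>
    have e : FreeGroup.invRev (x :: l) = FreeGroup.invRev l ++ [linv x] := by
      simp [FreeGroup.invRev, linv]
    rw [e, reads_append, mk_cons, mul_inv_rev, mul_smul]
    refine ⟨ih h.2, ?_, trivial⟩
    rw [← FreeGroup.inv_mk, inv_inv, smul_inv_smul]
    exact hP.inv_lt_mem h.1

theorem inv_mem (hP : IsGluing R P) {v : V} {g : F N} (h : g ∈ coverTree P v) :
    g⁻¹ ∈ coverTree P (g⁻¹ • v) := by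
  have := (hP.reads_invRev h).mk_mem
  rwa [← FreeGroup.inv_mk, FreeGroup.mk_toWord] at this

theorem mem_smul_iff (hP : IsGluing R P) {v : V} {g h : F N} (hg : g ∈ coverTree P v) :
    h ∈ coverTree P (g⁻¹ • v) ↔ g * h ∈ coverTree P v := by
  refine ⟨mul_mem_coverTree hg, fun hh => ?_⟩
  rw [← inv_mul_cancel_left g h]
  refine mul_mem_coverTree (hP.inv_mem hg) ?_
  rwa [inv_inv, smul_inv_smul]

/-- The pattern at `v` is really the ball in the covering tree: a word is read letter by letter, and
at each step the gluing condition replaces membership in `P v` by membership of the shorter word in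
the pattern at the next vertex. -/
theorem coverTree_inter_ball (hP : IsGluing R P) (v : V) : coverTree P v ∩ ball N R = P v := by
  have key : ∀ (l : List (Letter N)) (v : V), FreeGroup.IsReduced l → l.length ≤ R →
      (Reads P v l ↔ FreeGroup.mk l ∈ P v) := by
    intro l
    induction l with
    | nil =>
      intro v _ _
      rw [← FreeGroup.one_eq_mk]
      exact ⟨fun _ => hP.one_mem v, fun _ => trivial⟩
    | cons x l ih =>
      intro v hr hl
      have hr' : FreeGroup.IsReduced l := hr.infix ⟨[x], [], by simp⟩
      rw [List.length_cons] at hl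
      rw [Reads, ih _ hr' (by omega)]
      have hmem : FreeGroup.mk (x :: l) ∈ ball N R := by
        rw [ball, Set.mem_ofPred_eq, FreeGroup.norm, toWord_mk_of_isReduced hr]
        exact hl
      have hmem' : (lt x)⁻¹ * FreeGroup.mk (x :: l) ∈ ball N R := by
        rw [mk_cons, inv_mul_cancel_left, ball, Set.mem_ofPred_eq, FreeGroup.norm,
          toWord_mk_of_isReduced hr']
        omega
      constructor
      · rintro ⟨h1, h2⟩
        rw [hP.glue v x h1 _ hmem hmem', mk_cons, inv_mul_cancel_left]
        exact h2
      · intro h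
        have h1 : lt x ∈ P v := hP.head_mem v x l hr h
        rw [hP.glue v x h1 _ hmem hmem', mk_cons, inv_mul_cancel_left] at h
        exact ⟨h1, h⟩
  ext g
  constructor
  · rintro ⟨h, hg⟩
    rw [← FreeGroup.mk_toWord (x := g)]
    exact (key _ v FreeGroup.isReduced_toWord hg).1 h
  · intro h
    refine ⟨(key _ v FreeGroup.isReduced_toWord (hP.subset_ball v h)).2 ?_, hP.subset_ball v h⟩
    rwa [FreeGroup.mk_toWord]

/-- The fundamental group of the graph, based at `v`. -/
def group (hP : IsGluing R P) (v : V) : Subgroup (F N) where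
  carrier := {g | g ∈ coverTree P v ∧ g⁻¹ • v = v}
  one_mem' := ⟨one_mem_coverTree v, by simp⟩
  mul_mem' {g h} hg hh := by
    refine ⟨mul_mem_coverTree hg.1 (by rw [hg.2]; exact hh.1), ?_⟩
    rw [mul_inv_rev, mul_smul, hg.2, hh.2]
  inv_mem' {g} hg := by
    refine ⟨by simpa only [hg.2] using hP.inv_mem hg.1, ?_⟩
    rw [inv_inv, ← eq_inv_smul_iff, hg.2]

theorem mem_group (hP : IsGluing R P) {v : V} {g : F N} :
    g ∈ hP.group v ↔ g ∈ coverTree P v ∧ g⁻¹ • v = v := Iff.rfl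

theorem mul_inv_mem_group (hP : IsGluing R P) {v : V} {g h : F N} (hg : g ∈ coverTree P v)
    (hh : h ∈ coverTree P v) (e : g⁻¹ • v = h⁻¹ • v) : g * h⁻¹ ∈ hP.group v := by
  refine ⟨mul_mem_coverTree hg (by rw [e]; exact hP.inv_mem hh), ?_⟩
  rw [mul_inv_rev, inv_inv, mul_smul, e, smul_inv_smul]

theorem group_smul (hP : IsGluing R P) {v : V} {g : F N} (hg : g ∈ coverTree P v) :
    hP.group (g⁻¹ • v) = conj g⁻¹ (hP.group v) := by
  ext h
  rw [mem_conj, inv_inv, mem_group, mem_group, hP.mem_smul_iff hg]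
  have e : (g * h * g⁻¹)⁻¹ • v = v ↔ h⁻¹ • g⁻¹ • v = g⁻¹ • v := by
    rw [mul_inv_rev, mul_inv_rev, inv_inv, mul_smul, mul_smul, ← eq_inv_smul_iff]
  rw [e]
  constructor
  · rintro ⟨h1, h2⟩
    refine ⟨mul_mem_coverTree h1 ?_, h2⟩
    rw [mul_inv_rev, mul_smul, h2]
    exact hP.inv_mem hg
  · rintro ⟨h1, h2⟩
    refine ⟨?_, h2⟩
    have := mul_mem_coverTree (h := g) h1 (by rwa [e.2 h2])
    rwa [inv_mul_cancel_right] at this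

/-- Schreier generators: with a chosen path `u w` to each vertex of the component, every closed path
is a telescoping product of one element per edge passed. -/
theorem fg_group [Finite V] (hP : IsGluing R P) (v : V) : (hP.group v).FG := by
  classical
  have hu : ∀ w : V, ∃ u : F N, (∃ g ∈ coverTree P v, w = g⁻¹ • v) →
      u ∈ coverTree P v ∧ u⁻¹ • v = w := fun w => by
    by_cases h : ∃ g ∈ coverTree P v, w = g⁻¹ • v
    · obtain ⟨g, hg, e⟩ := h
      exact ⟨g, fun _ => ⟨hg, e.symm⟩⟩
    · exact ⟨1, fun h' => absurd h' h⟩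
  choose u hu using hu
  -- The chosen `u v` is an element of the group but need not be trivial; including it closes the
  -- telescoping product at both ends.
  let s : Set (F N) := insert (u v) {k | k ∈ hP.group v ∧
    k ∈ Set.range fun p : V × Letter N => u p.1 * lt p.2 * (u ((lt p.2)⁻¹ • p.1))⁻¹}
  have huv := hu v ⟨1, one_mem_coverTree v, by simp⟩
  have key : ∀ l : List (Letter N), ∀ g ∈ coverTree P v, Reads P (g⁻¹ • v) l →
      g * (u (g⁻¹ • v))⁻¹ ∈ Subgroup.closure s →
      g * FreeGroup.mk l * (u ((g * FreeGroup.mk l)⁻¹ • v))⁻¹ ∈ Subgroup.closure s := by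
    intro l
    induction l with
    | nil =>
      intro g _ _ h
      rwa [← FreeGroup.one_eq_mk, mul_one]
    | cons x l ih =>
      intro g hg hl h
      have hgx : g * lt x ∈ coverTree P v := (hP.mem_smul_iff hg).1 (lt_mem_coverTree.2 hl.1)
      have e : (g * lt x)⁻¹ • v = (lt x)⁻¹ • g⁻¹ • v := by rw [mul_inv_rev, mul_smul]
      rw [mk_cons, ← mul_assoc]
      refine ih (g * lt x) hgx (by rw [e]; exact hl.2) ?_
      have h1 := hu (g⁻¹ • v) ⟨g, hg, rfl⟩
      have h2 := hu ((g * lt x)⁻¹ • v) ⟨_, hgx, rfl⟩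
      have hmem : u (g⁻¹ • v) * lt x * (u ((g * lt x)⁻¹ • v))⁻¹ ∈ Subgroup.closure s := by
        refine Subgroup.subset_closure (Or.inr ⟨?_, (g⁻¹ • v, x), ?_⟩)
        · refine hP.mul_inv_mem_group ((hP.mem_smul_iff h1.1).1 ?_) h2.1 ?_
          · rw [h1.2]
            exact lt_mem_coverTree.2 hl.1
          · rw [h2.2, e, mul_inv_rev, mul_smul, h1.2]
        · simp only [e]
      have := mul_mem h hmem
      rwa [mul_assoc (u _), mul_assoc, inv_mul_cancel_left, ← mul_assoc] at this
  rw [Subgroup.fg_iff]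
  refine ⟨s, le_antisymm ?_ ?_, ?_⟩
  · rw [Subgroup.closure_le]
    rintro k (rfl | hk)
    · exact huv
    · exact hk.1
  · intro g hg
    have h1 : (1 : F N) * (u ((1 : F N)⁻¹ • v))⁻¹ ∈ Subgroup.closure s := by
      rw [one_mul, inv_one, one_smul]
      exact (Subgroup.closure s).inv_mem (Subgroup.subset_closure (Or.inl rfl))
    have := key g.toWord 1 (one_mem_coverTree v) (by rw [inv_one, one_smul]; exact hg.1) h1
    rw [one_mul, FreeGroup.mk_toWord, hg.2] at this
    have := mul_mem this (Subgroup.subset_closure (show u v ∈ s from Or.inl rfl))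
    rwa [inv_mul_cancel_right] at this
  · exact Set.Finite.insert _ ((Set.finite_range _).subset fun k hk => hk.2)

theorem pre_mem (hP : IsGluing R P) {v : V} {ξ : Boundary N} (h : ξ ∈ limitSet (hP.group v))
    (n : ℕ) : ξ.pre n ∈ coverTree P v := by
  obtain ⟨g, hg, hgn⟩ := mem_limitSet_iff.1 h n
  have e : ξ.pre n = FreeGroup.mk (g.toWord.take n) := by
    rw [Boundary.pre]
    congr 1
    refine List.ext_getElem? fun i => ?_
    by_cases hi : i < n
    · rw [List.getElem?_take_of_lt hi, hgn i hi]
      simp [hi]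
    · simp [hi]
  rw [e]
  have := (reads_append (l := g.toWord.take n) (l' := g.toWord.drop n)).1 (by
    rw [List.take_append_drop]
    exact hg.1)
  exact this.1.mk_mem

/-- As there are finitely many vertices, each vertex of the ray is within bounded distance of an
element of the group. -/
theorem mem_limitSet_group [Finite V] (hP : IsGluing R P) {v : V} {ξ : Boundary N}
    (h : ∀ n, ξ.pre n ∈ coverTree P v) : ξ ∈ limitSet (hP.group v) := by
  classical
  have hu : ∀ w : V, ∃ u : F N, (∃ g ∈ coverTree P v, w = g⁻¹ • v) →
      u ∈ coverTree P v ∧ u⁻¹ • v = w := fun w => by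
    by_cases h : ∃ g ∈ coverTree P v, w = g⁻¹ • v
    · obtain ⟨g, hg, e⟩ := h
      exact ⟨g, fun _ => ⟨hg, e.symm⟩⟩
    · exact ⟨1, fun h' => absurd h' h⟩
  choose u hu using hu
  obtain ⟨L, hL⟩ := (Set.finite_range fun w => (u w).norm).bddAbove
  refine ⟨fun n => ξ.pre n * (u ((ξ.pre n)⁻¹ • v))⁻¹, fun n => ?_,
    ξ.pre_convergesTo.of_norm_le (L := L) fun n => ?_⟩
  · have := hu _ ⟨_, h n, rfl⟩
    exact hP.mul_inv_mem_group (h n) this.1 this.2.symm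
  · rw [inv_mul_cancel_left, FreeGroup.norm_inv_eq]
    exact hL ⟨_, rfl⟩

/-- Every pattern contains two letters, so a path can always be continued without backtracking. -/
theorem exists_end (hP : IsGluing R P) {v : V} {x : Letter N} (hx : lt x ∈ P v) :
    ∃ ξ : Boundary N, ξ.1 0 = x ∧ ∀ n, ξ.pre n ∈ coverTree P v := by
  choose y hy hyP using hP.exists_ne
  let s : ℕ → V × Letter N := fun n =>
    Nat.rec (v, x) (fun _ p => ((lt p.2)⁻¹ • p.1, y ((lt p.2)⁻¹ • p.1) (linv p.2))) n
  have hs : ∀ n, lt (s n).2 ∈ P (s n).1 := by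
    intro n
    cases n with
    | zero => exact hx
    | succ n => exact hyP _ _
  let ξ : Boundary N := ⟨fun n => (s n).2, fun n => ne_linv_iff.1 (hy _ _)⟩
  refine ⟨ξ, rfl, fun n => ?_⟩
  have : ξ.pre n ∈ coverTree P v ∧ (ξ.pre n)⁻¹ • v = (s n).1 := by
    induction n with
    | zero =>
      rw [ξ.pre_zero, inv_one, one_smul]
      exact ⟨one_mem_coverTree v, rfl⟩
    | succ n ih =>
      rw [ξ.pre_succ, mul_inv_rev, mul_smul, ih.2]
      refine ⟨mul_mem_coverTree ih.1 ?_, rfl⟩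
      rw [ih.2]
      exact lt_mem_coverTree.2 (hs n)
  exact this.1

theorem one_mem_conv_limitSet [Finite V] (hP : IsGluing R P) (v : V) :
    1 ∈ conv (limitSet (hP.group v)) := by
  obtain ⟨x, y, hxy, hx, hy⟩ := hP.nontrivial v
  obtain ⟨ξ, rfl, hξ⟩ := hP.exists_end hx
  obtain ⟨ζ, rfl, hζ⟩ := hP.exists_end hy
  refine ⟨ξ, hP.mem_limitSet_group hξ, ζ, hP.mem_limitSet_group hζ, ?_⟩
  rw [inv_one, one_smul, one_smul]
  exact hxy

/-- A hull vertex other than the identity is a prefix of a limit point, so it lies in the tree.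
Conversely, changing the base vertex moves a vertex of the tree to the identity, which lies in the
hull because two rays leave it in different directions. -/
theorem conv_limitSet_group [Finite V] (hP : IsGluing R P) (v : V) :
    conv (limitSet (hP.group v)) = coverTree P v := by
  ext g
  constructor
  · rintro ⟨ξ, hξ, ζ, hζ, hne⟩
    rcases hw : g.toWord with _ | ⟨x, w⟩
    · rw [FreeGroup.toWord_eq_nil_iff.1 hw]
      exact one_mem_coverTree v
    · have hr : FreeGroup.IsReduced (x :: w) := hw ▸ FreeGroup.isReduced_toWord
      have e : g = FreeGroup.mk (x :: w) := by rw [← hw, FreeGroup.mk_toWord]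
      rw [e] at hne ⊢
      by_cases h : dir (FreeGroup.mk (x :: w)) ξ = linv ((x :: w).getLast (by simp))
      · rw [← pre_eq_of_dir_ne (ξ := ζ) hr fun h' => hne (h.trans h'.symm)]
        exact hP.pre_mem hζ _
      · rw [← pre_eq_of_dir_ne hr h]
        exact hP.pre_mem hξ _
  · intro hg
    have := hP.one_mem_conv_limitSet (g⁻¹ • v)
    rw [hP.group_smul hg, limitSet_conj, mem_conv_image, inv_inv, mul_one] at this
    exact this

theorem group_ne_bot [Finite V] (hP : IsGluing R P) (v : V) : hP.group v ≠ ⊥ := by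
  intro h
  obtain ⟨ξ, ⟨w, hw, hc⟩, _⟩ := hP.one_mem_conv_limitSet v
  obtain ⟨k, hk⟩ := (hc 0).exists
  have := hw k
  rw [h, Subgroup.mem_bot] at this
  rw [this] at hk
  simp at hk

theorem conv_cosetLimit [Finite V] (hP : IsGluing R P) {v : V} {g : F N} (hg : g ∈ coverTree P v) :
    conv (cosetLimit (hP.group v) (hP.group_ne_bot v) ((g⁻¹ : F N) : F N ⧸ hP.group v)).1 =
      coverTree P (g⁻¹ • v) := by
  rw [cosetLimit_mk, ← hP.conv_limitSet_group, hP.group_smul hg, limitSet_conj]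
  rfl

/-- The vertices of the component of `v`. -/
def component (P : V → Set (F N)) (v : V) : Set V := {w | ∃ g ∈ coverTree P v, g⁻¹ • v = w}

theorem component_equivalence (hP : IsGluing R P) : Equivalence fun v w => w ∈ component P v where
  refl v := ⟨1, one_mem_coverTree v, by simp⟩
  symm := by
    rintro v _ ⟨g, hg, rfl⟩
    exact ⟨g⁻¹, hP.inv_mem hg, by simp⟩
  trans := by
    rintro v _ _ ⟨g, hg, rfl⟩ ⟨h, hh, rfl⟩
    exact ⟨g * h, mul_mem_coverTree hg hh, by rw [mul_inv_rev, mul_smul]⟩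

/-- The translates of the limit set whose hull contains the identity correspond to the vertices of
the component, and the hull of such a translate has the pattern `P w` in the ball. -/
theorem countingMeasure_typeClass [Finite V] (hP : IsGluing R P) (v : V) (Q : Set (F N)) :
    countingMeasure (hP.group v) (typeClass R Q) = {w | w ∈ component P v ∧ P w = Q}.encard := by
  rw [countingMeasure_apply (hP.fg_group v) (hP.group_ne_bot v)
    (isClopen_typeClass R Q).1.measurableSet]
  congr 1
  have hmem : ∀ q : F N ⧸ hP.group v,
      1 ∈ conv (cosetLimit (hP.group v) (hP.group_ne_bot v) q).1 →
      ∃ g ∈ coverTree P v, ((g⁻¹ : F N) : F N ⧸ hP.group v) = q := by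
    intro q hq
    obtain ⟨g, rfl⟩ := QuotientGroup.mk_surjective q
    rw [cosetLimit_mk, mem_conv_smul, mul_one] at hq
    refine ⟨g⁻¹, ?_, by rw [inv_inv]⟩
    rw [← hP.conv_limitSet_group]
    exact hq
  have hlift : ∀ g h : F N, ((g⁻¹ : F N) : F N ⧸ hP.group v) = ((h⁻¹ : F N) : F N ⧸ hP.group v) →
      g⁻¹ • v = h⁻¹ • v := by
    intro g h e
    rw [QuotientGroup.eq, inv_inv] at e
    have := e.2
    rw [mul_inv_rev, inv_inv, mul_smul, ← eq_inv_smul_iff] at this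
    exact this
  let f : F N ⧸ hP.group v → V := fun q => (q.out)⁻¹⁻¹ • v
  have hf : ∀ g : F N, f ((g⁻¹ : F N) : F N ⧸ hP.group v) = g⁻¹ • v := by
    intro g
    refine hlift _ _ ?_
    rw [inv_inv]
    exact QuotientGroup.out_eq' _
  have hinj : Set.InjOn f {q | cosetLimit (hP.group v) (hP.group_ne_bot v) q ∈ typeClass R Q} := by
    intro q hq q' hq' e
    obtain ⟨g, hg, rfl⟩ := hmem q hq.1
    obtain ⟨h, hh, rfl⟩ := hmem q' hq'.1
    rw [hf, hf] at e
    rw [QuotientGroup.eq, inv_inv]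
    exact hP.mul_inv_mem_group hg hh e
  rw [← hinj.encard_image]
  congr 1
  ext w
  constructor
  · rintro ⟨q, hq, rfl⟩
    obtain ⟨g, hg, rfl⟩ := hmem q hq.1
    rw [hf]
    refine ⟨⟨g, hg, rfl⟩, ?_⟩
    rw [← hP.coverTree_inter_ball, ← hP.conv_cosetLimit hg]
    exact hq.2
  · rintro ⟨⟨g, hg, rfl⟩, hQ⟩
    refine ⟨((g⁻¹ : F N) : F N ⧸ hP.group v), ⟨?_, ?_⟩, hf g⟩
    · rw [hP.conv_cosetLimit hg]
      exact one_mem_coverTree _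
    · rw [hP.conv_cosetLimit hg, hP.coverTree_inter_ball, hQ]

/-- A finite gluing is realized by a sum of counting currents. -/
theorem exists_current [Finite V] (hP : IsGluing R P) :
    ∃ ν ∈ Submodule.span ℝ≥0 {η : SCurr N | ∃ (H : Subgroup (F N)) (hH : H.FG),
      η = countingCurrent H hH}, ∀ Q, ν.1 (typeClass R Q) = {v | P v = Q}.encard := by
  let st : Setoid V := ⟨_, hP.component_equivalence⟩
  have := Fintype.ofFinite (Quotient st)
  refine ⟨∑ c : Quotient st, countingCurrent (hP.group c.out) (hP.fg_group _),
    Submodule.sum_mem _ fun c _ => Submodule.subset_span ⟨_, _, rfl⟩, fun Q => ?_⟩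
  rw [Submodule.coe_sum, Measure.coe_finsetSum, Finset.sum_apply]
  have hc : ∀ c : Quotient st, (countingCurrent (hP.group c.out) (hP.fg_group c.out)).1
      (typeClass R Q) = ({w | Quotient.mk st w = c ∧ P w = Q}.encard : ℝ≥0∞) := by
    intro c
    refine (hP.countingMeasure_typeClass _ Q).trans ?_
    congr 2
    ext w
    have : w ∈ component P c.out ↔ Quotient.mk st w = c := by
      rw [← Quotient.out_eq c, eq_comm, Quotient.eq, Quotient.out_eq]
      rfl
    rw [Set.mem_ofPred_eq, this]
    rfl
  rw [Finset.sum_congr rfl fun c _ => hc c, ← tsum_fintype (L := .unconditional _), tsum_encard]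
  · congr 2
    ext w
    simp
  · intro c c' hne
    exact Set.disjoint_left.2 fun w h h' => hne (h.1.symm.trans h'.1)

end IsGluing

end Gluing

/-! ### Density of the span of the counting currents -/

/-- A finite family of non-negative reals is approximated by rationals with a common denominator,
preserving all equalities between partial sums. -/
theorem exists_nat_approx {ι : Type*} [Fintype ι] {w : ι → ℝ} (hw : ∀ i, 0 ≤ w i) {δ : ℝ}
    (hδ : 0 < δ) : ∃ (M : ℕ) (p : ι → ℕ), 0 < M ∧ (∀ i, |(p i : ℝ) / M - w i| ≤ δ) ∧
      (∀ i, w i = 0 → p i = 0) ∧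
      ∀ A B : Finset ι, ∑ i ∈ A, w i = ∑ i ∈ B, w i → ∑ i ∈ A, p i = ∑ i ∈ B, p i := by
  -- An error below every positive weight keeps the perturbed weights non-negative.
  have hmin : ∀ᶠ d in 𝓝[>] (0 : ℝ), ∀ i, w i ≠ 0 → d ≤ w i := by
    refine eventually_all.2 fun i => ?_
    by_cases h : w i = 0
    · simp [h]
    · have : ∀ᶠ d in 𝓝[>] (0 : ℝ), d < w i :=
        nhdsWithin_le_nhds (gt_mem_nhds ((hw i).lt_of_ne' h))
      exact this.mono fun d hd _ => hd.le
  have hle : ∀ᶠ d in 𝓝[>] (0 : ℝ), d < δ := nhdsWithin_le_nhds (gt_mem_nhds hδ)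
  obtain ⟨d, ⟨hd1, hd2⟩, hd0⟩ := ((hmin.and hle).and self_mem_nhdsWithin).exists
  have hd0 : 0 < d := hd0
  -- The perturbation is a ℚ-linear map from the span of the weights to ℚ, close to the inclusion on
  -- the weights. Linearity preserves all rational relations, in particular equal partial sums and
  -- zeros.
  let L := Submodule.span ℚ (Set.range w)
  have : Module.Finite ℚ L := Module.Finite.span_of_finite ℚ (Set.finite_range w)
  let b := Module.finBasis ℚ L
  let u : ι → L := fun i => ⟨w i, Submodule.subset_span ⟨i, rfl⟩⟩
  let C : ℝ := ∑ i, ∑ j, |(b.repr (u i) j : ℝ)|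
  have hC : 0 ≤ C := Finset.sum_nonneg fun i _ => Finset.sum_nonneg fun j _ => abs_nonneg _
  have hε : 0 < d / (C + 1) := by positivity
  have hq : ∀ j, ∃ q : ℚ, |(b j : ℝ) - q| < d / (C + 1) := fun j => exists_rat_near _ hε
  choose q hq using hq
  let φ : L →ₗ[ℚ] ℚ := b.constr ℚ q
  have hφ : ∀ i, |(φ (u i) : ℝ) - w i| ≤ d := by
    intro i
    have h1 : φ (u i) = ∑ j, b.repr (u i) j * q j := by
      simp only [φ, Module.Basis.constr_apply_fintype, Module.Basis.equivFun_apply, smul_eq_mul]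
    have h2 : w i = ∑ j, (b.repr (u i) j : ℝ) * (b j : ℝ) := by
      have := congrArg (Subtype.val) (b.sum_repr (u i))
      rw [Submodule.coe_sum] at this
      refine this.symm.trans (Finset.sum_congr rfl fun j _ => ?_)
      rw [Submodule.coe_smul, Rat.smul_def]
    rw [h1, h2]
    push_cast
    rw [← Finset.sum_sub_distrib]
    calc |∑ j, ((b.repr (u i) j : ℝ) * q j - (b.repr (u i) j : ℝ) * b j)|
        ≤ ∑ j, |(b.repr (u i) j : ℝ)| * (d / (C + 1)) := by
          refine (Finset.abs_sum_le_sum_abs _ _).trans (Finset.sum_le_sum fun j _ => ?_)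
          rw [← mul_sub, abs_mul, abs_sub_comm]
          exact mul_le_mul_of_nonneg_left (hq j).le (abs_nonneg _)
      _ ≤ C * (d / (C + 1)) := by
          rw [← Finset.sum_mul]
          refine mul_le_mul_of_nonneg_right ?_ hε.le
          exact Finset.single_le_sum (f := fun i => ∑ j, |(b.repr (u i) j : ℝ)|)
            (fun i _ => Finset.sum_nonneg fun j _ => abs_nonneg _) (Finset.mem_univ i)
      _ ≤ d := by
          rw [mul_div_assoc', div_le_iff₀ (by positivity)]
          nlinarith
  have h0 : ∀ i, w i = 0 → φ (u i) = 0 := fun i hi => by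
    rw [show u i = 0 from Subtype.ext hi, map_zero]
  have hpos : ∀ i, 0 ≤ φ (u i) := by
    intro i
    by_cases hi : w i = 0
    · rw [h0 i hi]
    · have h1 := (abs_le.1 (hφ i)).1
      have h2 := hd1 i hi
      have : (0 : ℝ) ≤ φ (u i) := by linarith
      exact_mod_cast this
  let M : ℕ := ∏ i, (φ (u i)).den
  have hM : 0 < M := Finset.prod_pos fun i _ => (φ (u i)).den_pos
  have hp : ∀ i, ∃ n : ℕ, (n : ℚ) = φ (u i) * M := by
    intro i
    obtain ⟨k, hk⟩ : (φ (u i)).den ∣ M := Finset.dvd_prod_of_mem _ (Finset.mem_univ i)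
    refine ⟨(φ (u i)).num.toNat * k, ?_⟩
    have h1 : (((φ (u i)).num.toNat : ℤ) : ℚ) = (φ (u i)).num := by
      rw [Int.toNat_of_nonneg (Rat.num_nonneg.2 (hpos i))]
    rw [hk]
    push_cast at h1 ⊢
    rw [h1, ← mul_assoc, Rat.mul_den_eq_num]
  choose p hp using hp
  have hMq : (M : ℚ) ≠ 0 := by exact_mod_cast hM.ne'
  refine ⟨M, p, hM, fun i => ?_, fun i hi => ?_, fun A B hAB => ?_⟩
  · have : (p i : ℝ) / M = φ (u i) := by
      rw [div_eq_iff (by exact_mod_cast hM.ne')]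
      exact_mod_cast hp i
    rw [this]
    exact (hφ i).trans hd2.le
  · have := hp i
    rw [h0 i hi, zero_mul] at this
    exact_mod_cast this
  · have hu : ∑ i ∈ A, u i = ∑ i ∈ B, u i := Subtype.ext (by
      rw [Submodule.coe_sum, Submodule.coe_sum]
      exact hAB)
    have := congrArg φ hu
    rw [map_sum, map_sum] at this
    have : (∑ i ∈ A, (p i : ℚ)) = ∑ i ∈ B, (p i : ℚ) := by
      rw [Finset.sum_congr rfl fun i _ => hp i, Finset.sum_congr rfl fun i _ => hp i,
        ← Finset.sum_mul, ← Finset.sum_mul, this]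
    exact_mod_cast this

theorem exists_equiv_of_card_fiber {α β γ : Type*} [Finite α] [Finite β] {f : α → γ} {g : β → γ}
    (h : ∀ c, Nat.card {a // f a = c} = Nat.card {b // g b = c}) :
    ∃ e : α ≃ β, ∀ a, g (e a) = f a := by
  let e : ∀ c, {a // f a = c} ≃ {b // g b = c} := fun c =>
    (Finite.card_eq.1 (h c)).some
  refine ⟨(Equiv.sigmaFiberEquiv f).symm.trans
    ((Equiv.sigmaCongrRight e).trans (Equiv.sigmaFiberEquiv g)), fun a => ?_⟩
  exact (e (f a) ⟨a, rfl⟩).2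

theorem card_sigma_fin {ι : Type*} [Fintype ι] (p : ι → ℕ) (A : ι → Prop) [DecidablePred A] :
    Nat.card {v : Σ i, Fin (p i) // A v.1} = ∑ i with A i, p i := by
  classical
  rw [Nat.card_eq_fintype_card, Fintype.card_subtype, Finset.card_filter, Fintype.sum_sigma,
    Finset.sum_filter]
  refine Finset.sum_congr rfl fun i _ => ?_
  split_ifs <;> simp

namespace SCurr

theorem setOf_type_eq_biUnion (r : ℕ) (A : Set (F N) → Prop) [DecidablePred A] :
    {S : ClosedSubsets N | 1 ∈ conv S.1 ∧ A (conv S.1 ∩ ball N r)} =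
      ⋃ Q ∈ (types N r).filter A, typeClass r Q := by
  ext S
  simp only [Set.mem_iUnion, Finset.mem_filter, exists_prop]
  constructor
  · rintro ⟨h1, hA⟩
    exact ⟨_, ⟨inter_mem_types r _, hA⟩, h1, rfl⟩
  · rintro ⟨Q, ⟨_, hA⟩, h1, rfl⟩
    exact ⟨h1, hA⟩

theorem measurableSet_type (r : ℕ) (A : Set (F N) → Prop) :
    MeasurableSet {S : ClosedSubsets N | 1 ∈ conv S.1 ∧ A (conv S.1 ∩ ball N r)} := by
  classical
  rw [setOf_type_eq_biUnion]
  exact Finset.measurableSet_biUnion _ fun Q _ => (isClopen_typeClass r Q).1.measurableSet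

theorem sum_typeClass (μ : SCurr N) (r : ℕ) (A : Set (F N) → Prop) [DecidablePred A] :
    ∑ Q ∈ types N r with A Q, (μ.1 (typeClass r Q)).toReal =
      (μ.1 {S | 1 ∈ conv S.1 ∧ A (conv S.1 ∩ ball N r)}).toReal := by
  rw [← ENNReal.toReal_sum fun P _ => typeClass_ne_top μ r P, ← measure_biUnion_finset
    (fun P _ P' _ h => typeClass_disjoint r h) fun P _ => (isClopen_typeClass r P).1.measurableSet,
    setOf_type_eq_biUnion]

-- The equations for gluing along the generator `a`: translation by a⁻¹ exchanges the hulls through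
-- the edge from 1 to `a` with those through the edge from a⁻¹ to 1, and `τ` is the part of the
-- pattern in the overlap of the balls around 1 and `a`, seen from either end.
open Classical in
theorem sum_typeClass_edge (μ : SCurr N) {r : ℕ} (hr : 1 ≤ r) (a : Fin N) (τ : Set (F N)) :
    ∑ Q ∈ types N r with FreeGroup.of a ∈ Q ∧ {h | h ∈ Q ∧ (FreeGroup.of a)⁻¹ * h ∈ ball N r} = τ,
        (μ.1 (typeClass r Q)).toReal =
      ∑ Q ∈ types N r with (FreeGroup.of a)⁻¹ ∈ Q ∧
        {h | (FreeGroup.of a)⁻¹ * h ∈ Q ∧ h ∈ ball N r} = τ, (μ.1 (typeClass r Q)).toReal := by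
  refine (sum_typeClass μ r fun Q => _ ∧ _).trans
    (Eq.trans ?_ (sum_typeClass μ r fun Q => _ ∧ _).symm)
  rw [← measure_preimage_smul μ (FreeGroup.of a)⁻¹ (measurableSet_type r fun Q =>
    (FreeGroup.of a)⁻¹ ∈ Q ∧ {h | (FreeGroup.of a)⁻¹ * h ∈ Q ∧ h ∈ ball N r} = τ)]
  congr 2
  ext S
  have ha : FreeGroup.of a ∈ ball N r := by
    rw [ball, Set.mem_ofPred_eq]
    exact (norm_lt (a, true)).le.trans hr
  have ha' : (FreeGroup.of a)⁻¹ ∈ ball N r := by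
    rw [ball, Set.mem_ofPred_eq, FreeGroup.norm_inv_eq]
    exact ha
  have e : {h | h ∈ conv S.1 ∩ ball N r ∧ (FreeGroup.of a)⁻¹ * h ∈ ball N r} =
      {h | (FreeGroup.of a)⁻¹ * h ∈ conv ((FreeGroup.of a)⁻¹ • S).1 ∩ ball N r ∧ h ∈ ball N r} := by
    ext h
    rw [Set.mem_ofPred_eq, Set.mem_ofPred_eq, Set.mem_inter_iff, Set.mem_inter_iff, mem_conv_smul,
      inv_inv, mul_inv_cancel_left]
    exact and_right_comm
  rw [Set.mem_ofPred_eq, Set.mem_ofPred_eq, Set.mem_ofPred_eq, e, Set.mem_inter_iff,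
    Set.mem_inter_iff, mem_conv_smul, mem_conv_smul, inv_inv, mul_one, mul_inv_cancel,
    and_iff_left ha, and_iff_left ha', and_left_comm]

/-- The subset currents spanned by the counting currents. -/
def countingSpan (N : ℕ) : Submodule ℝ≥0 (SCurr N) :=
  Submodule.span ℝ≥0 {η : SCurr N | ∃ (H : Subgroup (F N)) (hH : H.FG), η = countingCurrent H hH}

/-- Take `p Q` vertices of pattern `Q`. For each generator the equations match the vertices with an
outgoing edge to those with an incoming one, with equal overlaps. Extending the matchings to
permutations gives an action of the free group, with no relation to check. -/
theorem exists_isGluing (μ : SCurr N) {R : ℕ} (hR : 1 ≤ R) (p : types N R → ℕ)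
    (hp : ∀ Q, (μ.1 (typeClass R Q.1)).toReal = 0 → p Q = 0)
    (hs : ∀ A B : Finset (types N R), ∑ Q ∈ A, (μ.1 (typeClass R Q.1)).toReal =
      ∑ Q ∈ B, (μ.1 (typeClass R Q.1)).toReal → ∑ Q ∈ A, p Q = ∑ Q ∈ B, p Q) :
    ∃ _ : MulAction (F N) (Σ Q, Fin (p Q)), IsGluing R fun v : Σ Q, Fin (p Q) => v.1.1 := by
  classical
  let V := Σ Q, Fin (p Q)
  let P : V → Set (F N) := fun v => v.1.1
  -- Patterns not realized by any hull have mass zero and hence no vertices; so every pattern in use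
  -- inherits convexity and two directions from a hull.
  have hreal : ∀ v : V, ∃ S : ClosedSubsets N, 1 ∈ conv S.1 ∧ conv S.1 ∩ ball N R = P v := by
    intro v
    by_contra hne
    have hempty : typeClass R (P v) = ∅ := Set.eq_empty_iff_forall_notMem.2 fun S hS => hne ⟨S, hS⟩
    have := hp v.1 (by
      change (μ.1 (typeClass R (P v))).toReal = 0
      rw [hempty, measure_empty, ENNReal.toReal_zero])
    exact (this ▸ v.2).elim0
  have hcard : ∀ (a : Fin N) (τ : Set (F N)),
      Nat.card {x : {v : V // FreeGroup.of a ∈ P v} //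
        {h | h ∈ P x.1 ∧ (FreeGroup.of a)⁻¹ * h ∈ ball N R} = τ} =
      Nat.card {x : {v : V // (FreeGroup.of a)⁻¹ ∈ P v} //
        {h | (FreeGroup.of a)⁻¹ * h ∈ P x.1 ∧ h ∈ ball N R} = τ} := by
    intro a τ
    rw [Nat.card_congr (Equiv.subtypeSubtypeEquivSubtypeInter (fun v : V => FreeGroup.of a ∈ P v)
        fun v => {h | h ∈ P v ∧ (FreeGroup.of a)⁻¹ * h ∈ ball N R} = τ),
      Nat.card_congr (Equiv.subtypeSubtypeEquivSubtypeInter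
        (fun v : V => (FreeGroup.of a)⁻¹ ∈ P v)
        fun v => {h | (FreeGroup.of a)⁻¹ * h ∈ P v ∧ h ∈ ball N R} = τ)]
    refine (card_sigma_fin p fun Q => FreeGroup.of a ∈ Q.1 ∧
      {h | h ∈ Q.1 ∧ (FreeGroup.of a)⁻¹ * h ∈ ball N R} = τ).trans
      (Eq.trans (hs _ _ ?_) (card_sigma_fin p fun Q => (FreeGroup.of a)⁻¹ ∈ Q.1 ∧
      {h | (FreeGroup.of a)⁻¹ * h ∈ Q.1 ∧ h ∈ ball N R} = τ).symm)
    have := sum_typeClass_edge μ hR a τ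
    rw [Finset.sum_filter, Finset.sum_filter, ← Finset.sum_coe_sort,
      ← Finset.sum_coe_sort (types N R)] at this
    rw [Finset.sum_filter, Finset.sum_filter]
    exact this
  choose e he using fun a => exists_equiv_of_card_fiber (hcard a)
  -- The extension sends the complement to the complement, so no incoming edge arises at the image
  -- of a vertex without an outgoing one.
  let σ : Fin N → Equiv.Perm V := fun a => (e a).extendSubtype
  let ρ : F N →* Equiv.Perm V := FreeGroup.lift fun a => (σ a)⁻¹
  let act : MulAction (F N) V := MulAction.compHom V ρ
  have hof : ∀ a (v : V), FreeGroup.of a • σ a v = v := fun a v => by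
    change ρ (FreeGroup.of a) (σ a v) = v
    rw [show ρ (FreeGroup.of a) = (σ a)⁻¹ from FreeGroup.lift_apply_of]
    exact (σ a).symm_apply_apply v
  have hinv : ∀ a (v : V), (FreeGroup.of a)⁻¹ • v = σ a v := fun a v => by
    rw [inv_smul_eq_iff, hof]
  have hsub : ∀ v, P v ⊆ ball N R := fun v h hh => by
    obtain ⟨S, _, hS⟩ := hreal v
    rw [← hS] at hh
    exact hh.2
  have hglue : ∀ a v, FreeGroup.of a ∈ P v → ∀ h, h ∈ ball N R → (FreeGroup.of a)⁻¹ * h ∈ ball N R →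
      (h ∈ P v ↔ (FreeGroup.of a)⁻¹ * h ∈ P (σ a v)) := by
    intro a v hv h hb hb'
    have := Set.ext_iff.1 (he a ⟨v, hv⟩) h
    simp only [Set.mem_ofPred_eq, hb, hb', and_true] at this
    rw [← this, show σ a v = (e a ⟨v, hv⟩).1 from Equiv.extendSubtype_apply_of_mem (e a) v hv]
  have hnot : ∀ a v, (FreeGroup.of a)⁻¹ ∈ P (σ a v) → FreeGroup.of a ∈ P v := by
    intro a v h
    by_contra hv
    exact (e a).extendSubtype_not_mem v hv h
  refine ⟨act, hR, ?_, ?_, hsub, ?_, ?_⟩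
  · intro v x l hr h
    change _ ∈ P v at h
    change _ ∈ P v
    obtain ⟨S, h1, hS⟩ := hreal v
    rw [← hS] at h ⊢
    refine ⟨?_, ?_⟩
    · have := isConvex_conv S.1 1 h1 x l hr (by rw [one_mul]; exact h.1)
      rwa [one_mul] at this
    · rw [ball, Set.mem_ofPred_eq, norm_lt]
      exact hR
  · intro v
    change _ ∈ P v
    obtain ⟨S, h1, hS⟩ := hreal v
    rw [← hS]
    exact ⟨h1, by simp [ball]⟩
  · intro v
    change ∃ x y, x ≠ y ∧ lt x ∈ P v ∧ lt y ∈ P v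
    obtain ⟨S, h1, hS⟩ := hreal v
    have hb : ∀ x : Letter N, lt x ∈ ball N R := fun x => by
      rw [ball, Set.mem_ofPred_eq, norm_lt]
      exact hR
    obtain ⟨ξ, hξ, ζ, hζ, hne⟩ := h1
    rw [inv_one, one_smul, one_smul] at hne
    have h1 : 1 ∈ conv S.1 := ⟨ξ, hξ, ζ, hζ, by rwa [inv_one, one_smul, one_smul]⟩
    rw [← hS]
    refine ⟨ξ.1 0, ζ.1 0, hne, ⟨?_, hb _⟩, ⟨?_, hb _⟩⟩
    · rw [← Boundary.pre_one]
      exact pre_mem_conv h1 hξ 1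
    · rw [← Boundary.pre_one]
      exact pre_mem_conv h1 hζ 1
  · rintro v ⟨a, b⟩ hx h hb hb'
    change _ ∈ P v at hx
    change h ∈ P v ↔ _ ∈ P _
    cases b
    · change (FreeGroup.of a)⁻¹ ∈ P v at hx
      change (FreeGroup.of a)⁻¹⁻¹ * h ∈ ball N R at hb'
      change h ∈ P v ↔ (FreeGroup.of a)⁻¹⁻¹ * h ∈ P ((FreeGroup.of a)⁻¹⁻¹ • v)
      obtain ⟨v, rfl⟩ := (σ a).surjective v
      rw [inv_inv] at hb' ⊢
      rw [hof]
      have := hglue a v (hnot a v hx) (FreeGroup.of a * h) hb' (by rwa [inv_mul_cancel_left])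
      rw [inv_mul_cancel_left] at this
      exact this.symm
    · change FreeGroup.of a ∈ P v at hx
      change (FreeGroup.of a)⁻¹ * h ∈ ball N R at hb'
      change h ∈ P v ↔ (FreeGroup.of a)⁻¹ * h ∈ P ((FreeGroup.of a)⁻¹ • v)
      rw [hinv]
      exact hglue a v hx h hb hb'

/-- The graph glued from the numerators realizes the rational masses exactly after division by the
common denominator `M`. -/
theorem dense_countingSpan : Dense (countingSpan N : Set (SCurr N)) := by
  intro μ
  refine mem_closure_of_approx fun R hR δ hδ => ?_
  obtain ⟨M, p, hM, hMp, hp0, hps⟩ := exists_nat_approx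
    (w := fun Q : types N R => (μ.1 (typeClass R Q.1)).toReal) (fun _ => ENNReal.toReal_nonneg) hδ
  obtain ⟨_, hP⟩ := exists_isGluing μ hR p hp0 hps
  obtain ⟨ν, hν, hνQ⟩ := hP.exists_current
  refine ⟨(M : ℝ≥0)⁻¹ • ν, Submodule.smul_mem _ _ hν, fun Q => ?_⟩
  have hval : (((M : ℝ≥0)⁻¹ • ν).1 (typeClass R Q)).toReal =
      ({v : Σ Q, Fin (p Q) | v.1.1 = Q}.ncard : ℝ) / M := by
    rw [Submodule.coe_smul, Measure.smul_apply, hνQ, ENNReal.smul_def, smul_eq_mul,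
      ENNReal.toReal_mul, div_eq_inv_mul]
    rw [← (Set.toFinite {v : Σ Q, Fin (p Q) | v.1.1 = Q}).cast_ncard_eq, ENat.toENNReal_coe,
      ENNReal.toReal_natCast, ENNReal.coe_toReal, NNReal.coe_inv, NNReal.coe_natCast]
  rw [hval]
  by_cases hQ : Q ∈ types N R
  · have : {v : Σ Q, Fin (p Q) | v.1.1 = Q}.ncard = p ⟨Q, hQ⟩ := by
      classical
      have := card_sigma_fin p fun Q' => Q' = ⟨Q, hQ⟩
      rw [Finset.sum_filter, Finset.sum_ite_eq' Finset.univ, if_pos (Finset.mem_univ _)] at this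
      rw [← this, ← Nat.card_coe_set_eq]
      refine Nat.card_congr (Equiv.subtypeEquivRight fun v => ?_)
      rw [Set.mem_ofPred_eq, Subtype.ext_iff]
    rw [this]
    exact hMp ⟨Q, hQ⟩
  · have h1 : {v : Σ Q, Fin (p Q) | v.1.1 = Q} = ∅ := by
      refine Set.eq_empty_iff_forall_notMem.2 ?_
      rintro v rfl
      exact hQ v.1.2
    have h2 : typeClass R Q = ∅ := by
      refine Set.eq_empty_iff_forall_notMem.2 ?_
      rintro S ⟨_, rfl⟩
      exact hQ (inter_mem_types R _)
    rw [h1, h2]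
    simpa using hδ.le

end SCurr

/-! ### The form Ê - V̂ + ĉ: non-negativity and uniqueness -/

theorem productN_lt_top {H K : Subgroup (F N)} (hH : H.FG) (hK : K.FG) : productN H K < ∞ := by
  refine lt_of_le_of_lt le_self_add ((productN_add_vHat hH hK).trans_lt ?_)
  exact ENNReal.add_lt_top.2 ⟨SCurr.eHat_lt_top _ _, SCurr.cHat_lt_top _ _⟩

namespace SCurr

/-- The bilinear form `Ê - V̂ + ĉ`. -/
def eulerForm (μ ν : SCurr N) : ℝ :=
  (eHat μ ν).toReal - (vHat μ ν).toReal + (cHat μ ν).toReal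

theorem eulerForm_add (μ μ' ν : SCurr N) :
    eulerForm (μ + μ') ν = eulerForm μ ν + eulerForm μ' ν := by
  rw [eulerForm, eulerForm, eulerForm, eHat_add, vHat_add, cHat_add,
    ENNReal.toReal_add (eHat_lt_top _ _).ne (eHat_lt_top _ _).ne,
    ENNReal.toReal_add (vHat_lt_top _ _).ne (vHat_lt_top _ _).ne,
    ENNReal.toReal_add (cHat_lt_top _ _).ne (cHat_lt_top _ _).ne]
  ring

theorem eulerForm_smul (c : ℝ≥0) (μ ν : SCurr N) :
    eulerForm (c • μ) ν = c * eulerForm μ ν := by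
  rw [eulerForm, eulerForm, eHat_smul, vHat_smul, cHat_smul, ENNReal.toReal_mul,
    ENNReal.toReal_mul, ENNReal.toReal_mul, ENNReal.coe_toReal]
  ring

theorem eulerForm_comm (μ ν : SCurr N) : eulerForm μ ν = eulerForm ν μ := by
  rw [eulerForm, eHat_comm, vHat_comm, cHat_comm, eulerForm]

theorem eulerForm_zero (ν : SCurr N) : eulerForm 0 ν = 0 := by
  simpa using eulerForm_smul 0 0 ν

theorem continuous_eulerForm : Continuous fun p : SCurr N × SCurr N => eulerForm p.1 p.2 :=
  (continuous_eHat.sub continuous_vHat).add continuous_cHat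

theorem eulerForm_counting {H K : Subgroup (F N)} (hH : H.FG) (hK : K.FG) :
    eulerForm (countingCurrent H hH) (countingCurrent K hK) = (productN H K).toReal := by
  have := congrArg ENNReal.toReal (productN_add_vHat hH hK)
  rw [ENNReal.toReal_add (productN_lt_top hH hK).ne (vHat_lt_top _ _).ne,
    ENNReal.toReal_add (eHat_lt_top _ _).ne (cHat_lt_top _ _).ne] at this
  rw [eulerForm]
  linarith

theorem closed_property {p : SCurr N → SCurr N → Prop}
    (hc : IsClosed {x : SCurr N × SCurr N | p x.1 x.2})
    (h : ∀ μ ∈ countingSpan N, ∀ ν ∈ countingSpan N, p μ ν) (μ ν : SCurr N) : p μ ν := by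
  have hd := (dense_countingSpan (N := N)).prod (dense_countingSpan (N := N))
  have := closure_minimal (s := (countingSpan N : Set (SCurr N)) ×ˢ (countingSpan N : Set (SCurr N)))
    (fun x hx => h x.1 hx.1 x.2 hx.2) hc
  exact this (hd (μ, ν))

/-- The sign is not visible in the formula. At counting currents the value is a sum of reduced
ranks; bilinearity and density carry non-negativity over to all currents. -/
theorem eulerForm_nonneg (μ ν : SCurr N) : 0 ≤ eulerForm μ ν := by
  have key : ∀ (s : Set (SCurr N)) (ν : SCurr N), (∀ μ ∈ s, 0 ≤ eulerForm μ ν) →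
      ∀ μ ∈ Submodule.span ℝ≥0 s, 0 ≤ eulerForm μ ν := by
    intro s ν hs μ hμ
    induction hμ using Submodule.span_induction with
    | mem x hx => exact hs x hx
    | zero => rw [eulerForm_zero]
    | add x y _ _ hx hy => rw [eulerForm_add]; exact add_nonneg hx hy
    | smul c x _ hx => rw [eulerForm_smul]; exact mul_nonneg c.2 hx
  refine closed_property (p := fun μ ν => 0 ≤ eulerForm μ ν)
    (isClosed_le continuous_const continuous_eulerForm) (fun μ hμ ν hν => ?_) μ ν
  refine key _ ν ?_ μ hμ
  rintro _ ⟨H, hH, rfl⟩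
  rw [eulerForm_comm]
  refine key _ _ ?_ ν hν
  rintro _ ⟨K, hK, rfl⟩
  rw [eulerForm_counting]
  exact ENNReal.toReal_nonneg

/-- The intersection functional. -/
def intersection (N : ℕ) : SCurr N →ₗ[ℝ≥0] SCurr N →ₗ[ℝ≥0] ℝ≥0 :=
  LinearMap.mk₂ ℝ≥0 (fun μ ν => ⟨eulerForm μ ν, eulerForm_nonneg μ ν⟩)
    (fun μ μ' ν => NNReal.eq (eulerForm_add μ μ' ν))
    (fun c μ ν => NNReal.eq (eulerForm_smul c μ ν))
    (fun μ ν ν' => NNReal.eq (by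
      change eulerForm _ _ = eulerForm _ _ + eulerForm _ _
      rw [eulerForm_comm, eulerForm_add, eulerForm_comm ν, eulerForm_comm ν']))
    (fun c μ ν => NNReal.eq (by
      change eulerForm _ _ = c * eulerForm _ _
      rw [eulerForm_comm, eulerForm_smul, eulerForm_comm ν]))

theorem isIntersectionFunctional_intersection :
    IsIntersectionFunctional (fun _ : Subgroup (F N) => countingMeasure_mem) (intersection N) where
  continuous := continuous_eulerForm.subtype_mk _
  symm μ ν := NNReal.eq (eulerForm_comm μ ν)
  counting H K hH hK := by
    rw [← ENNReal.toReal_eq_toReal_iff' ENNReal.coe_ne_top (productN_lt_top hH hK).ne,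
      ENNReal.coe_toReal]
    exact eulerForm_counting hH hK

theorem intersectionFunctional_unique {B B' : SCurr N →ₗ[ℝ≥0] SCurr N →ₗ[ℝ≥0] ℝ≥0}
    (hB : IsIntersectionFunctional (fun _ : Subgroup (F N) => countingMeasure_mem) B)
    (hB' : IsIntersectionFunctional (fun _ : Subgroup (F N) => countingMeasure_mem) B') :
    B' = B := by
  refine LinearMap.ext₂ fun μ ν => ?_
  refine closed_property (p := fun μ ν => B' μ ν = B μ ν)
    (isClosed_eq hB'.continuous hB.continuous) (fun μ hμ ν hν => ?_) μ ν
  have h1 : Set.EqOn (B'.flip ν) (B.flip ν) (countingSpan N) := by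
    refine LinearMap.eqOn_span' ?_
    rintro _ ⟨H, hH, rfl⟩
    have h2 : Set.EqOn (B' (countingCurrent H hH)) (B (countingCurrent H hH)) (countingSpan N) := by
      refine LinearMap.eqOn_span' ?_
      rintro _ ⟨K, hK, rfl⟩
      exact ENNReal.coe_injective ((hB'.counting H K hH hK).trans (hB.counting H K hH hK).symm)
    exact h2 hν
  exact h1 hμ

end SCurr

/-! ### Invariance under automorphisms -/

section Automorphism

theorem limitSet_map (φ : MulAut (F N)) (H : Subgroup (F N)) :
    limitSet (H.map φ.toMonoidHom) = (φ • ·) '' limitSet H := by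
  have key : ∀ (φ : MulAut (F N)) (H : Subgroup (F N)),
      (φ • ·) '' limitSet H ⊆ limitSet (H.map φ.toMonoidHom) := by
    rintro φ H _ ⟨ξ, ⟨u, hu, hc⟩, rfl⟩
    exact ⟨fun k => φ (u k), fun k => ⟨u k, hu k, rfl⟩, mulAut_boundary_spec hc⟩
  refine Set.Subset.antisymm (fun ξ hξ => ⟨φ⁻¹ • ξ, ?_, smul_inv_smul φ ξ⟩) (key φ H)
  have := key φ⁻¹ _ ⟨ξ, hξ, rfl⟩
  rw [Subgroup.map_map] at this
  convert this
  conv_lhs => rw [← H.map_id]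
  congr 1
  exact MonoidHom.ext fun x => (φ.symm_apply_apply x).symm

theorem map_eq_bot_iff {φ : MulAut (F N)} {H : Subgroup (F N)} :
    H.map φ.toMonoidHom = ⊥ ↔ H = ⊥ :=
  Subgroup.map_eq_bot_iff_of_injective _ φ.injective

/-- The bijection `gH ↦ φ(g)φ(H)`. -/
def cosetMap (φ : MulAut (F N)) (H : Subgroup (F N)) :
    F N ⧸ H ≃ F N ⧸ H.map φ.toMonoidHom :=
  Quotient.congr φ.toEquiv fun a b => by
    change QuotientGroup.leftRel H a b ↔ QuotientGroup.leftRel (H.map φ.toMonoidHom) (φ a) (φ b)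
    rw [QuotientGroup.leftRel_apply, QuotientGroup.leftRel_apply, ← map_inv, ← map_mul]
    exact (Subgroup.mem_map_iff_mem (f := φ.toMonoidHom) φ.injective).symm

theorem cosetLimit_cosetMap (φ : MulAut (F N)) {H : Subgroup (F N)} (h : H ≠ ⊥)
    (h' : H.map φ.toMonoidHom ≠ ⊥) (q : F N ⧸ H) :
    cosetLimit (H.map φ.toMonoidHom) h' (cosetMap φ H q) = φ • cosetLimit H h q := by
  induction q using QuotientGroup.induction_on with
  | H g =>
    rw [cosetLimit_mk, closedSubsets_smul_smul_eq]
    change φ g • limitPoint _ h' = _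
    congr 1
    exact Subtype.ext (limitSet_map φ H)

theorem fg_map (φ : MulAut (F N)) {H : Subgroup (F N)} (hH : H.FG) :
    (H.map φ.toMonoidHom).FG := by
  classical
  obtain ⟨s, hs⟩ := hH
  refine ⟨s.image φ, ?_⟩
  rw [Finset.coe_image, ← hs, MonoidHom.map_closure]
  rfl

/-- The bijection `cosetMap` of cosets carries the translates of Λ(H) to their images under `φ`. -/
theorem smul_countingCurrent (φ : MulAut (F N)) {H : Subgroup (F N)} (hH : H.FG) :
    φ • countingCurrent H hH = countingCurrent (H.map φ.toMonoidHom) (fg_map φ hH) := by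
  apply Subtype.ext
  change (countingMeasure H).map (φ • ·) = countingMeasure (H.map φ.toMonoidHom)
  by_cases h : H = ⊥
  · subst h
    rw [Subgroup.map_bot, countingMeasure_bot, Measure.map_zero]
  have h' : H.map φ.toMonoidHom ≠ ⊥ := fun e => h (map_eq_bot_iff.1 e)
  ext A hA
  have hm := measurable_smul_closedSubsets φ
  rw [Measure.map_apply hm hA, countingMeasure_apply hH h (hm hA),
    countingMeasure_apply (fg_map φ hH) h' hA, ← (cosetMap φ H).injective.encard_image]
  congr 2
  ext q
  obtain ⟨q, rfl⟩ := (cosetMap φ H).surjective q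
  rw [(cosetMap φ H).injective.mem_set_image, Set.mem_ofPred_eq, Set.mem_ofPred_eq,
    cosetLimit_cosetMap φ h h']
  rfl

theorem map_conj (φ : MulAut (F N)) (g : F N) (K : Subgroup (F N)) :
    (conj g K).map φ.toMonoidHom = conj (φ g) (K.map φ.toMonoidHom) := by
  rw [conj, conj, Subgroup.map_map, Subgroup.map_map]
  congr 1
  ext x
  simp

theorem reducedRank_map (φ : MulAut (F N)) (H : Subgroup (F N)) :
    reducedRank (H.map φ.toMonoidHom) = reducedRank H := by
  rw [reducedRank_eq, reducedRank_eq, freeRank_map]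

theorem reducedRank_inf_conj_eq {H K : Subgroup (F N)} {g g' : F N}
    (h : DoubleCoset.mk H K g = DoubleCoset.mk H K g') :
    reducedRank (H ⊓ conj g K) = reducedRank (H ⊓ conj g' K) := by
  obtain ⟨k, hk⟩ := (mem_orbit_iff (H := H) (K := K) 1 g g').2 (by rwa [inv_one, one_mul])
  rw [← stabilizer_pair, ← stabilizer_pair, reducedRank_eq, reducedRank_eq, ← hk]
  congr 1
  exact freeRank_stabilizer_smul _ k

theorem productN_map (φ : MulAut (F N)) (H K : Subgroup (F N)) :
    productN (H.map φ.toMonoidHom) (K.map φ.toMonoidHom) = productN H K := by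
  let e : DoubleCoset.Quotient (H : Set (F N)) (K : Set (F N)) ≃
      DoubleCoset.Quotient (H.map φ.toMonoidHom : Set (F N)) (K.map φ.toMonoidHom : Set (F N)) :=
    Quotient.congr φ.toEquiv fun a b => by
      change DoubleCoset.setoid _ _ a b ↔ DoubleCoset.setoid _ _ (φ a) (φ b)
      rw [DoubleCoset.rel_iff, DoubleCoset.rel_iff]
      constructor
      · rintro ⟨h, hh, k, hk, rfl⟩
        exact ⟨φ h, ⟨h, hh, rfl⟩, φ k, ⟨k, hk, rfl⟩, by rw [map_mul, map_mul]⟩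
      · rintro ⟨_, ⟨h, hh, rfl⟩, _, ⟨k, hk, rfl⟩, e⟩
        refine ⟨h, hh, k, hk, φ.injective ?_⟩
        rw [map_mul, map_mul]
        exact e
  rw [productN, productN, ← e.tsum_eq]
  refine tsum_congr fun D => ?_
  rw [← reducedRank_map φ (H ⊓ conj D.out K), Subgroup.map_inf _ _ _ φ.injective, map_conj]
  congr 1
  apply reducedRank_inf_conj_eq
  rw [DoubleCoset.out_eq']
  conv_lhs => rw [← DoubleCoset.out_eq' H K D]
  rfl

/-- The action of an automorphism on subset currents as a linear map. -/
def autLinear (φ : MulAut (F N)) : SCurr N →ₗ[ℝ≥0] SCurr N where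
  toFun μ := φ • μ
  map_add' _ _ := Subtype.ext (Measure.map_add _ _ (measurable_smul_closedSubsets φ))
  map_smul' c _ := Subtype.ext (Measure.map_smul c _ _)

theorem continuous_autLinear (φ : MulAut (F N)) : Continuous (autLinear φ) := by
  refine continuous_induced_rng.2 (continuous_pi fun f => ?_)
  let f' : C_c(ClosedSubsets N, ℝ) :=
    ⟨⟨fun S => f (φ • S), f.continuous.comp (continuous_const_smul φ)⟩,
      f.hasCompactSupport.comp_homeomorph (Homeomorph.smul φ)⟩
  have : ∀ μ : SCurr N, ∫ S, f S ∂(autLinear φ μ).1 = ∫ S, f' S ∂μ.1 := fun μ =>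
    MeasurableEmbedding.integral_map (Homeomorph.smul φ).measurableEmbedding f
  change Continuous fun μ : SCurr N => ∫ S, f S ∂(autLinear φ μ).1
  simp only [this]
  have hc : Continuous fun (μ : SCurr N) (g : C_c(ClosedSubsets N, ℝ)) => ∫ S, g S ∂μ.1 :=
    continuous_induced_dom
  exact continuous_pi_iff.1 hc f'

theorem isIntersectionFunctional_compl {B : SCurr N →ₗ[ℝ≥0] SCurr N →ₗ[ℝ≥0] ℝ≥0}
    (h : IsIntersectionFunctional (fun _ : Subgroup (F N) => countingMeasure_mem) B)
    (φ : MulAut (F N)) :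
    IsIntersectionFunctional (fun _ : Subgroup (F N) => countingMeasure_mem)
      (B.compl₁₂ (autLinear φ) (autLinear φ)) where
  continuous := by
    simp only [LinearMap.compl₁₂_apply]
    exact h.continuous.comp ((continuous_autLinear φ).prodMap (continuous_autLinear φ))
  symm μ ν := by
    simp only [LinearMap.compl₁₂_apply]
    exact h.symm _ _
  counting H K hH hK := by
    rw [LinearMap.compl₁₂_apply, ← productN_map φ,
      ← h.counting _ _ (fg_map φ hH) (fg_map φ hK)]
    congr 2
    · exact congrArg B (smul_countingCurrent φ hH)
    · exact smul_countingCurrent φ hK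

/-- The terms Ê, V̂ and ĉ refer to the chosen basis, so invariance is not apparent from them. But
the functional pulled back by `φ` has the same defining properties, and uniqueness applies. -/
theorem SCurr.intersection_smul (φ : MulAut (F N)) (μ ν : SCurr N) :
    intersection N (φ • μ) (φ • ν) = intersection N μ ν := by
  have h := isIntersectionFunctional_intersection (N := N)
  have := intersectionFunctional_unique h (isIntersectionFunctional_compl h φ)
  have := LinearMap.congr_fun₂ this μ ν
  rw [LinearMap.compl₁₂_apply] at this
  exact this

end Automorphism

end FreeCurr

end

theorem theorem3p2 (N : ℕ) (hN : 2 ≤ N) :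
    ∃ hη : ∀ H : Subgroup (F N), H.FG → countingMeasure H ∈ subsetCurrents N,
    ∃ B : SCurr N →ₗ[ℝ≥0] SCurr N →ₗ[ℝ≥0] ℝ≥0,
      IsIntersectionFunctional hη B ∧
      (∀ B' : SCurr N →ₗ[ℝ≥0] SCurr N →ₗ[ℝ≥0] ℝ≥0, IsIntersectionFunctional hη B' → B' = B) ∧
      (∀ (Φ : OutF N) (μ ν : SCurr N), B (Φ • μ) (Φ • ν) = B μ ν) ∧
      (∀ μ ν : SCurr N, eHat μ ν < ∞ ∧ vHat μ ν < ∞ ∧ cHat μ ν < ∞ ∧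
        (B μ ν : ℝ) = (eHat μ ν).toReal - (vHat μ ν).toReal + (cHat μ ν).toReal) ∧
      (∀ (H K : Subgroup (F N)) (hH : H.FG) (hK : K.FG),
        cHat ⟨countingMeasure H, hη H hH⟩ ⟨countingMeasure K, hη K hK⟩ =
          (((coreGraph H).fiberProduct (coreGraph K)).numContractible : ℝ≥0∞)) := by
  refine ⟨fun H hH => countingMeasure_mem hH, SCurr.intersection N,
    SCurr.isIntersectionFunctional_intersection,
    fun B' hB' => SCurr.intersectionFunctional_unique SCurr.isIntersectionFunctional_intersection hB',
    fun Φ μ ν => ?_, fun μ ν => ⟨SCurr.eHat_lt_top μ ν, SCurr.vHat_lt_top μ ν,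
      SCurr.cHat_lt_top μ ν, rfl⟩, fun H K hH hK => cHat_eq_numContractible hH hK⟩
  obtain ⟨φ, rfl⟩ := QuotientGroup.mk_surjective Φ
  exact SCurr.intersection_smul φ μ ν
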